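/- **Setting.** Let $w=(w_1,\dots,w_n)\in\mathbb{Q}^n$ with $0<w_i\le 1$ and $\sum_i w_i>2$. A rational $n$-marked tropical curve is a finite metric tree (all bounded edges of positive length) with $n$ marked unbounded ends attached to its vertices. It is *$w$-stable* if at every vertex the sum of the weights of the adjacent ends plus the number of adjacent bounded edges is greater than $2$. $M^{\mathrm{trop}}_{0,w}$ is the cone complex of all isomorphism classes of $w$-stable curves, with one cone (the nonnegative edge lengths, edges of length $0$ being contracted) for each combinatorial type, and $M^{\mathrm{trop}}_{0,n}=M^{\mathrm{trop}}_{0,(1,\dots,1)}$. An index $i$ is *heavy* if $w_i+w_j>1$ for all $j\ne i$. It is *small* if, for all $j\neq i$, $w_i+w_j>1$ implies that $j$ is heavy. It is *light* if it is small and the total weight of all small indices is at most $1$. $w$ is *heavy/light* if every index is heavy or light. For a heavy index $a$ let $G(w)$ be the graph on $\{1,\dots,n\}\setminus\{a\}$ in which $i\ne j$ are adjacent iff $w_i+w_j>1$, with edge set $E$. Let $B'(G(w))\subset\mathbb{R}^{E}/\mathbb{R}(1,\dots,1)$ be the Bergman fan of its cycle matroid modulo $\mathbb{R}(1,\dots,1)$,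 where the Bergman fan is the set of $x\in\mathbb{R}^E$ such that every element of $E$ lies in a basis of minimal $x$-weight. Embed $M^{\mathrm{trop}}_{0,n}$ in $\mathbb{R}^{\binom n2}/\Phi(\mathbb{R}^n)$, $\Phi(x)=(x_i+x_j)_{i<j}$, by the pairwise distances $d_{ij}$ of the ends, and let $\mathrm{pr}_w:\mathbb{R}^{\binom n2}/\Phi(\mathbb{R}^n)\to\mathbb{R}^{E}/\mathbb{R}(1,\dots,1)$ be the linear map $[d]\mapsto[\tfrac12(d_{kl}-d_{ak}-d_{al})_{kl\in E}]$, i.e. the identification of $M^{\mathrm{trop}}_{0,n}$ with the Bergman fan $B'(K_{n-1})$ of the complete graph, followed by forgetting the coordinates of the edges not in $G(w)$. A *tropical (balanced) fan* of dimension $d$ in a real vector space with a lattice is a finite, rational, pure $d$-dimensional polyhedral fan with a positive integer weight on each $d$-dimensional cone such that for every $(d-1)$-dimensional cone $\tau$ the weighted sum of the primitive normal vectors of the $d$-dimensional cones containing $\tau$ lies in the span of $\tau$. A *balanced embedding* of $M^{\mathrm{trop}}_{0,w}$ in a real vector space $V$ is an injective map $M^{\mathrm{trop}}_{0,w}\to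 V$, linear on each cone, whose image is the support of a tropical fan (with respect to some lattice in $V$). **Theorem.** Assume that $w$ has at least two heavy entries. 1. If $w$ is heavy/light and $a$ is any heavy index, then $\mathrm{pr}_w(M^{\mathrm{trop}}_{0,n})=B'(G(w))$; the images under $\mathrm{pr}_w$ of the cones of $M^{\mathrm{trop}}_{0,n}$ form a fan with this support, whose underlying cone complex is $M^{\mathrm{trop}}_{0,w}$: restricted to $M^{\mathrm{trop}}_{0,w}$, $\mathrm{pr}_w$ is injective, linear on each cone, maps the cones of $M^{\mathrm{trop}}_{0,w}$ precisely to the cones of the fan, and maps precisely the curves with integral edge lengths to points of the lattice $\mathbb{Z}^E/\mathbb{Z}(1,\dots,1)$. With all weights equal to $1$ this is a balanced fan of pure dimension $n-3$ with respect to this lattice. 2. If $w$ is not heavy/light, then there is no balanced embedding of $M^{\mathrm{trop}}_{0,w}$ in any real vector space. -/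

import Mathlib

open Set

noncomputable section

namespace WeightedTrop

/-! ### Polyhedral fans and the balancing condition -/

section Fans

variable {V : Type*} [AddCommGroup V] [Module ℝ V]

/-- `N` is a full lattice in `V`: the integral span of some basis of the (finite dimensional)
real vector space `V`. -/
def IsLattice (N : Submodule ℤ V) : Prop :=
  ∃ (m : ℕ) (b : Module.Basis (Fin m) ℝ V), N = Submodule.span ℤ (Set.range b)

/-- The linear span of a cone. -/
def linSpan (σ : PointedCone ℝ V) : Submodule ℝ V := Submodule.span ℝ (σ : Set V)

/-- The dimension of a cone: the dimension of its linear span. -/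
def coneDim (σ : PointedCone ℝ V) : ℕ := Module.finrank ℝ (linSpan σ)

/-- The support of a collection of cones: their union. -/
def support (X : Set (PointedCone ℝ V)) : Set V := {x | ∃ σ ∈ X, x ∈ σ}

/-- `u` is a primitive normal vector of the cone `σ` relative to its facet `τ`: a lattice vector
in `σ` that, together with the lattice vectors in the span of `τ`, generates the lattice of all
lattice vectors in the span of `σ`. -/
def IsPrimitiveNormal (N : Submodule ℤ V) (τ σ : PointedCone ℝ V) (u : V) : Prop :=
  u ∈ N ∧ u ∈ σ ∧ ∀ x ∈ N, x ∈ linSpan σ → ∃ k : ℤ, x - k • u ∈ linSpan τ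

/-- `(X, ω)` is a tropical (balanced) fan of pure dimension `d` in the vector space `V` with
lattice `N`. Only the values of `ω` on the `d`-dimensional cones of `X` matter. -/
structure IsTropicalFan (N : Submodule ℤ V) (X : Set (PointedCone ℝ V)) (d : ℕ)
    (ω : PointedCone ℝ V → ℕ) : Prop where
  lattice : IsLattice N
  finite : X.Finite
  nonempty : X.Nonempty
  rational : ∀ σ ∈ X, ∃ S : Set V, S.Finite ∧ S ⊆ (N : Set V) ∧ σ = PointedCone.hull ℝ S
  face_mem : ∀ σ ∈ X, ∀ F : PointedCone ℝ V, F.IsFaceOf σ → F ∈ X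
  inter_face : ∀ σ ∈ X, ∀ τ ∈ X, (σ ⊓ τ).IsFaceOf σ
  pure : ∀ σ ∈ X, ∃ τ ∈ X, σ ≤ τ ∧ coneDim τ = d
  weight_pos : ∀ σ ∈ X, coneDim σ = d → 0 < ω σ
  balanced : ∀ τ ∈ X, coneDim τ + 1 = d →
    ∃ u : PointedCone ℝ V → V,
      (∀ σ ∈ X, coneDim σ = d → τ ≤ σ → IsPrimitiveNormal N τ σ (u σ)) ∧
      (∑ᶠ σ ∈ {σ | σ ∈ X ∧ coneDim σ = d ∧ τ ≤ σ}, ω σ • u σ) ∈ linSpan τ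

end Fans

/-! ### Graphic matroids and their Bergman fans -/

section Bergman

/-- The Bergman fan of a matroid `M` on the (finite) ground set `E`: all vectors `x` such that the
matroid whose bases are the bases of `M` of minimal `x`-weight has no loops, i.e. such that every
element lies in a basis of minimal `x`-weight. -/
def bergmanFan {E : Type*} [Finite E] (M : Matroid E) : Set (E → ℝ) :=
  {x | ∀ e ∈ M.E, ∃ B : Set E, M.IsBase B ∧ e ∈ B ∧
    ∀ B' : Set E, M.IsBase B' → ∑ᶠ i ∈ B, x i ≤ ∑ᶠ i ∈ B', x i}

variable {W : Type*}

/-- A set of edges of `G` is a forest. -/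
def IsForest (G : SimpleGraph W) (I : Set G.edgeSet) : Prop :=
  (SimpleGraph.fromEdgeSet (Subtype.val '' I)).IsAcyclic

lemma fromEdgeSet_insert (G : SimpleGraph W) (I : Set G.edgeSet) {u v : W} (h : G.Adj u v) :
    SimpleGraph.fromEdgeSet (Subtype.val '' (insert (⟨s(u, v), h⟩ : G.edgeSet) I)) =
      SimpleGraph.fromEdgeSet (Subtype.val '' I) ⊔ SimpleGraph.edge u v := by
  rw [Set.image_insert_eq, SimpleGraph.edge, ← SimpleGraph.fromEdgeSet_union, Set.insert_eq,
    Set.union_comm]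

lemma isForest_insert {G : SimpleGraph W} {I : Set G.edgeSet} {u v : W} (h : G.Adj u v)
    (hI : IsForest G I)
    (hr : ¬ (SimpleGraph.fromEdgeSet (Subtype.val '' I)).Reachable u v) :
    IsForest G (insert ⟨s(u, v), h⟩ I) := by
  unfold IsForest
  rw [fromEdgeSet_insert]
  exact SimpleGraph.IsAcyclic.sup_edge_of_not_reachable hr hI

lemma IsForest.subset {G : SimpleGraph W} {I J : Set G.edgeSet} (hJ : IsForest G J)
    (h : I ⊆ J) : IsForest G I :=
  SimpleGraph.IsAcyclic.anti (SimpleGraph.fromEdgeSet_mono (Set.image_mono h)) hJ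

lemma isForest_aug (G : SimpleGraph W) ⦃I B : Set G.edgeSet⦄ (hI : IsForest G I)
    (hnI : ¬ Maximal (IsForest G) I) (hB : Maximal (IsForest G) B) :
    ∃ x ∈ B \ I, IsForest G (insert x I) := by
  obtain ⟨J, hIJ, hJ⟩ := Set.exists_insert_of_not_maximal (fun _ _ h hs => h.subset hs) hI hnI
  obtain ⟨⟨e, he⟩, heI, hins⟩ : ∃ e, e ∉ I ∧ IsForest G (insert e I) := ⟨_, hIJ, hJ⟩
  induction e using Sym2.ind with
  | _ u v =>
    have huv : G.Adj u v := he
    have hnr : ¬ (SimpleGraph.fromEdgeSet (Subtype.val '' I)).Reachable u v := by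
      intro hr
      unfold IsForest at hins
      rw [fromEdgeSet_insert G I huv, SimpleGraph.isAcyclic_sup_fromEdgeSet_iff] at hins
      rcases hins.2 hr with h | h
      · exact huv.ne h
      · rw [SimpleGraph.fromEdgeSet_adj] at h
        obtain ⟨⟨x, hx⟩, hmem, hxe⟩ := h.1
        subst hxe
        exact heI hmem
    have hrB : (SimpleGraph.fromEdgeSet (Subtype.val '' B)).Reachable u v := by
      by_contra hn
      have h1 := hB.le_of_ge (isForest_insert huv hB.prop hn) (Set.subset_insert _ _)
      have h2 : (⟨s(u, v), huv⟩ : G.edgeSet) ∈ B := h1 (Set.mem_insert _ _)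
      exact hn (SimpleGraph.Adj.reachable
        ((SimpleGraph.fromEdgeSet_adj _).2 ⟨⟨_, h2, rfl⟩, huv.ne⟩))
    obtain ⟨p⟩ := hrB
    obtain ⟨d, -, hd1, hd2⟩ := p.exists_boundary_dart
      {x | (SimpleGraph.fromEdgeSet (Subtype.val '' I)).Reachable u x}
      (SimpleGraph.Reachable.refl u) hnr
    have hadj := (SimpleGraph.fromEdgeSet_adj _).1 d.adj
    obtain ⟨⟨x, hx⟩, hxB, hxe⟩ := hadj.1
    have hGadj : G.Adj d.fst d.snd := by
      have : s(d.fst, d.snd) ∈ G.edgeSet := hxe ▸ hx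
      exact this
    have hnr' : ¬ (SimpleGraph.fromEdgeSet (Subtype.val '' I)).Reachable d.fst d.snd :=
      fun h => hd2 (SimpleGraph.Reachable.trans hd1 h)
    have hxB' : (⟨s(d.fst, d.snd), hGadj⟩ : G.edgeSet) ∈ B := by
      have heq : (⟨s(d.fst, d.snd), hGadj⟩ : G.edgeSet) = ⟨x, hx⟩ := Subtype.ext hxe.symm
      rw [heq]
      exact hxB
    refine ⟨⟨s(d.fst, d.snd), hGadj⟩, ⟨hxB', fun hxI => hnr' ?_⟩,
      isForest_insert hGadj hI hnr'⟩
    exact SimpleGraph.Adj.reachable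
      ((SimpleGraph.fromEdgeSet_adj _).2 ⟨⟨_, hxI, rfl⟩, hadj.2⟩)

/-- The cycle matroid of a finite simple graph: the ground set is the set of edges and the
independent sets are the forests. -/
def cycleMatroid (G : SimpleGraph W) [Finite G.edgeSet] : Matroid G.edgeSet :=
  IndepMatroid.matroid
    { E := Set.univ
      Indep := IsForest G
      indep_empty := by
        unfold IsForest
        rw [Set.image_empty, SimpleGraph.fromEdgeSet_empty]
        exact SimpleGraph.isAcyclic_bot
      indep_subset := fun _ _ hJ h => hJ.subset h
      indep_aug := isForest_aug G
      indep_maximal := by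
        intro X _ I hI hIX
        obtain ⟨J, hIJ, hJ⟩ := (Set.toFinite {J | IsForest G J ∧ J ⊆ X}).exists_le_maximal
          (show I ∈ {J | IsForest G J ∧ J ⊆ X} from ⟨hI, hIX⟩)
        exact ⟨J, hIJ, hJ⟩
      subset_ground := fun _ _ => Set.subset_univ _ }

/-- The line in `ℝ^E` spanned by `(1, …, 1)`. -/
def allOnes (E : Type*) : Submodule ℝ (E → ℝ) := Submodule.span ℝ {fun _ => 1}

/-- The vector space `ℝ^E / ℝ(1, …, 1)` for the edge set `E` of a graph. -/
abbrev EdgeSpace (G : SimpleGraph W) : Type _ := (G.edgeSet → ℝ) ⧸ allOnes G.edgeSet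

/-- The lattice in `ℝ^E / ℝ(1, …, 1)` that is the image of `ℤ^E`. -/
def edgeLattice (G : SimpleGraph W) : Submodule ℤ (EdgeSpace G) :=
  Submodule.map ((allOnes G.edgeSet).mkQ.restrictScalars ℤ)
    (Submodule.span ℤ {x | ∀ e, ∃ k : ℤ, x e = k})

/-- The Bergman fan `B'(G)` of the cycle matroid of `G` modulo its lineality line
`ℝ(1, …, 1)`, as a subset of `ℝ^E / ℝ(1, …, 1)`. -/
def reducedBergmanFan (G : SimpleGraph W) [Finite G.edgeSet] : Set (EdgeSpace G) :=
  (allOnes G.edgeSet).mkQ '' bergmanFan (cycleMatroid G)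

/-- For a subgraph `G` of `G'` on the same vertices, the projection
`ℝ^{E(G')} / ℝ(1, …, 1) → ℝ^{E(G)} / ℝ(1, …, 1)` that forgets the coordinates of the edges
not in `G`. -/
def forgetEdges {G G' : SimpleGraph W} (h : G ≤ G') : EdgeSpace G' →ₗ[ℝ] EdgeSpace G :=
  Submodule.mapQ _ _
    (LinearMap.funLeft ℝ ℝ (Set.inclusion (SimpleGraph.edgeSet_mono h)))
    (by
      rw [allOnes, Submodule.span_le, Set.singleton_subset_iff]
      exact Submodule.subset_span rfl)

end Bergman

/-! ### Rational tropical curves -/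

/-- A combinatorial type of rational `n`-marked curves: a finite tree together with the vertices
to which the `n` marked ends are attached. (The unbounded ends themselves are not
recorded as edges: the edges of `graph` are the bounded edges.) -/
structure MarkedTree (n : ℕ) where
  numVert : ℕ
  graph : SimpleGraph (Fin numVert)
  isTree : graph.IsTree
  mark : Fin n → Fin numVert

/-- A rational abstract `n`-marked tropical curve: a marked tree with a positive length for each
bounded edge. -/
structure TropCurve (n : ℕ) extends MarkedTree n where
  len : graph.edgeSet → ℝ
  len_pos : ∀ e, 0 < len e

variable {n : ℕ}

/-- `w`-stability: at every vertex, the sum of the weights of the marked ends at the vertex plus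
the number of adjacent bounded edges is greater than two. -/
def MarkedTree.IsStable (T : MarkedTree n) (w : Fin n → ℚ) : Prop :=
  ∀ v : Fin T.numVert,
    2 < (∑ i with T.mark i = v, w i) + ((T.graph.neighborSet v).ncard : ℚ)

namespace TropCurve

/-- Isomorphism (isometry respecting the markings) of tropical curves. -/
def Iso (C D : TropCurve n) : Prop :=
  ∃ f : C.graph ≃g D.graph, (∀ i, f (C.mark i) = D.mark i) ∧
    ∀ e, D.len (f.mapEdgeSet e) = C.len e

lemma Iso.refl (C : TropCurve n) : Iso C C := by
  refine ⟨SimpleGraph.Iso.refl, fun _ => rfl, fun e => ?_⟩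
  congr 1
  ext1
  simp [SimpleGraph.Iso.mapEdgeSet, SimpleGraph.Hom.mapEdgeSet]

lemma Iso.symm {C D : TropCurve n} (h : Iso C D) : Iso D C := by
  obtain ⟨f, hm, hl⟩ := h
  refine ⟨f.symm, fun i => ?_, fun e => ?_⟩
  · rw [← hm i]
    exact f.symm_apply_apply _
  · have := hl (f.mapEdgeSet.symm e)
    rw [Equiv.apply_symm_apply] at this
    exact this.symm

lemma Iso.trans {C D E : TropCurve n} (h : Iso C D) (h' : Iso D E) : Iso C E := by
  obtain ⟨f, hm, hl⟩ := h
  obtain ⟨g, hm', hl'⟩ := h'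
  refine ⟨f.trans g, fun i => ?_, fun e => ?_⟩
  · rw [← hm' i, ← hm i]
    rfl
  · rw [← hl e, ← hl' (f.mapEdgeSet e)]
    congr 1
    ext1
    obtain ⟨e, he⟩ := e
    induction e using Sym2.ind with
    | _ u v => rfl

instance setoid (n : ℕ) : Setoid (TropCurve n) where
  r := Iso
  iseqv := ⟨Iso.refl, Iso.symm, Iso.trans⟩

/-- The unique path in the tree between two vertices. -/
def path (C : TropCurve n) (u v : Fin C.numVert) : C.graph.Walk u v :=
  (C.isTree.existsUnique_path u v).choose

lemma path_isPath (C : TropCurve n) (u v : Fin C.numVert) : (C.path u v).IsPath :=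
  (C.isTree.existsUnique_path u v).choose_spec.1

lemma eq_path (C : TropCurve n) {u v : Fin C.numVert} {p : C.graph.Walk u v} (hp : p.IsPath) :
    p = C.path u v :=
  (C.isTree.existsUnique_path u v).choose_spec.2 p hp

/-- The distance of the vertices to which the ends `i` and `j` are attached: the sum of the
lengths of the edges on the path joining them. -/
def dist (C : TropCurve n) (i j : Fin n) : ℝ :=
  ∑ᶠ e ∈ {e : C.graph.edgeSet | (e : Sym2 (Fin C.numVert)) ∈
    (C.path (C.mark i) (C.mark j)).edges}, C.len e

lemma dist_comm (C : TropCurve n) (i j : Fin n) : C.dist i j = C.dist j i := by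
  unfold dist
  rw [← C.eq_path (C.path_isPath (C.mark j) (C.mark i)).reverse]
  simp only [SimpleGraph.Walk.edges_reverse, List.mem_reverse]

lemma Iso.dist_eq {C D : TropCurve n} (h : Iso C D) (i j : Fin n) : C.dist i j = D.dist i j := by
  obtain ⟨f, hm, hl⟩ := h
  have key : ∀ u v (e : C.graph.edgeSet),
      ((f.mapEdgeSet e : D.graph.edgeSet) : Sym2 (Fin D.numVert)) ∈ (D.path (f u) (f v)).edges ↔
        (e : Sym2 (Fin C.numVert)) ∈ (C.path u v).edges := by
    intro u v e
    have hp : ((C.path u v).map f.toHom).IsPath :=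
      SimpleGraph.Walk.IsPath.map f.injective (C.path_isPath u v)
    have h1 := D.eq_path hp
    change _ ∈ (D.path (f.toHom u) (f.toHom v)).edges ↔ _
    rw [← h1, SimpleGraph.Walk.edges_map]
    change Sym2.map f (e : Sym2 (Fin C.numVert)) ∈ _ ↔ _
    exact List.mem_map_of_injective (Sym2.map.injective f.injective)
  unfold dist
  refine finsum_mem_eq_of_bijOn f.mapEdgeSet ⟨?_, ?_, ?_⟩ (fun e _ => (hl e).symm)
  · intro e he
    have := (key (C.mark i) (C.mark j) e).2 he
    rw [hm, hm] at this
    exact this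
  · exact f.mapEdgeSet.injective.injOn
  · intro e he
    refine ⟨f.mapEdgeSet.symm e, ?_, f.mapEdgeSet.apply_symm_apply e⟩
    apply (key (C.mark i) (C.mark j) _).1
    rw [hm, hm, f.mapEdgeSet.apply_symm_apply]
    exact he

end TropCurve

/-- Isomorphism classes of rational `n`-marked tropical curves (not necessarily stable). -/
abbrev CurveClass (n : ℕ) : Type := Quotient (TropCurve.setoid n)

/-- The moduli space `M_{0,w}^trop`: the set of all (isomorphism classes of) `w`-stable
rational tropical curves. -/
def MTrop (w : Fin n → ℚ) : Set (CurveClass n) :=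
  {c | ∃ C : TropCurve n, C.IsStable w ∧ c = ⟦C⟧}

/-- Let `T` be a marked tree with a nonnegative length `ℓ e` for each of its edges. The tropical
curve `C` is the metric tree determined by `T` and `ℓ`: there is a map from `T` onto `C` that
contracts exactly the edges of length zero and preserves the other edges, their lengths and
the marks. -/
def IsContraction (T : MarkedTree n) (ℓ : T.graph.edgeSet → ℝ) (C : TropCurve n) : Prop :=
  ∃ f : Fin T.numVert → Fin C.numVert, Function.Surjective f ∧
    (∀ i, f (T.mark i) = C.mark i) ∧
    (∀ u v, f u = f v ↔ (SimpleGraph.fromEdgeSet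
      {e | ∃ h : e ∈ T.graph.edgeSet, ℓ ⟨e, h⟩ = 0}).Reachable u v) ∧
    ∀ u v, ∀ h : T.graph.Adj u v, ℓ ⟨s(u, v), h⟩ ≠ 0 →
      ∃ h' : C.graph.Adj (f u) (f v), C.len ⟨s(f u, f v), h'⟩ = ℓ ⟨s(u, v), h⟩

/-- The (closed) cone of a combinatorial type `T` in the moduli space, parametrized by the
nonnegative lengths of the edges of `T`. These cones are glued by identifying the
points that represent the same tropical curve. -/
def MarkedTree.cone (T : MarkedTree n) : Set (CurveClass n) :=
  {c | ∃ (ℓ : T.graph.edgeSet → ℝ) (C : TropCurve n),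
    (∀ e, 0 ≤ ℓ e) ∧ IsContraction T ℓ C ∧ c = ⟦C⟧}

section Embeddings

variable {V : Type*} [AddCommGroup V] [Module ℝ V]

/-- `φ` embeds the cone complex `M_{0,w}^trop` into the vector space `V`: it is injective on
`M_{0,w}^trop` and linear (in the edge lengths) on each of its cones. -/
structure IsConeEmbedding (w : Fin n → ℚ) (φ : CurveClass n → V) : Prop where
  injOn : Set.InjOn φ (MTrop w)
  linear : ∀ T : MarkedTree n, T.IsStable w →
    ∃ L : (T.graph.edgeSet → ℝ) →ₗ[ℝ] V, ∀ (ℓ : T.graph.edgeSet → ℝ) (C : TropCurve n),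
      (∀ e, 0 ≤ ℓ e) → IsContraction T ℓ C → φ ⟦C⟧ = L ℓ

/-- Via `φ`, the cone complex underlying the collection of cones `X` in `(V, N)` is
`M_{0,w}^trop`, including the integral structure: `φ` is a cone-wise linear embedding, it maps
the cones of `M_{0,w}^trop` exactly to the cones of `X`, and it maps precisely the curves with
integral edge lengths to lattice points. -/
structure IsUnderlyingComplex (w : Fin n → ℚ) (φ : CurveClass n → V) (N : Submodule ℤ V)
    (X : Set (PointedCone ℝ V)) : Prop extends IsConeEmbedding w φ where
  image_mem : ∀ T : MarkedTree n, T.IsStable w → ∃ σ ∈ X, (σ : Set V) = φ '' T.cone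
  eq_image : ∀ σ ∈ X, ∃ T : MarkedTree n, T.IsStable w ∧ (σ : Set V) = φ '' T.cone
  integral : ∀ C : TropCurve n, C.IsStable w →
    (φ ⟦C⟧ ∈ N ↔ ∀ e, ∃ k : ℤ, C.len e = k)

/-- A balanced embedding of `M_{0,w}^trop` into the vector space `V`: a cone-wise linear
embedding whose image is the support of a tropical fan, with respect to some lattice. -/
def HasBalancedEmbedding (w : Fin n → ℚ) (V : Type*) [AddCommGroup V] [Module ℝ V] : Prop :=
  ∃ (φ : CurveClass n → V) (N : Submodule ℤ V) (X : Set (PointedCone ℝ V)) (d : ℕ)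
    (ω : PointedCone ℝ V → ℕ),
    IsConeEmbedding w φ ∧ IsTropicalFan N X d ω ∧ φ '' MTrop w = support X

end Embeddings

/-! ### The embedding of `M_{0,n}^trop` by distances -/

/-- The two-element subsets of `{1, …, n}`. -/
abbrev Pairs (n : ℕ) : Type := {e : Sym2 (Fin n) // ¬ e.IsDiag}

/-- The map `Φ : ℝ^n → ℝ^(n choose 2)`, `x ↦ (x_i + x_j)_{i < j}`. -/
def pairSum (n : ℕ) : (Fin n → ℝ) →ₗ[ℝ] (Pairs n → ℝ) where
  toFun x e := Sym2.lift ⟨fun i j => x i + x j, fun _ _ => add_comm _ _⟩ e.1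
  map_add' x y := by
    funext ⟨e, he⟩
    induction e using Sym2.ind with
    | _ i j => simp; ring
  map_smul' c x := by
    funext ⟨e, he⟩
    induction e using Sym2.ind with
    | _ i j => simp; ring

/-- The vector space `ℝ^(n choose 2) / Φ(ℝ^n)`. -/
abbrev DistSpace (n : ℕ) : Type := (Pairs n → ℝ) ⧸ LinearMap.range (pairSum n)

/-- The vector of all distances of two ends of a tropical curve. -/
def TropCurve.distVec (C : TropCurve n) : Pairs n → ℝ :=
  fun e => Sym2.lift ⟨C.dist, C.dist_comm⟩ e.1

/-- The map that takes (the class of) a tropical curve `C` to the class `d(C)` of its distance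
vector in `ℝ^(n choose 2) / Φ(ℝ^n)`. -/
def distMap (n : ℕ) : CurveClass n → DistSpace n :=
  Quotient.lift (fun C => (LinearMap.range (pairSum n)).mkQ C.distVec) (by
    intro C D h
    have : C.distVec = D.distVec := by
      funext ⟨e, he⟩
      induction e using Sym2.ind with
      | _ i j => exact TropCurve.Iso.dist_eq h i j
    simp only [this])

/-- `M_{0,n}^trop` as a fan in `ℝ^(n choose 2) / Φ(ℝ^n)` in its combinatorial subdivision: one
cone for each combinatorial type of `n`-marked curves, i.e. of stable curves for the
weight vector `(1, …, 1)`. -/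
def distFan (n : ℕ) : Set (PointedCone ℝ (DistSpace n)) :=
  {σ | ∃ T : MarkedTree n, T.IsStable 1 ∧ (σ : Set (DistSpace n)) = distMap n '' T.cone}

/-- The entry of a vector in `ℝ^(n choose 2)` at the pair `{i, j}`, and `0` if `i = j`. -/
def pairCoord (i j : Fin n) : (Pairs n → ℝ) →ₗ[ℝ] ℝ :=
  if h : i = j then 0 else LinearMap.proj ⟨s(i, j), h⟩

lemma pairCoord_comm (i j : Fin n) : pairCoord i j = pairCoord j i := by
  unfold pairCoord
  by_cases h : i = j
  · rw [dif_pos h, dif_pos h.symm]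
  · rw [dif_neg h, dif_neg (Ne.symm h)]
    congr 2
    exact Sym2.eq_swap

lemma pairCoord_pairSum {i j : Fin n} (h : i ≠ j) (x : Fin n → ℝ) :
    pairCoord i j (pairSum n x) = x i + x j := by
  simp [pairCoord, h, pairSum]

/-- The vertices of the complete graph `K_{n-1}`: all markings but the marking `a`. -/
abbrev Others (a : Fin n) : Type := ↥({a}ᶜ : Set (Fin n))

/-- The linear map `ℝ^(n choose 2) → ℝ^{E(K_{n-1})}` that takes `(d_{ij})` to
`((d_{kl} - d_{ak} - d_{al}) / 2)_{kl}`. -/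
def edgeCoords (a : Fin n) :
    (Pairs n → ℝ) →ₗ[ℝ] ((⊤ : SimpleGraph (Others a)).edgeSet → ℝ) :=
  LinearMap.pi fun e => Sym2.lift ⟨fun k l : Others a =>
    (1 / 2 : ℝ) • (pairCoord k.1 l.1 - pairCoord a k.1 - pairCoord a l.1), fun k l => by
      beta_reduce
      rw [pairCoord_comm k.1 l.1, sub_right_comm]⟩ e.1

/-- The isomorphism from `ℝ^(n choose 2) / Φ(ℝ^n)` to `ℝ^{E(K_{n-1})} / ℝ(1, …, 1)` by which
`M_{0,n}^trop` is identified with `B'(K_{n-1})`. It takes the curve with a single edge of length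
one and the split `I ⊔ Iᶜ`, `a ∉ I`, to `v_F = -∑_{e ∈ F} e`, where `F` is the complete graph
on `I`. -/
def bergmanIso (a : Fin n) :
    DistSpace n →ₗ[ℝ] EdgeSpace (⊤ : SimpleGraph (Others a)) :=
  Submodule.mapQ _ _ (edgeCoords a) (by
    rintro _ ⟨x, rfl⟩
    rw [Submodule.mem_comap, allOnes, Submodule.mem_span_singleton]
    refine ⟨- x a, ?_⟩
    funext ⟨e, he⟩
    induction e using Sym2.ind with
    | _ k l =>
      have hkl : k.1 ≠ l.1 := fun h =>
        SimpleGraph.Adj.ne ((SimpleGraph.mem_edgeSet _).1 he) (Subtype.ext h)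
      have hk : a ≠ k.1 := fun h => k.2 h.symm
      have hl : a ≠ l.1 := fun h => l.2 h.symm
      simp only [edgeCoords, LinearMap.pi_apply, Sym2.lift_mk, LinearMap.smul_apply,
        LinearMap.sub_apply, pairCoord_pairSum hkl, pairCoord_pairSum hk, pairCoord_pairSum hl,
        Pi.smul_apply, smul_eq_mul]
      ring)

/-! ### Weights -/

/-- `i` is heavy in `w`. -/
def IsHeavy (w : Fin n → ℚ) (i : Fin n) : Prop := ∀ j, j ≠ i → 1 < w i + w j

/-- `i` is small in `w`. -/
def IsSmall (w : Fin n → ℚ) (i : Fin n) : Prop := ∀ j, j ≠ i → 1 < w i + w j → IsHeavy w j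

/-- `i` is light in `w`: it is small, and the total weight of the small entries is at
most one. -/
def IsLight (w : Fin n → ℚ) (i : Fin n) : Prop :=
  IsSmall w i ∧ ∑ᶠ j ∈ {j | IsSmall w j}, w j ≤ 1

/-- Every entry of `w` is heavy or light. -/
def IsHeavyLight (w : Fin n → ℚ) : Prop := ∀ i, IsHeavy w i ∨ IsLight w i

/-- The total weight graph `G_t(w)`: `i` and `j` are adjacent if `w_i + w_j > 1`. -/
def totalWeightGraph (w : Fin n → ℚ) : SimpleGraph (Fin n) where
  Adj i j := i ≠ j ∧ 1 < w i + w j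
  symm := ⟨fun i j h => ⟨h.1.symm, by rw [add_comm]; exact h.2⟩⟩
  loopless := ⟨fun _ h => h.1 rfl⟩

/-- The reduced weight graph `G(w)`: the total weight graph with the vertex `a` deleted. -/
def reducedWeightGraph (w : Fin n → ℚ) (a : Fin n) : SimpleGraph (Others a) :=
  (totalWeightGraph w).induce {a}ᶜ

/-- The projection `pr_w` from the ambient space of `M_{0,n}^trop`, identified with
the ambient space of `B'(K_{n-1})`, to the ambient space of `B'(G(w))`: it forgets the
coordinates of the edges that do not lie in `G(w)`. -/
def prW (w : Fin n → ℚ) (a : Fin n) :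
    DistSpace n →ₗ[ℝ] EdgeSpace (reducedWeightGraph w a) :=
  forgetEdges le_top ∘ₗ bergmanIso a

/-- The projected fan `pr_w(M_{0,n}^trop)`: its cones are the images of the cones of
`M_{0,n}^trop`. -/
def projectedFan (w : Fin n → ℚ) (a : Fin n) :
    Set (PointedCone ℝ (EdgeSpace (reducedWeightGraph w a))) :=
  PointedCone.map (prW w a) '' distFan n

end WeightedTrop

end

open WeightedTrop

/-!
# Projections of tropical moduli spaces of weighted stable curves

Fix a marking `a`. The *side* of an edge of a marked tree is the set of the markings that the edge
separates from `a`. A `w`-stable curve is determined by the function that assigns to each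
subset of the markings the length of the edge with this side (or `0`), its vector of *split
coordinates*. The vectors that occur are exactly the nonnegative ones whose support is a laminar
family of sets `I` not containing `a` such that `I` and its complement both have weight greater than
one (`exists_curve`, `class_eq_of_coord_eq`); the curve with a given vector is built on the rooted
tree of the laminar family. Conewise linear maps are the restrictions of linear maps of the split
coordinates (`IsConeEmbedding.exists_linear`), and `pr_w` becomes the map `c ↦ ∑ c_I v_I`, where
`v_I` has the entry `-1` at the edges of `G(w)` inside `I` and zero elsewhere (`prW_distMap`).

*Heavy/light weights.* Here `I` is admissible if and only if it is so for the weights `(1, …, 1)`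
and contains a heavy marking, and `v_I = 0` if `I` contains no heavy marking; so the images of the
cones of `M_{0,n}^trop` are the images of the cones of `M_{0,w}^trop`. The image of a curve
satisfies the ultrametric inequality, and the same condition describes the Bergman fan, namely that
no edge is the unique edge of maximal weight of a cycle (`mem_bergmanFan_iff`); conversely, the
components of the graphs of all edges of weight at most `t` form the laminar family of the curve to
which a point of the Bergman fan belongs (`exists_isCoord_of_mem_bergmanFan`). The maximum of the
image over the edges inside `I` is the negative of the sum of the coordinates at the sets containing
`I`, so the coordinates, and their integrality, can be recovered (`IsExt.isGreatest`). For the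
balancing condition, a laminar family that lacks one member has exactly one set with three *blocks*
(maximal proper subsets in the family, and single markings in none of these), all others having two.
The new members are the unions of two of these blocks that contain a heavy marking, and the sum of
their vectors is the sum of the vectors of the three blocks and of the set itself
(`sum_negClique_sdiff`).

*Other weights.* In a tropical fan all maximal cones have the same dimension, and no cone of
codimension one lies in just one larger cone (`false_of_unique_refinement`). If `w` is not
heavy/light, then either some markings `i`, `j`, `k` that are not heavy satisfy `w_i + w_j > 1` and
`w_i + w_k, w_j + w_k ≤ 1`, or the small markings contain a minimal set of weight greater than one
with more than two elements. A maximal chain of sets above `{i, j, k}` violates the second property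
(`false_of_triple`), a maximal chain above the minimal set the first one (`false_of_minimal`).
-/

noncomputable section

namespace WeightedTrop

section

/-! ### Separation by an edge of a tree -/

section Sep

variable {V : Type*} {G : SimpleGraph V}

/-- The edge `e` separates the vertices `u` and `v`: they are not connected after the removal
of `e`. -/
def Sep (G : SimpleGraph V) (e : Sym2 V) (u v : V) : Prop :=
  ¬ (G.deleteEdges {e}).Reachable u v

lemma not_sep_iff {e : Sym2 V} {u v : V} :
    ¬ Sep G e u v ↔ ∃ p : G.Walk u v, e ∉ p.edges := by
  classical
  rw [Sep, not_not]
  constructor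
  · rintro ⟨p⟩
    refine ⟨p.mapLe (G.deleteEdges_le _), fun h => ?_⟩
    rw [SimpleGraph.Walk.edges_mapLe_eq_edges] at h
    have := p.edges_subset_edgeSet h
    simp at this
  · rintro ⟨p, hp⟩
    exact ⟨p.toDeleteEdges {e} (fun e' he' h => hp (by
      rw [Set.mem_singleton_iff] at h; exact h ▸ he'))⟩

lemma not_sep_self (e : Sym2 V) (u : V) : ¬ Sep G e u u := fun h => h .rfl

lemma sep_adj (hG : G.IsTree) {e : Sym2 V} {u v : V} (h : G.Adj u v) :
    Sep G e u v ↔ e = s(u, v) := by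
  constructor
  · intro hs
    by_contra hne
    refine hs (SimpleGraph.Adj.reachable ?_)
    rw [SimpleGraph.deleteEdges_adj]
    exact ⟨h, fun h' => hne h'.symm⟩
  · rintro rfl
    exact (SimpleGraph.isAcyclic_iff_forall_adj_isBridge.1 hG.2 h)

/-- The removal of an edge of a connected graph leaves at most two components, so among three
vertices two are not separated. -/
lemma exists_not_sep (hG : G.IsTree) (e : Sym2 V) (u v w : V) :
    ¬ Sep G e u v ∨ ¬ Sep G e v w ∨ ¬ Sep G e u w := by
  induction e using Sym2.ind with
  | _ x y =>
  have key : ∀ a, (G.deleteEdges {s(x, y)}).Reachable x a ∨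
      (G.deleteEdges {s(x, y)}).Reachable y a := by
    intro a
    obtain ⟨p⟩ := hG.1 a x
    have : ∀ a b (p : G.Walk a b), b = x → (G.deleteEdges {s(x, y)}).Reachable x a ∨
        (G.deleteEdges {s(x, y)}).Reachable y a := by
      intro a b p hb
      induction p with
      | nil => subst hb; exact .inl .rfl
      | @cons a b c hab p ih =>
        by_cases he : s(a, b) = s(x, y)
        · rcases Sym2.eq_iff.1 he with ⟨rfl, -⟩ | ⟨rfl, -⟩
          · exact .inl .rfl
          · exact .inr .rfl
        · have : (G.deleteEdges {s(x, y)}).Reachable b a :=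
            SimpleGraph.Adj.reachable (by
              rw [SimpleGraph.deleteEdges_adj]
              exact ⟨hab.symm, fun h => he (Sym2.eq_swap.trans h)⟩)
          exact (ih hb).imp (·.trans this) (·.trans this)
    exact this a x p rfl
  simp only [Sep, not_not]
  rcases key u with h1 | h1 <;> rcases key v with h2 | h2 <;> rcases key w with h3 | h3 <;>
    first
    | exact .inl (h1.symm.trans h2)
    | exact .inr (.inl (h2.symm.trans h3))
    | exact .inr (.inr (h1.symm.trans h3))

lemma sep_xor (hG : G.IsTree) (e : Sym2 V) (r u v : V) :
    Sep G e u v ↔ ¬ (Sep G e r u ↔ Sep G e r v) := by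
  have h0 := exists_not_sep hG e r u v
  have h1 : ¬ Sep G e r u → ¬ Sep G e r v → ¬ Sep G e u v := by
    simp only [Sep, not_not]
    exact fun a b => a.symm.trans b
  have h2 : ¬ Sep G e r u → ¬ Sep G e u v → ¬ Sep G e r v := by
    simp only [Sep, not_not]
    exact fun a b => a.trans b
  have h3 : ¬ Sep G e r v → ¬ Sep G e u v → ¬ Sep G e r u := by
    simp only [Sep, not_not]
    exact fun a b => a.trans b.symm
  tauto

lemma mem_edges_iff_sep (hG : G.IsTree) {e : Sym2 V} {u v : V} {p : G.Walk u v}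
    (hp : p.IsPath) : e ∈ p.edges ↔ Sep G e u v := by
  classical
  constructor
  · intro h
    by_contra hs
    obtain ⟨q, hq⟩ := not_sep_iff.1 hs
    have := (hG.2.subsingleton_path u v).elim ⟨p, hp⟩ q.toPath
    have h2 : p = q.bypass := congrArg Subtype.val this
    rw [h2] at h
    exact hq (q.edges_bypass_subset_edges h)
  · intro h
    by_contra hs
    exact (not_sep_iff.2 ⟨p, hs⟩) h

/-- A two-colouring of the vertices that changes along the edge `e` and along no other edge
describes the two sides of `e`. -/
lemma sep_iff_of_coloring (hG : G.IsTree) {e : Sym2 V} (he : e ∈ G.edgeSet) {χ : V → Prop}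
    (hχ : ∀ u v, G.Adj u v → ((χ u ↔ χ v) ↔ s(u, v) ≠ e)) (u v : V) :
    Sep G e u v ↔ ¬ (χ u ↔ χ v) := by
  have key : ∀ u v, ¬ Sep G e u v → (χ u ↔ χ v) := by
    intro u v h
    obtain ⟨p, hp⟩ := not_sep_iff.1 h
    clear h
    induction p with
    | nil => rfl
    | @cons a b c hab p ih =>
      simp only [SimpleGraph.Walk.edges_cons, List.mem_cons, not_or] at hp
      exact ((hχ _ _ hab).2 (fun h => hp.1 h.symm)).trans (ih hp.2)
  induction e using Sym2.ind with
  | _ x y =>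
  have hxy : G.Adj x y := he
  have h1 : ¬ (χ x ↔ χ y) := fun h => (hχ _ _ hxy).1 h rfl
  have h2 := (sep_adj hG hxy).2 rfl
  have h3 : ∀ a, Sep G s(x, y) x a ↔ ¬ (χ x ↔ χ a) := by
    intro a
    have h4 := sep_xor hG s(x, y) x y a
    have h5 := key x a
    have h6 := key y a
    tauto
  rw [sep_xor hG _ x, h3, h3]
  tauto

lemma isAcyclic_of_coloring
    (h : ∀ x y, G.Adj x y → ∃ χ : V → Prop, ∀ u v, G.Adj u v → ((χ u ↔ χ v) ↔ s(u, v) ≠ s(x, y))) :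
    G.IsAcyclic := by
  rw [SimpleGraph.isAcyclic_iff_forall_adj_isBridge]
  intro x y hxy
  obtain ⟨χ, hχ⟩ := h x y hxy
  change Sep G s(x, y) x y
  by_contra hs
  obtain ⟨p, hp⟩ := not_sep_iff.1 hs
  have key : ∀ u v (p : G.Walk u v), s(x, y) ∉ p.edges → (χ u ↔ χ v) := by
    intro u v p hp
    induction p with
    | nil => rfl
    | @cons a b c hab p ih =>
      simp only [SimpleGraph.Walk.edges_cons, List.mem_cons, not_or] at hp
      exact ((hχ _ _ hab).2 (fun h => hp.1 h.symm)).trans (ih hp.2)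
  exact (hχ x y hxy).1 (key _ _ p hp) rfl

/-- Two vertices on the same side of `e` are not separated by an edge on the other side. -/
lemma not_sep_of_sep {e e' : Sym2 V} {x v v' : V} (hx : x ∈ e')
    (h : ¬ Sep G e v v') (h' : Sep G e v x) : ¬ Sep G e' v v' := by
  classical
  obtain ⟨p, hp⟩ := not_sep_iff.1 h
  refine not_sep_iff.2 ⟨p, fun he' => ?_⟩
  obtain ⟨y, rfl⟩ := hx
  have hx : x ∈ p.support := p.fst_mem_support_of_mem_edges he'
  exact not_sep_iff.2 ⟨p.takeUntil x hx, fun h => hp (p.edges_takeUntil_subset_edges hx h)⟩ h'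

lemma sep_of_sep {e e' : Sym2 V} {r x v : V} (hx : x ∈ e') (h : Sep G e r x)
    (hv : Sep G e' r v) : Sep G e r v := by
  by_contra hs
  exact not_sep_of_sep hx hs h hv

lemma sep_iff_sep (hG : G.IsTree) {e e' : Sym2 V} {r x v v' : V} (hx : x ∈ e')
    (h : ¬ Sep G e r x) (hv : Sep G e r v) (hv' : Sep G e r v') :
    Sep G e' r v ↔ Sep G e' r v' := by
  have h1 : ¬ Sep G e v v' := by rw [sep_xor hG e r]; tauto
  have h2 : Sep G e v x := by rw [sep_xor hG e r]; tauto
  have h3 := not_sep_of_sep hx h1 h2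
  rw [sep_xor hG e' r] at h3
  tauto

lemma exists_far (hG : G.IsTree) {e : Sym2 V} (he : e ∈ G.edgeSet) (r : V) :
    ∃ x y, e = s(x, y) ∧ G.Adj x y ∧ ¬ Sep G e r x ∧ Sep G e r y := by
  induction e using Sym2.ind with
  | _ x y =>
  have h := (sep_adj hG he).2 rfl
  rw [sep_xor hG _ r] at h
  by_cases hx : Sep G s(x, y) r x
  · exact ⟨y, x, Sym2.eq_swap, SimpleGraph.Adj.symm he, by tauto, hx⟩
  · exact ⟨x, y, rfl, he, hx, by tauto⟩

lemma sep_trichotomy (hG : G.IsTree) (e e' : Sym2 V) (r : V) (he' : e' ∈ G.edgeSet) :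
    (∀ v, Sep G e' r v → Sep G e r v) ∨ (∀ v, Sep G e r v → Sep G e' r v) ∨
      (∀ v, Sep G e r v → ¬ Sep G e' r v) := by
  obtain ⟨x, y, rfl, -, -, hy⟩ := exists_far hG he' r
  by_cases h : Sep G e r x
  · exact .inl fun v => sep_of_sep (Sym2.mem_mk_left _ _) h
  · right
    by_cases h2 : ∃ v, Sep G e r v ∧ Sep G s(x, y) r v
    · obtain ⟨v, hv, hv'⟩ := h2
      exact .inl fun u hu => (sep_iff_sep hG (Sym2.mem_mk_left _ _) h hv hu).1 hv'
    · exact .inr fun v hv hv' => h2 ⟨v, hv, hv'⟩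

end Sep

end

section

/-! ### Splits of the edges of a marked tree -/

variable {n : ℕ}

/-- `I` is the side, not containing the marking `r`, of an edge of some `w`-stable curve: the total
weight on both sides is greater than one. -/
def Adm (w : Fin n → ℚ) (r : Fin n) (I : Finset (Fin n)) : Prop :=
  r ∉ I ∧ 1 < ∑ i ∈ I, w i ∧ 1 < ∑ i ∈ Iᶜ, w i

lemma Adm.nonempty {w : Fin n → ℚ} {r : Fin n} {I : Finset (Fin n)} (h : Adm w r I) :
    I.Nonempty := by
  rw [Finset.nonempty_iff_ne_empty]
  rintro rfl
  have := h.2.1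
  norm_num at this

/-- Two sets are compatible if they are nested or disjoint. -/
def Compat {α : Type*} (I J : Finset α) : Prop := I ⊆ J ∨ J ⊆ I ∨ Disjoint I J

lemma Compat.symm {α : Type*} {I J : Finset α} (h : Compat I J) : Compat J I :=
  h.elim (fun h => .inr (.inl h)) fun h => h.elim .inl fun h => .inr (.inr h.symm)

/-- A laminar family of sides of edges: the sides of the edges of a `w`-stable tree. -/
def IsLam (w : Fin n → ℚ) (r : Fin n) (𝓛 : Finset (Finset (Fin n))) : Prop :=
  (∀ I ∈ 𝓛, Adm w r I) ∧ ∀ I ∈ 𝓛, ∀ J ∈ 𝓛, Compat I J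

lemma IsLam.mono {w : Fin n → ℚ} {r : Fin n} {𝓛 𝓜 : Finset (Finset (Fin n))}
    (h : IsLam w r 𝓛) (hs : 𝓜 ⊆ 𝓛) : IsLam w r 𝓜 :=
  ⟨fun I hI => h.1 I (hs hI), fun I hI J hJ => h.2 I (hs hI) J (hs hJ)⟩

namespace MarkedTree

variable (T : MarkedTree n) (r : Fin n) {w : Fin n → ℚ}

open Classical in
/-- The set of the markings that an edge separates from the marking `r`. -/
def sideSet (e : Sym2 (Fin T.numVert)) : Finset (Fin n) :=
  Finset.univ.filter fun i => Sep T.graph e (T.mark r) (T.mark i)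

variable {T r}

lemma mem_sideSet {e : Sym2 (Fin T.numVert)} {i : Fin n} :
    i ∈ T.sideSet r e ↔ Sep T.graph e (T.mark r) (T.mark i) := by
  simp [sideSet]

lemma exists_adj_of_neighborSet_ne (T : MarkedTree n) {x y : Fin T.numVert}
    (h : T.graph.Adj x y) (hc : T.graph.neighborSet y ≠ {x}) :
    ∃ z, z ≠ x ∧ T.graph.Adj y z := by
  by_contra! hz
  refine hc (Set.Subset.antisymm (fun z hz' => ?_) ?_)
  · by_contra hne
    exact hz z hne hz'
  · rintro _ rfl
    exact h.symm

open Classical in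
/-- Beyond every edge there is a vertex with only one edge; its ends have weight greater
than one. -/
lemma IsStable.one_lt_sum_sep (hT : T.IsStable w) (hw : ∀ i, 0 ≤ w i) {x y : Fin T.numVert}
    (h : T.graph.Adj x y) : 1 < ∑ i with Sep T.graph s(x, y) x (T.mark i), w i := by
  have main : ∀ k : ℕ, ∀ x y : Fin T.numVert, T.graph.Adj x y →
      (Finset.univ.filter fun v => Sep T.graph s(x, y) x v).card = k →
      1 < ∑ i with Sep T.graph s(x, y) x (T.mark i), w i := by
    intro k
    induction k using Nat.strong_induction_on with
    | _ k ih =>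
    intro x y h hk
    have hxy := (sep_adj T.isTree h).2 rfl
    by_cases hc : T.graph.neighborSet y = {x}
    · have h1 := hT y
      rw [hc, Set.ncard_singleton] at h1
      have h2 : ∑ i with T.mark i = y, w i ≤
          ∑ i with Sep T.graph s(x, y) x (T.mark i), w i := by
        refine Finset.sum_le_sum_of_subset_of_nonneg ?_ fun i _ _ => hw i
        intro i hi
        simp only [Finset.mem_filter, Finset.mem_univ, true_and] at hi ⊢
        rw [hi]
        exact hxy
      push_cast at h1
      linarith
    · obtain ⟨z, hzx, hz⟩ := T.exists_adj_of_neighborSet_ne h hc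
      have hzy := (sep_adj T.isTree hz).2 rfl
      have hne : s(y, z) ≠ s(x, y) := by
        intro h'
        rcases Sym2.eq_iff.1 h' with ⟨h1, -⟩ | ⟨-, h1⟩
        · exact h.ne h1.symm
        · exact hzx h1
      have hxy' : ¬ Sep T.graph s(y, z) x y := fun h' => hne ((sep_adj T.isTree h).1 h')
      have hsub : ∀ v, Sep T.graph s(y, z) y v → Sep T.graph s(x, y) x v := by
        intro v hv
        refine sep_of_sep (e' := s(y, z)) (Sym2.mem_mk_left y z) hxy ?_
        rw [sep_xor T.isTree _ x] at hv
        tauto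
      refine (ih _ ?_ y z hz rfl).trans_le ?_
      · rw [← hk]
        refine Finset.card_lt_card ((Finset.ssubset_iff_of_subset ?_).2 ⟨y, ?_, ?_⟩)
        · intro v hv
          simp only [Finset.mem_filter, Finset.mem_univ, true_and] at hv ⊢
          exact hsub v hv
        · simpa using hxy
        · simpa using not_sep_self _ _
      · refine Finset.sum_le_sum_of_subset_of_nonneg ?_ fun i _ _ => hw i
        intro i hi
        simp only [Finset.mem_filter, Finset.mem_univ, true_and] at hi ⊢
        exact hsub _ hi
  exact main _ x y h rfl

lemma IsStable.adm (hT : T.IsStable w) (hw : ∀ i, 0 ≤ w i) {e : Sym2 (Fin T.numVert)}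
    (he : e ∈ T.graph.edgeSet) : Adm w r (T.sideSet r e) := by
  classical
  obtain ⟨x, y, rfl, h, hx, hy⟩ := exists_far T.isTree he (T.mark r)
  refine ⟨fun hr => not_sep_self _ _ (mem_sideSet.1 hr), ?_, ?_⟩
  · have h1 : T.sideSet r s(x, y) =
        Finset.univ.filter fun i => Sep T.graph s(x, y) x (T.mark i) := by
      ext i
      rw [mem_sideSet, Finset.mem_filter, sep_xor T.isTree _ (T.mark r) x]
      simp [hx]
    rw [h1]
    exact hT.one_lt_sum_sep hw h
  · have h1 : (T.sideSet r s(x, y))ᶜ =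
        Finset.univ.filter fun i => Sep T.graph s(y, x) y (T.mark i) := by
      ext i
      rw [Finset.mem_compl, mem_sideSet, Finset.mem_filter, Sym2.eq_swap,
        sep_xor T.isTree _ (T.mark r) y]
      rw [Sym2.eq_swap] at hy
      simp [hy]
    rw [h1]
    exact hT.one_lt_sum_sep hw h.symm

/-- By stability, the side of one edge contains the side of another one if and only if this
is so for the sets of markings on these sides. -/
lemma IsStable.sideSet_subset_iff (hT : T.IsStable w) (hw : ∀ i, 0 ≤ w i)
    {x y : Fin T.numVert} (h : T.graph.Adj x y) (hy : Sep T.graph s(x, y) (T.mark r) y)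
    {e' : Sym2 (Fin T.numVert)} :
    T.sideSet r s(x, y) ⊆ T.sideSet r e' ↔ Sep T.graph e' (T.mark r) y := by
  classical
  have hG := T.isTree
  constructor
  · intro hsub
    by_contra hn
    have hxy := (sep_adj hG h).2 rfl
    have hx : ¬ Sep T.graph s(x, y) (T.mark r) x := by
      have := sep_xor hG s(x, y) (T.mark r) x y
      tauto
    have hmark : ∀ i, T.mark i ≠ y := by
      intro i hi
      have := hsub (mem_sideSet.2 (hi ▸ hy : Sep T.graph s(x, y) (T.mark r) (T.mark i)))
      rw [mem_sideSet, hi] at this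
      exact hn this
    have hdeg : 2 < (T.graph.neighborSet y).ncard := by
      have := hT y
      rw [Finset.filter_eq_empty_iff.2 fun i _ => hmark i, Finset.sum_empty, zero_add] at this
      exact_mod_cast this
    have hdeg2 : 1 < (T.graph.neighborSet y \ {x}).ncard := by
      rw [Set.ncard_sdiff_singleton_of_mem (show x ∈ T.graph.neighborSet y from h.symm)]
      omega
    obtain ⟨z₁, ⟨hz₁, hzx₁⟩, z₂, ⟨hz₂, hzx₂⟩, hne⟩ := (Set.one_lt_ncard).1 hdeg2
    have key : ∀ z, T.graph.Adj y z → z ≠ x →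
        ∃ i, Sep T.graph s(y, z) y (T.mark i) ∧ Sep T.graph e' y (T.mark i) := by
      intro z hz hzx
      have h1 := hT.one_lt_sum_sep hw hz
      obtain ⟨i, hi⟩ : (Finset.univ.filter fun i =>
          Sep T.graph s(y, z) y (T.mark i)).Nonempty := by
        by_contra h'
        rw [Finset.not_nonempty_iff_eq_empty.1 h', Finset.sum_empty] at h1
        norm_num at h1
      simp only [Finset.mem_filter, Finset.mem_univ, true_and] at hi
      refine ⟨i, hi, ?_⟩
      have hne : s(y, z) ≠ s(x, y) := by
        intro h'
        rcases Sym2.eq_iff.1 h' with ⟨h1, -⟩ | ⟨-, h1⟩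
        · exact h.ne h1.symm
        · exact hzx h1
      have hxy' : ¬ Sep T.graph s(y, z) x y := fun h' => hne ((sep_adj hG h).1 h')
      have h2 : Sep T.graph s(x, y) x (T.mark i) :=
        sep_of_sep (e' := s(y, z)) (Sym2.mem_mk_left y z) hxy (by
          rw [sep_xor hG _ x] at hi
          tauto)
      have h3 : i ∈ T.sideSet r s(x, y) := mem_sideSet.2 (by
        rw [sep_xor hG _ (T.mark r)] at h2
        tauto)
      have h4 := mem_sideSet.1 (hsub h3)
      rw [sep_xor hG _ (T.mark r)]
      tauto
    have sub : ∀ z, T.graph.Adj y z → ∀ e'' i, Sep T.graph s(y, z) y (T.mark i) →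
        Sep T.graph e'' y (T.mark i) → e'' ∈ T.graph.edgeSet →
        ∀ v, Sep T.graph e'' y v → Sep T.graph s(y, z) y v := by
      intro z hz e'' i hi hi' he'' v hv
      obtain ⟨x', y', rfl, -, -, -⟩ := exists_far hG he'' y
      by_cases hx' : Sep T.graph s(y, z) y x'
      · exact sep_of_sep (Sym2.mem_mk_left _ _) hx' hv
      · have h1 := (sep_iff_sep hG (e' := s(x', y')) (Sym2.mem_mk_left _ _) hx' hi
          ((sep_adj hG hz).2 rfl)).1 hi'
        rw [← (sep_adj hG hz).1 h1]
        exact hv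
    obtain ⟨i₁, hi₁, hi₁'⟩ := key z₁ hz₁ hzx₁
    obtain ⟨i₂, hi₂, hi₂'⟩ := key z₂ hz₂ hzx₂
    have he' : e' ∈ T.graph.edgeSet := by
      by_contra he'
      refine hi₁' ?_
      rw [SimpleGraph.deleteEdges_eq_self.2 (by simpa using he')]
      exact hG.1 _ _
    have h1 := sub z₁ hz₁ e' i₁ hi₁ hi₁' he' _ hi₂'
    have h2 := sub z₁ hz₁ s(y, z₂) i₂ h1 hi₂ hz₂ z₂ ((sep_adj hG hz₂).2 rfl)
    have h3 := (sep_adj hG hz₂).1 h2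
    rcases Sym2.eq_iff.1 h3 with ⟨-, h4⟩ | ⟨h4, -⟩
    · exact hne h4
    · exact (T.graph.ne_of_adj hz₂) h4
  · intro hs i hi
    rw [mem_sideSet] at hi ⊢
    by_cases hee : e' = s(x, y)
    · exact hee ▸ hi
    · exact sep_of_sep (Sym2.mem_mk_right x y) hs hi

lemma IsStable.sideSet_injOn (hT : T.IsStable w) (hw : ∀ i, 0 ≤ w i) :
    Set.InjOn (T.sideSet r) T.graph.edgeSet := by
  intro e he e' he' heq
  obtain ⟨x, y, rfl, h, hx, hy⟩ := exists_far T.isTree he (T.mark r)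
  obtain ⟨x', y', rfl, h', hx', hy'⟩ := exists_far T.isTree he' (T.mark r)
  have h1 := (hT.sideSet_subset_iff hw h hy).1 heq.subset
  have h2 := (hT.sideSet_subset_iff hw h' hy').1 heq.symm.subset
  by_contra hne
  -- the far end of each edge is beyond the other edge, so the near ends are, too
  have h3 : Sep T.graph s(x', y') (T.mark r) x := by
    have := sep_xor T.isTree s(x', y') (T.mark r) x y
    rw [sep_adj T.isTree h] at this
    have : s(x', y') ≠ s(x, y) := Ne.symm hne
    tauto
  have h4 : Sep T.graph s(x, y) (T.mark r) x' := by
    have := sep_xor T.isTree s(x, y) (T.mark r) x' y'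
    rw [sep_adj T.isTree h'] at this
    tauto
  exact hx (sep_of_sep (e' := s(x', y')) (Sym2.mem_mk_left _ _) h4 h3)

lemma sideSet_compat (T : MarkedTree n) (r : Fin n) (e : Sym2 (Fin T.numVert))
    {e' : Sym2 (Fin T.numVert)} (he' : e' ∈ T.graph.edgeSet) :
    Compat (T.sideSet r e) (T.sideSet r e') := by
  rcases sep_trichotomy T.isTree e e' (T.mark r) he' with h | h | h
  · exact .inr (.inl fun i hi => mem_sideSet.2 (h _ (mem_sideSet.1 hi)))
  · exact .inl fun i hi => mem_sideSet.2 (h _ (mem_sideSet.1 hi))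
  · refine .inr (.inr (Finset.disjoint_left.2 fun i hi hi' => ?_))
    exact h _ (mem_sideSet.1 hi) (mem_sideSet.1 hi')

variable (T r) in
open Classical in
/-- The family of the sides of all edges of a marked tree. -/
def sides : Finset (Finset (Fin n)) :=
  Finset.univ.image fun e : T.graph.edgeSet => T.sideSet r e

lemma mem_sides {I : Finset (Fin n)} :
    I ∈ T.sides r ↔ ∃ e : T.graph.edgeSet, T.sideSet r e = I := by
  simp [sides]

lemma IsStable.isLam_sides (hT : T.IsStable w) (hw : ∀ i, 0 ≤ w i) :
    IsLam w r (T.sides r) := by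
  constructor
  · intro I hI
    obtain ⟨e, rfl⟩ := mem_sides.1 hI
    exact hT.adm hw e.2
  · intro I hI J hJ
    obtain ⟨e, rfl⟩ := mem_sides.1 hI
    obtain ⟨e', rfl⟩ := mem_sides.1 hJ
    exact sideSet_compat T r e e'.2

lemma IsStable.one (hT : T.IsStable w) (hle : ∀ i, w i ≤ 1) : T.IsStable 1 := by
  intro v
  refine (hT v).trans_le (add_le_add_left (Finset.sum_le_sum fun i _ => hle i) _)

end MarkedTree

end

section

/-! ### Laminar families as rooted trees -/

section Laminar

variable {α : Type*} [DecidableEq α] {U I J : Finset α} {𝓛 : Finset (Finset α)}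

/-- The parent of `I` with respect to a laminar family `𝓛` of subsets of `U`: the smallest
member of `𝓛` strictly containing `I`, or `U` if there is none. -/
def par (U : Finset α) (𝓛 : Finset (Finset α)) (I : Finset α) : Finset α :=
  U.filter fun i => ∀ J ∈ 𝓛, I ⊂ J → i ∈ J

lemma mem_par {i : α} : i ∈ par U 𝓛 I ↔ i ∈ U ∧ ∀ J ∈ 𝓛, I ⊂ J → i ∈ J := by
  simp [par]

lemma par_subset (hJ : J ∈ 𝓛) (h : I ⊂ J) : par U 𝓛 I ⊆ J := fun _ hi => (mem_par.1 hi).2 J hJ h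

lemma subset_par (h : I ⊆ U) : I ⊆ par U 𝓛 I :=
  fun _ hi => mem_par.2 ⟨h hi, fun _ _ hJ => hJ.subset hi⟩

lemma par_eq_or_mem (hI : I.Nonempty) (hU : ∀ J ∈ 𝓛, J ⊆ U)
    (hc : ∀ J ∈ 𝓛, ∀ K ∈ 𝓛, Compat J K) :
    par U 𝓛 I = U ∨ (par U 𝓛 I ∈ 𝓛 ∧ I ⊂ par U 𝓛 I) := by
  by_cases h : ∃ J ∈ 𝓛, I ⊂ J
  · right
    obtain ⟨J, hJ, hmin⟩ := Finset.exists_min_image (𝓛.filter fun J => I ⊂ J) Finset.card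
      (by obtain ⟨J, hJ⟩ := h; exact ⟨J, by simpa using hJ⟩)
    rw [Finset.mem_filter] at hJ
    have : par U 𝓛 I = J := by
      refine (par_subset hJ.1 hJ.2).antisymm fun i hi => mem_par.2 ⟨hU J hJ.1 hi, ?_⟩
      intro K hK hIK
      have h1 := hmin K (Finset.mem_filter.2 ⟨hK, hIK⟩)
      rcases hc J hJ.1 K hK with h | h | h
      · exact h hi
      · rw [Finset.eq_of_subset_of_card_le h h1]
        exact hi
      · obtain ⟨x, hx⟩ := hI
        exact absurd (hIK.subset hx) (Finset.disjoint_left.1 h (hJ.2.subset hx))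
    rw [this]
    exact hJ
  · left
    push Not at h
    ext i
    rw [mem_par]
    exact ⟨fun h' => h'.1, fun h' => ⟨h', fun J hJ hIJ => absurd hIJ (h J hJ)⟩⟩

lemma par_mem_insert (hI : I.Nonempty) (hU : ∀ J ∈ 𝓛, J ⊆ U)
    (hc : ∀ J ∈ 𝓛, ∀ K ∈ 𝓛, Compat J K) : par U 𝓛 I ∈ insert U 𝓛 :=
  (par_eq_or_mem hI hU hc).elim (fun h => by rw [h]; exact Finset.mem_insert_self _ _)
    fun h => Finset.mem_insert_of_mem h.1

lemma ssubset_par (hI : I.Nonempty) (hIU : I ⊂ U) (hU : ∀ J ∈ 𝓛, J ⊆ U)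
    (hc : ∀ J ∈ 𝓛, ∀ K ∈ 𝓛, Compat J K) : I ⊂ par U 𝓛 I :=
  (par_eq_or_mem hI hU hc).elim (fun h => h.symm ▸ hIU) fun h => h.2

lemma par_top (hU : ∀ J ∈ 𝓛, J ⊆ U) : par U 𝓛 U = U := by
  ext i
  rw [mem_par]
  exact ⟨fun h => h.1, fun h => ⟨h, fun J hJ hUJ => absurd (hU J hJ) hUJ.2⟩⟩

/-- A subset of a member `I` of a laminar family either has `I` as its parent or lies in a
member of the family with parent `I`. -/
lemma par_eq_or_exists_child (hU : ∀ J ∈ 𝓛, J ⊆ U) (hI : I ∈ insert U 𝓛)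
    (hc : ∀ J ∈ 𝓛, ∀ K ∈ 𝓛, Compat J K) (hJ : J.Nonempty) (hJI : J ⊂ I) :
    par U 𝓛 J = I ∨ ∃ K ∈ 𝓛, K ⊂ I ∧ par U 𝓛 K = I ∧ J ⊆ K := by
  have hIU : I ⊆ U := by
    rcases Finset.mem_insert.1 hI with rfl | h
    · exact subset_rfl
    · exact hU _ h
  have hdis : ∀ {A B : Finset α}, J ⊆ A → J ⊆ B → ¬ Disjoint A B := by
    intro A B hA hB h
    obtain ⟨x, hx⟩ := hJ
    exact Finset.disjoint_left.1 h (hA hx) (hB hx)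
  by_cases h : ∃ K ∈ 𝓛, K ⊂ I ∧ J ⊆ K
  · right
    obtain ⟨K, hK, hmax⟩ := Finset.exists_max_image (𝓛.filter fun K => K ⊂ I ∧ J ⊆ K) Finset.card
      (by obtain ⟨K, hK⟩ := h; exact ⟨K, by simpa using hK⟩)
    rw [Finset.mem_filter] at hK
    refine ⟨K, hK.1, hK.2.1, ?_, hK.2.2⟩
    ext i
    rw [mem_par]
    constructor
    · rintro ⟨hi, h⟩
      rcases Finset.mem_insert.1 hI with rfl | hI'
      · exact hi
      · exact h I hI' hK.2.1
    · refine fun hi => ⟨hIU hi, fun A hA hKA => ?_⟩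
      rcases Finset.mem_insert.1 hI with rfl | hI'
      · by_contra hiA
        have h1 := hmax A (Finset.mem_filter.2 ⟨hA, (Finset.ssubset_iff_of_subset (hU A hA)).2
          ⟨i, hi, hiA⟩, hK.2.2.trans hKA.subset⟩)
        exact absurd (Finset.card_lt_card hKA) (not_lt.2 h1)
      · rcases hc I hI' A hA with h | h | h
        · exact h hi
        · by_contra hiA
          have h1 := hmax A (Finset.mem_filter.2 ⟨hA, (Finset.ssubset_iff_of_subset h).2
            ⟨i, hi, hiA⟩, hK.2.2.trans hKA.subset⟩)
          exact absurd (Finset.card_lt_card hKA) (not_lt.2 h1)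
        · exact absurd h (hdis hJI.subset (hK.2.2.trans hKA.subset))
  · left
    push Not at h
    ext i
    rw [mem_par]
    constructor
    · rintro ⟨hi, h'⟩
      rcases Finset.mem_insert.1 hI with rfl | hI'
      · exact hi
      · exact h' I hI' hJI
    · refine fun hi => ⟨hIU hi, fun A hA hJA => ?_⟩
      rcases Finset.mem_insert.1 hI with rfl | hI'
      · by_contra hiA
        exact h A hA ((Finset.ssubset_iff_of_subset (hU A hA)).2 ⟨i, hi, hiA⟩) hJA.subset
      · rcases hc I hI' A hA with h'' | h'' | h''
        · exact h'' hi
        · by_contra hiA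
          exact h A hA ((Finset.ssubset_iff_of_subset h'').2 ⟨i, hi, hiA⟩) hJA.subset
        · exact absurd h'' (hdis hJI.subset hJA.subset)

end Laminar

variable {n : ℕ} {w : Fin n → ℚ} {r : Fin n} {𝓛 : Finset (Finset (Fin n))}

lemma Adm.one (hle : ∀ i, w i ≤ 1) {I : Finset (Fin n)} (h : Adm w r I) : Adm 1 r I :=
  ⟨h.1, h.2.1.trans_le (Finset.sum_le_sum fun i _ => hle i),
    h.2.2.trans_le (Finset.sum_le_sum fun i _ => hle i)⟩

lemma adm_one_iff {I : Finset (Fin n)} : Adm 1 r I ↔ r ∉ I ∧ 1 < I.card ∧ 1 < Iᶜ.card := by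
  simp [Adm]

lemma IsLam.one (hle : ∀ i, w i ≤ 1) (h : IsLam w r 𝓛) : IsLam 1 r 𝓛 :=
  ⟨fun I hI => (h.1 I hI).one hle, h.2⟩

lemma IsLam.nonempty (h : IsLam w r 𝓛) {I : Finset (Fin n)} (hI : I ∈ insert Finset.univ 𝓛) :
    I.Nonempty := by
  rcases Finset.mem_insert.1 hI with rfl | hI
  · exact ⟨r, Finset.mem_univ _⟩
  · exact (h.1 I hI).nonempty

lemma IsLam.ne_univ (h : IsLam w r 𝓛) {I : Finset (Fin n)} (hI : I ∈ 𝓛) : I ≠ Finset.univ := by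
  rintro rfl
  exact (h.1 _ hI).1 (Finset.mem_univ _)

lemma IsLam.singleton_notMem (h : IsLam 1 r 𝓛) (i : Fin n) : {i} ∉ 𝓛 := fun hi => by
  have := (adm_one_iff.1 (h.1 _ hi)).2.1
  simp at this

namespace Canon

/-! ### The canonical tree of a laminar family -/

/-- The vertices of the canonical tree of `𝓛` are the members of `𝓛` and the set of all
markings, the root. -/
def vs (𝓛 : Finset (Finset (Fin n))) (p : Fin (insert Finset.univ 𝓛).card) : Finset (Fin n) :=
  ((insert Finset.univ 𝓛).equivFin.symm p).1

lemma vs_mem (p) : vs 𝓛 p ∈ insert Finset.univ 𝓛 := ((insert Finset.univ 𝓛).equivFin.symm p).2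

lemma vs_injective : Function.Injective (vs 𝓛) :=
  Subtype.val_injective.comp (insert Finset.univ 𝓛).equivFin.symm.injective

lemma exists_vs {I : Finset (Fin n)} (hI : I ∈ insert Finset.univ 𝓛) : ∃ p, vs 𝓛 p = I :=
  ⟨(insert Finset.univ 𝓛).equivFin ⟨I, hI⟩, by simp [vs]⟩

/-- In the canonical tree, every vertex but the root is joined to its parent. -/
def graph (𝓛 : Finset (Finset (Fin n))) : SimpleGraph (Fin (insert Finset.univ 𝓛).card) :=
  SimpleGraph.fromRel fun p q => par Finset.univ 𝓛 (vs 𝓛 p) = vs 𝓛 q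

lemma graph_adj {p q} : (graph 𝓛).Adj p q ↔ p ≠ q ∧
    (par Finset.univ 𝓛 (vs 𝓛 p) = vs 𝓛 q ∨ par Finset.univ 𝓛 (vs 𝓛 q) = vs 𝓛 p) := by
  simp [graph, SimpleGraph.fromRel_adj]

lemma ssubset_of_par (h : IsLam w r 𝓛) {p q} (hpq : p ≠ q)
    (he : par Finset.univ 𝓛 (vs 𝓛 p) = vs 𝓛 q) : vs 𝓛 p ∈ 𝓛 ∧ vs 𝓛 p ⊂ vs 𝓛 q := by
  rcases Finset.mem_insert.1 (vs_mem p) with h1 | h1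
  · rw [h1, par_top fun _ _ => Finset.subset_univ _] at he
    exact absurd (vs_injective (h1.trans he)) hpq
  · rw [← he]
    exact ⟨h1, ssubset_par (h.nonempty (vs_mem p)) (Finset.ssubset_univ_iff.2 (h.ne_univ h1))
      (fun _ _ => Finset.subset_univ _) h.2⟩

/-- The edge joining `I` to its parent is the only edge that connects a subset of `I` with a
vertex that is not a subset of `I`. -/
lemma subset_iff_subset (h : IsLam w r 𝓛) {x y} (hxy : x ≠ y)
    (he : par Finset.univ 𝓛 (vs 𝓛 x) = vs 𝓛 y) (u v) (huv : (graph 𝓛).Adj u v) :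
    ((vs 𝓛 u ⊆ vs 𝓛 x ↔ vs 𝓛 v ⊆ vs 𝓛 x) ↔ s(u, v) ≠ s(x, y)) := by
  obtain ⟨hx, hxy'⟩ := ssubset_of_par h hxy he
  have key : ∀ u v, u ≠ v → par Finset.univ 𝓛 (vs 𝓛 u) = vs 𝓛 v →
      ((vs 𝓛 u ⊆ vs 𝓛 x ↔ vs 𝓛 v ⊆ vs 𝓛 x) ↔ s(u, v) ≠ s(x, y)) := by
    intro u v hne huv
    obtain ⟨hu, huv'⟩ := ssubset_of_par h hne huv
    by_cases hux : u = x
    · subst hux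
      obtain rfl : v = y := vs_injective (huv.symm.trans he)
      simp [hxy'.not_subset]
    · have h1 : s(u, v) ≠ s(x, y) := by
        intro h'
        rcases Sym2.eq_iff.1 h' with ⟨h1, -⟩ | ⟨h1, h2⟩
        · exact hux h1
        · rw [h1, h2] at huv'
          exact huv'.asymm hxy'
      simp only [ne_eq, h1, not_false_eq_true, iff_true]
      refine ⟨fun h2 => ?_, fun h2 => huv'.subset.trans h2⟩
      rw [← huv]
      exact par_subset hx (h2.ssubset_of_ne fun h' => hux (vs_injective h'))
  obtain ⟨hne, h1 | h1⟩ := graph_adj.1 huv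
  · exact key u v hne h1
  · rw [Sym2.eq_swap, ← key v u hne.symm h1]
    exact iff_comm

lemma isTree (h : IsLam w r 𝓛) : (graph 𝓛).IsTree := by
  obtain ⟨p₀, hp₀⟩ := exists_vs (𝓛 := 𝓛) (Finset.mem_insert_self Finset.univ 𝓛)
  constructor
  · have key : ∀ k p, (vs 𝓛 p)ᶜ.card = k → (graph 𝓛).Reachable p p₀ := by
      intro k
      induction k using Nat.strong_induction_on with
      | _ k ih =>
      intro p hk
      by_cases hp : p = p₀
      · exact hp ▸ .rfl
      · have hp1 : vs 𝓛 p ≠ Finset.univ := fun h' => hp (vs_injective (h'.trans hp₀.symm))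
        have hp2 := ssubset_par (h.nonempty (vs_mem p)) (Finset.ssubset_univ_iff.2 hp1)
          (fun _ _ => Finset.subset_univ _) h.2
        obtain ⟨q, hq⟩ := exists_vs (par_mem_insert (h.nonempty (vs_mem p))
          (fun _ _ => Finset.subset_univ _) h.2)
        rw [← hq] at hp2
        have hadj : (graph 𝓛).Adj p q :=
          graph_adj.2 ⟨fun h' => hp2.ne (h' ▸ rfl), .inl hq.symm⟩
        refine hadj.reachable.trans (ih _ ?_ q rfl)
        rw [← hk]
        exact Finset.card_lt_card (Finset.compl_ssubset_compl.2 hp2)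
    have : Nonempty (Fin (insert Finset.univ 𝓛).card) := ⟨p₀⟩
    exact ⟨fun u v => (key _ u rfl).trans (key _ v rfl).symm⟩
  · refine isAcyclic_of_coloring fun x y hxy => ?_
    obtain ⟨hne, h1 | h1⟩ := graph_adj.1 hxy
    · exact ⟨fun v => vs 𝓛 v ⊆ vs 𝓛 x, subset_iff_subset h hne h1⟩
    · refine ⟨fun v => vs 𝓛 v ⊆ vs 𝓛 y, ?_⟩
      rw [Sym2.eq_swap]
      exact subset_iff_subset h hne.symm h1

/-- The canonical tree of a laminar family. A marking `i` is attached to the smallest vertex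
that contains it. -/
def tree (h : IsLam w r 𝓛) : MarkedTree n where
  numVert := (insert Finset.univ 𝓛).card
  graph := graph 𝓛
  isTree := isTree h
  mark i := (exists_vs (par_mem_insert (Finset.singleton_nonempty i)
    (fun _ _ => Finset.subset_univ _) h.2)).choose

lemma vs_mark (h : IsLam w r 𝓛) (i : Fin n) :
    vs 𝓛 ((tree h).mark i) = par Finset.univ 𝓛 {i} :=
  (exists_vs (par_mem_insert (Finset.singleton_nonempty i)
    (fun _ _ => Finset.subset_univ _) h.2)).choose_spec

/-- The canonical curve with prescribed lengths for the edges of the canonical tree. The ends of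
an edge are nested sets, so the smaller one, which is the side of the edge, is their
intersection. -/
def curve (h : IsLam w r 𝓛) (c : Finset (Fin n) → ℝ) (hc : ∀ I ∈ 𝓛, 0 < c I) : TropCurve n where
  toMarkedTree := tree h
  len e := Sym2.lift ⟨fun p q => c (vs 𝓛 p ∩ vs 𝓛 q), fun p q => by
    beta_reduce
    rw [Finset.inter_comm]⟩ e.1
  len_pos := by
    rintro ⟨e, he⟩
    induction e using Sym2.ind with
    | _ p q =>
    obtain ⟨hne, h1 | h1⟩ := graph_adj.1 he
    · obtain ⟨h2, h3⟩ := ssubset_of_par h hne h1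
      change 0 < c (vs 𝓛 p ∩ vs 𝓛 q)
      rw [Finset.inter_eq_left.2 h3.subset]
      exact hc _ h2
    · obtain ⟨h2, h3⟩ := ssubset_of_par h hne.symm h1
      change 0 < c (vs 𝓛 p ∩ vs 𝓛 q)
      rw [Finset.inter_eq_right.2 h3.subset]
      exact hc _ h2

lemma mark_subset_iff (h : IsLam 1 r 𝓛) {I : Finset (Fin n)} (hI : I ∈ 𝓛) (i : Fin n) :
    vs 𝓛 ((tree h).mark i) ⊆ I ↔ i ∈ I := by
  rw [vs_mark]
  constructor
  · exact fun h' => h' (subset_par (Finset.subset_univ _) (Finset.mem_singleton_self i))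
  · refine fun hi => par_subset hI ((Finset.singleton_subset_iff.2 hi).ssubset_of_ne ?_)
    rintro rfl
    exact h.singleton_notMem i hI

lemma sideSet_eq (h : IsLam 1 r 𝓛) {p q} (hne : p ≠ q)
    (he : par Finset.univ 𝓛 (vs 𝓛 p) = vs 𝓛 q) : (tree h).sideSet r s(p, q) = vs 𝓛 p := by
  have hp := (ssubset_of_par h hne he).1
  ext i
  rw [MarkedTree.mem_sideSet]
  have h1 := sep_iff_of_coloring (tree h).isTree (e := s(p, q))
    (show (graph 𝓛).Adj p q from graph_adj.2 ⟨hne, .inl he⟩)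
    (χ := fun v => vs 𝓛 v ⊆ vs 𝓛 p) (subset_iff_subset h hne he)
    ((tree h).mark r) ((tree h).mark i)
  rw [h1, mark_subset_iff h hp, mark_subset_iff h hp]
  simp [(h.1 _ hp).1]

lemma isStable (hpos : ∀ i, 0 < w i) (hle : ∀ i, w i ≤ 1) (hsum : 2 < ∑ i, w i)
    (h : IsLam w r 𝓛) : (tree (h.one hle)).IsStable w := by
  have h' := h.one hle
  intro p
  set I := vs 𝓛 p with hI
  have hIV : I ∈ insert Finset.univ 𝓛 := vs_mem p
  -- the neighbours of `I` are its children and its parent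
  set ch := 𝓛.filter fun J => J ⊂ I ∧ par Finset.univ 𝓛 J = I with hch
  set A : Finset (Finset (Fin n)) := if I = Finset.univ then ch else insert (par Finset.univ 𝓛 I) ch
    with hA
  have hUniv : ∀ J ∈ 𝓛, J ⊆ Finset.univ := fun _ _ => Finset.subset_univ _
  have hpar : I ≠ Finset.univ → I ⊂ par Finset.univ 𝓛 I := fun hne =>
    ssubset_par (h.nonempty hIV) (Finset.ssubset_univ_iff.2 hne) hUniv h.2
  have hAcard : A.card ≤ ((tree h').graph.neighborSet p).ncard := by
    have hAV : ∀ J ∈ A, ∃ q : Fin (tree h').numVert, vs 𝓛 q = J ∧ (graph 𝓛).Adj p q := by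
      intro J hJ
      have hcase : J ∈ ch ∨ (I ≠ Finset.univ ∧ J = par Finset.univ 𝓛 I) := by
        rw [hA] at hJ
        split_ifs at hJ with hu
        · exact .inl hJ
        · exact (Finset.mem_insert.1 hJ).symm.imp id fun h => ⟨hu, h⟩
      rcases hcase with hJ | ⟨hne, rfl⟩
      · rw [hch, Finset.mem_filter] at hJ
        obtain ⟨q, rfl⟩ := exists_vs (Finset.mem_insert_of_mem hJ.1)
        exact ⟨q, rfl, graph_adj.2 ⟨fun h => hJ.2.1.ne (h ▸ rfl), .inr hJ.2.2⟩⟩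
      · obtain ⟨q, hq⟩ := exists_vs (par_mem_insert (h.nonempty hIV) hUniv h.2)
        refine ⟨q, hq, graph_adj.2 ⟨fun h => (hpar hne).ne ?_, .inl hq.symm⟩⟩
        rw [← hq, hI, h]
    have : Nonempty (Fin (tree h').numVert) := ⟨p⟩
    choose! g hg using hAV
    have h1 : (A.image g : Set _) ⊆ (tree h').graph.neighborSet p := by
      intro q hq
      obtain ⟨J, hJ, rfl⟩ := Finset.mem_image.1 (Finset.mem_coe.1 hq)
      exact (hg J hJ).2
    have h2 := Set.ncard_le_ncard h1 (Set.toFinite _)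
    rw [Set.ncard_coe_finset, Finset.card_image_of_injOn] at h2
    · exact h2
    · intro J hJ K hK hJK
      rw [← (hg J hJ).1, ← (hg K hK).1]
      exact congrArg _ hJK
  have hmark : ∀ i ∈ I, (∀ J ∈ ch, i ∉ J) → (tree h').mark i = p := by
    intro i hi hJ
    refine vs_injective ?_
    rw [vs_mark]
    by_cases hsing : ({i} : Finset (Fin n)) = I
    · exfalso
      rcases Finset.mem_insert.1 hIV with h1 | h1
      · have h2 : ∑ j, w j = w i := by rw [← h1, ← hsing, Finset.sum_singleton]
        linarith [hle i]
      · exact h'.singleton_notMem i (hsing ▸ h1)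
    · rcases par_eq_or_exists_child hUniv hIV h.2 (Finset.singleton_nonempty i)
        ((Finset.singleton_subset_iff.2 hi).ssubset_of_ne hsing) with
        h1 | ⟨K, hK, hKI, hKp, hiK⟩
      · exact h1
      · exact absurd (Finset.singleton_subset_iff.1 hiK)
          (hJ K (Finset.mem_filter.2 ⟨hK, hKI, hKp⟩))
  have hwt : ∀ B : Finset (Fin n), (∀ i ∈ B, i ∈ I ∧ ∀ J ∈ ch, i ∉ J) →
      ∑ i ∈ B, w i ≤ ∑ i with (tree h').mark i = p, w i := by
    intro B hB
    refine Finset.sum_le_sum_of_subset_of_nonneg (fun i hi => ?_) fun i _ _ => (hpos i).le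
    simpa using hmark i (hB i hi).1 (hB i hi).2
  have hnn := hwt ∅ (by simp)
  rw [Finset.sum_empty] at hnn
  have hAc : (A.card : ℚ) ≤ (((tree h').graph.neighborSet p).ncard : ℚ) := by exact_mod_cast hAcard
  refine lt_of_lt_of_le ?_ (add_le_add_right hAc _)
  by_cases hu : I = Finset.univ
  · rw [hA, if_pos hu]
    rcases Nat.lt_or_ge ch.card 3 with hlt | hge
    · interval_cases hcard : ch.card
      · have h0 := Finset.card_eq_zero.1 hcard
        have := hwt Finset.univ (fun i _ => ⟨by rw [hu]; exact Finset.mem_univ _, by simp [h0]⟩)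
        push_cast
        linarith
      · obtain ⟨J, hJ⟩ := Finset.card_eq_one.1 hcard
        have hJ𝓛 : J ∈ 𝓛 := (Finset.mem_filter.1 (hJ ▸ Finset.mem_singleton_self J : J ∈ ch)).1
        have := hwt Jᶜ (fun i hi => ⟨by rw [hu]; exact Finset.mem_univ _, by simpa [hJ] using hi⟩)
        have := (h.1 J hJ𝓛).2.2
        push_cast
        linarith
      · have := hwt {r} (fun i hi => ⟨by rw [hu]; exact Finset.mem_univ _, fun J hJ => by
          rw [Finset.mem_singleton.1 hi]
          exact (h.1 J (Finset.mem_filter.1 hJ).1).1⟩)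
        rw [Finset.sum_singleton] at this
        push_cast
        linarith [hpos r]
    · have : (3 : ℚ) ≤ ch.card := by exact_mod_cast hge
      linarith
  · have hpch : par Finset.univ 𝓛 I ∉ ch := fun h1 =>
      (hpar hu).asymm (Finset.mem_filter.1 h1).2.1
    have hI𝓛 : I ∈ 𝓛 := (Finset.mem_insert.1 hIV).resolve_left hu
    rw [hA, if_neg hu, Finset.card_insert_of_notMem hpch]
    rcases Nat.lt_or_ge ch.card 2 with hlt | hge
    · interval_cases hcard : ch.card
      · have h0 := Finset.card_eq_zero.1 hcard
        have := hwt I (fun i hi => ⟨hi, by simp [h0]⟩)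
        have := (h.1 I hI𝓛).2.1
        push_cast
        linarith
      · obtain ⟨J, hJ⟩ := Finset.card_eq_one.1 hcard
        have hJI : J ⊂ I := (Finset.mem_filter.1 (hJ ▸ Finset.mem_singleton_self J : J ∈ ch)).2.1
        obtain ⟨i, hi, hiJ⟩ := Finset.exists_of_ssubset hJI
        have := hwt {i} (fun j hj => by
          rw [Finset.mem_singleton.1 hj]
          exact ⟨hi, by simpa [hJ] using hiJ⟩)
        rw [Finset.sum_singleton] at this
        push_cast
        linarith [hpos i]
    · have : (2 : ℚ) ≤ ch.card := by exact_mod_cast hge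
      push_cast
      linarith

end Canon

end

section

/-! ### Split coordinates of tropical curves -/

variable {n : ℕ} {w : Fin n → ℚ} {r : Fin n}

namespace MarkedTree

open Classical in
/-- The vector that has the entry `ℓ e` at the side of each edge `e`. -/
def push (T : MarkedTree n) (r : Fin n) :
    (T.graph.edgeSet → ℝ) →ₗ[ℝ] (Finset (Fin n) → ℝ) where
  toFun ℓ I := ∑ e ∈ (Finset.univ : Finset T.graph.edgeSet).filter
    fun e => T.sideSet r e.1 = I, ℓ e
  map_add' ℓ ℓ' := by
    funext I
    simp [Finset.sum_add_distrib]
  map_smul' a ℓ := by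
    funext I
    simp [Finset.mul_sum]

open Classical in
lemma push_apply {T : MarkedTree n} (ℓ : T.graph.edgeSet → ℝ) (I : Finset (Fin n)) :
    T.push r ℓ I = ∑ e ∈ (Finset.univ : Finset T.graph.edgeSet).filter
      fun e => T.sideSet r e.1 = I, ℓ e := rfl

lemma push_nonneg {T : MarkedTree n} {ℓ : T.graph.edgeSet → ℝ} (h : ∀ e, 0 ≤ ℓ e)
    (I : Finset (Fin n)) : 0 ≤ T.push r ℓ I := by
  rw [push_apply]
  exact Finset.sum_nonneg fun e _ => h e

lemma push_of_notMem {T : MarkedTree n} (ℓ : T.graph.edgeSet → ℝ) {I : Finset (Fin n)}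
    (hI : I ∉ T.sides r) : T.push r ℓ I = 0 := by
  rw [push_apply]
  refine Finset.sum_eq_zero fun e he => ?_
  exact absurd (mem_sides.2 ⟨e, (Finset.mem_filter.1 he).2⟩) hI

lemma IsStable.push_sideSet {T : MarkedTree n} (hT : T.IsStable w) (hw : ∀ i, 0 ≤ w i)
    (ℓ : T.graph.edgeSet → ℝ) (e : T.graph.edgeSet) : T.push r ℓ (T.sideSet r e) = ℓ e := by
  rw [push_apply]
  refine (Finset.sum_eq_single e (fun e' he' hne => ?_) fun h => ?_)
  · exact absurd (Subtype.ext (hT.sideSet_injOn hw e'.2 e.2 (Finset.mem_filter.1 he').2)) hne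
  · simp at h

end MarkedTree

/-- The split coordinates of a tropical curve `C`: the entry at `I` is the length of the edge whose
side, not containing the marking `r`, is `I`. -/
def TropCurve.coord (r : Fin n) (C : TropCurve n) : Finset (Fin n) → ℝ := C.push r C.len

/-- The set of the indices of the nonzero entries of `c`. -/
def supp (c : Finset (Fin n) → ℝ) : Finset (Finset (Fin n)) := Finset.univ.filter fun I => c I ≠ 0

lemma mem_supp {c : Finset (Fin n) → ℝ} {I : Finset (Fin n)} : I ∈ supp c ↔ c I ≠ 0 := by
  simp [supp]

lemma notMem_supp {c : Finset (Fin n) → ℝ} {I : Finset (Fin n)} : I ∉ supp c ↔ c I = 0 := by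
  simp [supp]

/-- `c` is the vector of split coordinates of a `w`-stable curve. -/
def IsCoord (w : Fin n → ℚ) (r : Fin n) (c : Finset (Fin n) → ℝ) : Prop :=
  (∀ I, 0 ≤ c I) ∧ IsLam w r (supp c)

lemma IsCoord.pos {c : Finset (Fin n) → ℝ} (h : IsCoord w r c) {I : Finset (Fin n)}
    (hI : I ∈ supp c) : 0 < c I := (h.1 I).lt_of_ne' (mem_supp.1 hI)

lemma IsCoord.one (hle : ∀ i, w i ≤ 1) {c : Finset (Fin n) → ℝ} (h : IsCoord w r c) :
    IsCoord 1 r c := ⟨h.1, h.2.one hle⟩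

lemma isCoord_push {T : MarkedTree n} (hT : T.IsStable w) (hw : ∀ i, 0 ≤ w i)
    {ℓ : T.graph.edgeSet → ℝ} (h : ∀ e, 0 ≤ ℓ e) : IsCoord w r (T.push r ℓ) := by
  refine ⟨MarkedTree.push_nonneg h, (hT.isLam_sides hw).mono fun I hI => ?_⟩
  by_contra hn
  exact mem_supp.1 hI (MarkedTree.push_of_notMem ℓ hn)

lemma TropCurve.isCoord_coord {C : TropCurve n} (hC : C.IsStable w) (hw : ∀ i, 0 ≤ w i) :
    IsCoord w r (C.coord r) := isCoord_push hC hw fun e => (C.len_pos e).le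

lemma TropCurve.supp_coord {C : TropCurve n} (hC : C.IsStable w) (hw : ∀ i, 0 ≤ w i) :
    supp (C.coord r) = C.sides r := by
  ext I
  constructor
  · intro hI
    by_contra hn
    exact mem_supp.1 hI (MarkedTree.push_of_notMem _ hn)
  · intro hI
    obtain ⟨e, rfl⟩ := MarkedTree.mem_sides.1 hI
    rw [mem_supp, TropCurve.coord, hC.push_sideSet hw]
    exact (C.len_pos e).ne'

namespace Canon

lemma isStable_one (hn : 2 < n) {𝓛 : Finset (Finset (Fin n))} (h : IsLam 1 r 𝓛) :
    (tree h).IsStable 1 :=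
  isStable (fun _ => one_pos) (fun _ => le_rfl) (by simpa using hn) h

lemma len_curve {𝓛 : Finset (Finset (Fin n))} (h : IsLam w r 𝓛)
    (c : Finset (Fin n) → ℝ) (hc : ∀ I ∈ 𝓛, 0 < c I) {p q} (hne : p ≠ q)
    (hpar : par Finset.univ 𝓛 (vs 𝓛 p) = vs 𝓛 q) (he) :
    (curve h c hc).len ⟨s(p, q), he⟩ = c (vs 𝓛 p) := by
  change c (vs 𝓛 p ∩ vs 𝓛 q) = _
  rw [Finset.inter_eq_left.2 (ssubset_of_par h hne hpar).2.subset]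

lemma coord_curve (hn : 2 < n) {𝓛 : Finset (Finset (Fin n))} (h : IsLam 1 r 𝓛)
    (c : Finset (Fin n) → ℝ) (hc : ∀ I ∈ 𝓛, 0 < c I) (hc0 : ∀ I ∉ 𝓛, c I = 0) :
    (curve h c hc).coord r = c := by
  have hs : (tree h).IsStable 1 := isStable_one hn h
  funext I
  by_cases hI : I ∈ 𝓛
  · obtain ⟨p, rfl⟩ := exists_vs (Finset.mem_insert_of_mem (b := Finset.univ) hI)
    obtain ⟨q, hq⟩ := exists_vs (par_mem_insert (h.nonempty (vs_mem p))
      (fun _ _ => Finset.subset_univ _) h.2)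
    have hlt := ssubset_par (h.nonempty (vs_mem p)) (Finset.ssubset_univ_iff.2 (h.ne_univ hI))
      (fun _ _ => Finset.subset_univ _) h.2
    have hne : p ≠ q := fun h' => hlt.ne (by rw [← hq, h'])
    have hadj : s(p, q) ∈ (tree h).graph.edgeSet := graph_adj.2 ⟨hne, .inl hq.symm⟩
    have h1 := hs.push_sideSet (r := r) (fun _ => zero_le_one) (curve h c hc).len ⟨s(p, q), hadj⟩
    refine (congrArg _ (sideSet_eq h hne hq.symm).symm).trans (h1.trans ?_)
    exact len_curve h c hc hne hq.symm hadj
  · rw [hc0 I hI]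
    refine MarkedTree.push_of_notMem _ fun h' => hI ?_
    obtain ⟨⟨e, he⟩, rfl⟩ := MarkedTree.mem_sides.1 h'
    induction e using Sym2.ind with
    | _ p q =>
    obtain ⟨hne, h1 | h1⟩ := graph_adj.1 he
    · have := sideSet_eq h hne h1
      exact this ▸ (ssubset_of_par h hne h1).1
    · have h2 : (tree h).sideSet r s(p, q) = vs 𝓛 q :=
        (congrArg _ Sym2.eq_swap).trans (sideSet_eq h hne.symm h1)
      exact h2 ▸ (ssubset_of_par h hne.symm h1).1

section Contraction

variable {T : MarkedTree n} {ℓ : T.graph.edgeSet → ℝ}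

open Classical in
/-- The vertex of the canonical tree to which a vertex of a tree is contracted, as a set
of markings: the smallest side of an edge of nonzero length that contains the vertex. -/
def target (T : MarkedTree n) (r : Fin n) (ℓ : T.graph.edgeSet → ℝ) (v : Fin T.numVert) :
    Finset (Fin n) :=
  Finset.univ.filter fun i => ∀ e : T.graph.edgeSet, ℓ e ≠ 0 →
    Sep T.graph e (T.mark r) v → Sep T.graph e (T.mark r) (T.mark i)

lemma mem_target {v : Fin T.numVert} {i : Fin n} : i ∈ target T r ℓ v ↔
    ∀ e : T.graph.edgeSet, ℓ e ≠ 0 →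
      Sep T.graph e (T.mark r) v → Sep T.graph e (T.mark r) (T.mark i) := by
  simp [target]

lemma mem_supp_push (hT : T.IsStable 1) {I : Finset (Fin n)} :
    I ∈ supp (T.push r ℓ) ↔ ∃ e : T.graph.edgeSet, ℓ e ≠ 0 ∧ T.sideSet r e = I := by
  rw [mem_supp]
  constructor
  · intro h
    have hI : I ∈ T.sides r := by
      by_contra hn
      exact h (MarkedTree.push_of_notMem ℓ hn)
    obtain ⟨e, rfl⟩ := MarkedTree.mem_sides.1 hI
    rw [hT.push_sideSet fun _ => zero_le_one] at h
    exact ⟨e, h, rfl⟩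
  · rintro ⟨e, he, rfl⟩
    rwa [hT.push_sideSet fun _ => zero_le_one]

lemma target_far (hT : T.IsStable 1) {x y : Fin T.numVert} (h : T.graph.Adj x y)
    (hy : Sep T.graph s(x, y) (T.mark r) y) (hℓ : ℓ ⟨s(x, y), h⟩ ≠ 0) :
    target T r ℓ y = T.sideSet r s(x, y) := by
  ext i
  rw [mem_target]
  constructor
  · exact fun h' => MarkedTree.mem_sideSet.2 (h' ⟨_, h⟩ hℓ hy)
  · intro hi e _ he
    exact MarkedTree.mem_sideSet.1
      ((hT.sideSet_subset_iff (fun _ => zero_le_one) h hy).2 he hi)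

lemma target_mem (v : Fin T.numVert) :
    target T r ℓ v = Finset.univ ∨ ∃ x y, ∃ h : T.graph.Adj x y,
      ℓ ⟨s(x, y), h⟩ ≠ 0 ∧ Sep T.graph s(x, y) (T.mark r) y ∧ Sep T.graph s(x, y) (T.mark r) v ∧
      target T r ℓ v = T.sideSet r s(x, y) := by
  classical
  by_cases hex : ∃ e : T.graph.edgeSet, ℓ e ≠ 0 ∧ Sep T.graph e (T.mark r) v
  · right
    obtain ⟨e, he, hmin⟩ := Finset.exists_min_image (Finset.univ.filter fun e : T.graph.edgeSet =>
      ℓ e ≠ 0 ∧ Sep T.graph e (T.mark r) v) (fun e => (T.sideSet r e).card)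
      (by obtain ⟨e, he⟩ := hex; exact ⟨e, by simpa using he⟩)
    simp only [Finset.mem_filter, Finset.mem_univ, true_and] at he hmin
    obtain ⟨⟨e, hadj⟩, rfl⟩ : ∃ e', e' = e := ⟨e, rfl⟩
    obtain ⟨x, y, rfl, h, -, hy⟩ := exists_far T.isTree hadj (T.mark r)
    refine ⟨x, y, h, he.1, hy, he.2, ?_⟩
    ext i
    rw [mem_target, MarkedTree.mem_sideSet]
    refine ⟨fun h' => h' ⟨_, h⟩ he.1 he.2, fun hi e' he' hv => ?_⟩
    have h1 := hmin e' ⟨he', hv⟩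
    rcases sep_trichotomy T.isTree (s(x, y)) (e' : Sym2 (Fin T.numVert)) (T.mark r) e'.2 with
      h2 | h2 | h2
    · have h3 : T.sideSet r e' ⊆ T.sideSet r s(x, y) := fun i hi =>
        MarkedTree.mem_sideSet.2 (h2 _ (MarkedTree.mem_sideSet.1 hi))
      have h4 := Finset.eq_of_subset_of_card_le h3 h1
      exact MarkedTree.mem_sideSet.1 (h4 ▸ MarkedTree.mem_sideSet.2 hi)
    · exact h2 _ hi
    · exact absurd hv (h2 v he.2)
  · left
    push Not at hex
    ext i
    rw [mem_target]
    exact ⟨fun _ => Finset.mem_univ _, fun _ e he h => absurd h (hex e he)⟩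

lemma target_subset_iff (hT : T.IsStable 1) {e : T.graph.edgeSet} (he : ℓ e ≠ 0)
    (v : Fin T.numVert) : target T r ℓ v ⊆ T.sideSet r e ↔ Sep T.graph e (T.mark r) v := by
  constructor
  · intro h
    rcases target_mem (r := r) (ℓ := ℓ) v with h1 | ⟨x, y, hxy, -, hy, hv, h1⟩
    · rw [h1] at h
      exact absurd (MarkedTree.mem_sideSet.1 (h (Finset.mem_univ r))) (not_sep_self _ _)
    · rw [h1, hT.sideSet_subset_iff (fun _ => zero_le_one) hxy hy] at h
      by_cases hee : (e : Sym2 (Fin T.numVert)) = s(x, y)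
      · rwa [hee]
      · exact sep_of_sep (Sym2.mem_mk_right x y) h hv
  · exact fun h i hi => MarkedTree.mem_sideSet.2 (mem_target.1 hi e he h)

lemma target_near (hT : T.IsStable 1) {x y : Fin T.numVert} (h : T.graph.Adj x y)
    (hy : Sep T.graph s(x, y) (T.mark r) y) :
    target T r ℓ x = par Finset.univ (supp (T.push r ℓ)) (T.sideSet r s(x, y)) := by
  have hG := T.isTree
  ext i
  rw [mem_target, mem_par]
  have key : ∀ e : T.graph.edgeSet,
      T.sideSet r s(x, y) ⊂ T.sideSet r e ↔ Sep T.graph e (T.mark r) x := by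
    intro e
    have h1 := hT.sideSet_subset_iff (fun _ => zero_le_one) h hy (e' := (e : Sym2 (Fin T.numVert)))
    have h2 := sep_xor hG (e : Sym2 (Fin T.numVert)) (T.mark r) x y
    rw [sep_adj hG h] at h2
    rw [Finset.ssubset_iff_subset_ne, h1]
    by_cases hee : (e : Sym2 (Fin T.numVert)) = s(x, y)
    · rw [hee] at h2 ⊢
      simp only [ne_eq, not_true_eq_false, and_false, false_iff]
      tauto
    · have : T.sideSet r s(x, y) ≠ T.sideSet r e := fun h' =>
        hee (hT.sideSet_injOn (fun _ => zero_le_one) h e.2 h').symm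
      tauto
  constructor
  · refine fun h' => ⟨Finset.mem_univ _, fun J hJ hJ' => ?_⟩
    obtain ⟨e, he, rfl⟩ := (mem_supp_push hT).1 hJ
    exact MarkedTree.mem_sideSet.2 (h' e he ((key e).1 hJ'))
  · rintro ⟨-, h'⟩ e he hx
    exact MarkedTree.mem_sideSet.1 (h' _ ((mem_supp_push hT).2 ⟨e, he, rfl⟩) ((key e).2 hx))

/-- The curve with the split coordinates obtained from the lengths `ℓ` is the contraction
of the tree. -/
theorem isContraction (hT : T.IsStable 1)
    (h : IsLam 1 r (supp (T.push r ℓ))) (hc : ∀ I ∈ supp (T.push r ℓ), 0 < T.push r ℓ I) :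
    IsContraction T ℓ (curve h (T.push r ℓ) hc) := by
  classical
  have hG := T.isTree
  have hex : ∀ v, ∃ p, vs (supp (T.push r ℓ)) p = target T r ℓ v := by
    intro v
    refine exists_vs ?_
    rcases target_mem (r := r) (ℓ := ℓ) v with h1 | ⟨x, y, hxy, h2, -, -, h1⟩
    · rw [h1]
      exact Finset.mem_insert_self _ _
    · rw [h1]
      exact Finset.mem_insert_of_mem ((mem_supp_push hT).2 ⟨⟨_, hxy⟩, h2, rfl⟩)
  choose f hf using hex
  refine ⟨f, ?_, ?_, ?_, ?_⟩
  · intro p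
    rcases Finset.mem_insert.1 (vs_mem (𝓛 := supp (T.push r ℓ)) p) with h1 | h1
    · refine ⟨T.mark r, vs_injective ?_⟩
      rw [hf, h1]
      ext i
      rw [mem_target]
      exact ⟨fun _ => Finset.mem_univ _, fun _ e _ h' => absurd h' (not_sep_self _ _)⟩
    · obtain ⟨⟨e, he⟩, hne, h2⟩ := (mem_supp_push hT).1 h1
      obtain ⟨x, y, rfl, hxy, -, hy⟩ := exists_far hG he (T.mark r)
      refine ⟨y, vs_injective ?_⟩
      rw [hf, ← h2]
      exact target_far hT hxy hy hne
  · intro i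
    refine vs_injective ?_
    rw [hf]
    refine Eq.trans ?_ (vs_mark h i).symm
    ext j
    rw [mem_target, mem_par]
    constructor
    · refine fun h' => ⟨Finset.mem_univ _, fun J hJ hJ' => ?_⟩
      obtain ⟨e, he, rfl⟩ := (mem_supp_push hT).1 hJ
      exact MarkedTree.mem_sideSet.2
        (h' e he (MarkedTree.mem_sideSet.1 (Finset.singleton_subset_iff.1 hJ'.subset)))
    · rintro ⟨-, h'⟩ e he hi
      have hJ := (mem_supp_push (r := r) hT).2 ⟨e, he, rfl⟩
      refine MarkedTree.mem_sideSet.1 (h' _ hJ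
        ((Finset.singleton_subset_iff.2 (MarkedTree.mem_sideSet.2 hi)).ssubset_of_ne ?_))
      intro h''
      exact h.singleton_notMem i (h'' ▸ hJ)
  · intro u v
    have h1 : f u = f v ↔ ∀ e : T.graph.edgeSet, ℓ e ≠ 0 → ¬ Sep T.graph e u v := by
      constructor
      · intro huv e he
        have hu := target_subset_iff (r := r) hT he u
        have hv := target_subset_iff (r := r) hT he v
        rw [← hf, huv, hf, hv] at hu
        rw [sep_xor hG _ (T.mark r)]
        tauto
      · intro h'
        refine vs_injective ?_
        rw [hf, hf]
        ext i
        rw [mem_target, mem_target]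
        refine forall₂_congr fun e he => ?_
        have := h' e he
        rw [sep_xor hG _ (T.mark r)] at this
        tauto
    refine h1.trans ?_
    constructor
    · intro h'
      obtain ⟨p, hp, -⟩ := hG.existsUnique_path u v
      refine ⟨p.transfer _ fun e he => ?_⟩
      have he' := p.edges_subset_edgeSet he
      rw [SimpleGraph.edgeSet_fromEdgeSet]
      refine ⟨⟨he', ?_⟩, ?_⟩
      · by_contra hne
        exact h' ⟨e, he'⟩ hne ((mem_edges_iff_sep hG hp).1 he)
      · exact SimpleGraph.not_isDiag_of_mem_edgeSet _ he'
    · rintro ⟨p⟩ e he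
      refine not_sep_iff.2 ⟨p.mapLe ?_, fun h' => ?_⟩
      · intro a b hab
        obtain ⟨⟨h1, -⟩, -⟩ := (SimpleGraph.fromEdgeSet_adj _).1 hab
        exact h1
      · rw [SimpleGraph.Walk.edges_mapLe_eq_edges] at h'
        have := p.edges_subset_edgeSet h'
        rw [SimpleGraph.edgeSet_fromEdgeSet] at this
        obtain ⟨⟨_, h2⟩, -⟩ := this
        exact he h2
  · have key : ∀ x y, ∀ hxy : T.graph.Adj x y, Sep T.graph s(x, y) (T.mark r) y →
        ℓ ⟨s(x, y), hxy⟩ ≠ 0 → f y ≠ f x ∧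
        par Finset.univ (supp (T.push r ℓ)) (vs _ (f y)) = vs _ (f x) ∧
          vs _ (f y) = T.sideSet r s(x, y) := by
      intro x y hxy hy hne
      have h1 : vs _ (f y) = T.sideSet r s(x, y) := by
        rw [hf]
        exact target_far hT hxy hy hne
      refine ⟨fun h' => ?_, ?_, h1⟩
      · have hx := target_subset_iff (r := r) hT hne x
        rw [← hf, ← h', hf, target_subset_iff hT hne] at hx
        have h3 := sep_xor hG s(x, y) (T.mark r) x y
        rw [sep_adj hG hxy] at h3
        simp only [true_iff] at h3
        exact h3 hx.symm
      · rw [h1, hf x]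
        exact (target_near hT hxy hy).symm
    intro u v huv hne
    have h3 := sep_xor hG s(u, v) (T.mark r) u v
    rw [sep_adj hG huv] at h3
    by_cases hv : Sep T.graph s(u, v) (T.mark r) v
    · obtain ⟨h1, h2, h4⟩ := key u v huv hv hne
      have hadj : s(f v, f u) ∈ (curve h (T.push r ℓ) hc).graph.edgeSet :=
        graph_adj.2 ⟨h1, .inl h2⟩
      have h5 := len_curve h (T.push r ℓ) hc h1 h2 hadj
      rw [h4] at h5
      refine ⟨SimpleGraph.Adj.symm hadj, ?_⟩
      refine Eq.trans (congrArg _ (Subtype.ext Sym2.eq_swap)) (h5.trans ?_)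
      exact hT.push_sideSet (fun _ => zero_le_one) ℓ ⟨s(u, v), huv⟩
    · have hu : Sep T.graph s(v, u) (T.mark r) u := by
        rw [Sym2.eq_swap]
        tauto
      have hne' : ℓ ⟨s(v, u), huv.symm⟩ ≠ 0 := by
        convert hne using 2
        exact Subtype.ext Sym2.eq_swap
      obtain ⟨h1, h2, h4⟩ := key v u huv.symm hu hne'
      have hadj : s(f u, f v) ∈ (curve h (T.push r ℓ) hc).graph.edgeSet :=
        graph_adj.2 ⟨h1, .inl h2⟩
      have h5 := len_curve h (T.push r ℓ) hc h1 h2 hadj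
      rw [h4] at h5
      refine ⟨hadj, h5.trans ?_⟩
      rw [Sym2.eq_swap]
      exact hT.push_sideSet (fun _ => zero_le_one) ℓ ⟨s(u, v), huv⟩

end Contraction

end Canon

end

section

variable {n : ℕ} {w : Fin n → ℚ} {r : Fin n}

/-! ### Contractions and split coordinates -/

/-- Every edge of a contraction comes from an edge of nonzero length: a walk between preimages
of the ends of an edge has to cross it. -/
lemma exists_adj_of_contraction {T : MarkedTree n} {ℓ : T.graph.edgeSet → ℝ} {C : TropCurve n}
    {f : Fin T.numVert → Fin C.numVert}
    (h1 : ∀ u v, f u = f v ↔ (SimpleGraph.fromEdgeSet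
      {e | ∃ h : e ∈ T.graph.edgeSet, ℓ ⟨e, h⟩ = 0}).Reachable u v)
    (h2 : ∀ u v, ∀ h : T.graph.Adj u v, ℓ ⟨s(u, v), h⟩ ≠ 0 →
      ∃ h' : C.graph.Adj (f u) (f v), C.len ⟨s(f u, f v), h'⟩ = ℓ ⟨s(u, v), h⟩)
    {u v : Fin T.numVert} (huv : C.graph.Adj (f u) (f v)) :
    ∃ a b, ∃ h : T.graph.Adj a b, ℓ ⟨s(a, b), h⟩ ≠ 0 ∧ f a = f u ∧ f b = f v := by
  obtain ⟨p⟩ := T.isTree.1 u v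
  have key : ∀ x y (p : T.graph.Walk x y), Sep C.graph s(f u, f v) (f x) (f y) →
      ∃ a b, T.graph.Adj a b ∧ Sep C.graph s(f u, f v) (f a) (f b) := by
    intro x y p
    induction p with
    | nil => exact fun h => absurd h (not_sep_self _ _)
    | @cons x z y hxz p ih =>
      intro h
      by_cases h3 : Sep C.graph s(f u, f v) (f x) (f z)
      · exact ⟨x, z, hxz, h3⟩
      · refine ih ?_
        have := sep_xor C.isTree s(f u, f v) (f x) (f z) (f y)
        tauto
  obtain ⟨a, b, hab, hs⟩ := key u v p ((sep_adj C.isTree huv).2 rfl)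
  have hne : ℓ ⟨s(a, b), hab⟩ ≠ 0 := by
    intro h0
    have : f a = f b := (h1 a b).2 (SimpleGraph.Adj.reachable
      ((SimpleGraph.fromEdgeSet_adj _).2 ⟨⟨hab, h0⟩, hab.ne⟩))
    rw [this] at hs
    exact not_sep_self _ _ hs
  obtain ⟨h3, -⟩ := h2 a b hab hne
  have h4 := (sep_adj C.isTree h3).1 hs
  rcases Sym2.eq_iff.1 h4 with ⟨h5, h6⟩ | ⟨h5, h6⟩
  · exact ⟨a, b, hab, hne, h5.symm, h6.symm⟩
  · refine ⟨b, a, hab.symm, ?_, h5.symm, h6.symm⟩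
    convert hne using 2
    exact Subtype.ext Sym2.eq_swap

lemma IsContraction.iso {T : MarkedTree n} {ℓ : T.graph.edgeSet → ℝ} {C D : TropCurve n}
    (hC : IsContraction T ℓ C) (hD : IsContraction T ℓ D) : TropCurve.Iso C D := by
  obtain ⟨f, hf, hfm, hfr, hfe⟩ := hC
  obtain ⟨g, hg, hgm, hgr, hge⟩ := hD
  have hfg : ∀ u v, f u = f v ↔ g u = g v := fun u v => (hfr u v).trans (hgr u v).symm
  have hφ : ∀ u, g (Function.surjInv hf (f u)) = g u := fun u =>
    (hfg _ _).1 (Function.surjInv_eq hf (f u))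
  let φ : Fin C.numVert ≃ Fin D.numVert :=
    Equiv.ofBijective (fun x => g (Function.surjInv hf x)) (by
    constructor
    · intro x y hxy
      have := (hfg _ _).2 hxy
      rwa [Function.surjInv_eq hf, Function.surjInv_eq hf] at this
    · intro y
      obtain ⟨u, rfl⟩ := hg y
      exact ⟨f u, hφ u⟩)
  have hφ' : ∀ u, φ (f u) = g u := hφ
  have hadj : ∀ {x y}, D.graph.Adj (φ x) (φ y) ↔ C.graph.Adj x y := by
    intro x y
    obtain ⟨u, rfl⟩ := hf x
    obtain ⟨v, rfl⟩ := hf y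
    rw [hφ', hφ']
    constructor
    · intro h
      obtain ⟨a, b, hab, hne, h1, h2⟩ := exists_adj_of_contraction hgr hge h
      rw [← (hfg _ _).2 h1, ← (hfg _ _).2 h2]
      exact (hfe a b hab hne).1
    · intro h
      obtain ⟨a, b, hab, hne, h1, h2⟩ := exists_adj_of_contraction hfr hfe h
      rw [← (hfg _ _).1 h1, ← (hfg _ _).1 h2]
      exact (hge a b hab hne).1
  refine ⟨⟨φ, hadj⟩, fun i => ?_, ?_⟩
  · change φ (C.mark i) = _
    rw [← hfm, hφ', hgm]
  · rintro ⟨e, he⟩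
    induction e using Sym2.ind with
    | _ x y =>
    obtain ⟨u, rfl⟩ := hf x
    obtain ⟨v, rfl⟩ := hf y
    obtain ⟨a, b, hab, hne, h1, h2⟩ := exists_adj_of_contraction hfr hfe he
    obtain ⟨h3, h4⟩ := hfe a b hab hne
    obtain ⟨h5, h6⟩ := hge a b hab hne
    have h7 : C.len ⟨s(f u, f v), he⟩ = ℓ ⟨s(a, b), hab⟩ := by
      rw [← h4]
      congr 2
      rw [h1, h2]
    rw [h7, ← h6]
    congr 1
    refine Subtype.ext ?_
    change s(φ (f u), φ (f v)) = _
    rw [← h1, ← h2, hφ', hφ']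

lemma isContraction_self (C : TropCurve n) : IsContraction C.toMarkedTree C.len C := by
  refine ⟨id, Function.surjective_id, fun _ => rfl, fun u v => ?_, fun u v h _ => ⟨h, rfl⟩⟩
  have : {e | ∃ h : e ∈ C.graph.edgeSet, C.len ⟨e, h⟩ = 0} = ∅ := by
    ext e
    simp only [Set.mem_ofPred_eq, Set.mem_empty_iff_false, iff_false, not_exists]
    exact fun h => (C.len_pos _).ne'
  rw [this, SimpleGraph.fromEdgeSet_empty, SimpleGraph.reachable_bot]
  rfl

/-- Every admissible vector of split coordinates comes from a stable curve. -/
lemma exists_curve (hpos : ∀ i, 0 < w i) (hle : ∀ i, w i ≤ 1) (hsum : 2 < ∑ i, w i)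
    {c : Finset (Fin n) → ℝ} (h : IsCoord w r c) :
    ∃ C : TropCurve n, C.IsStable w ∧ C.coord r = c := by
  have hn : 2 < n := by
    have : ∑ i, w i ≤ ∑ i : Fin n, (1 : ℚ) := Finset.sum_le_sum fun i _ => hle i
    rw [Finset.sum_const, Finset.card_univ, Fintype.card_fin, nsmul_eq_mul, mul_one] at this
    exact_mod_cast hsum.trans_le this
  exact ⟨Canon.curve (h.2.one hle) c fun I hI => h.pos hI, Canon.isStable hpos hle hsum h.2,
    Canon.coord_curve hn _ _ _ fun I hI => notMem_supp.1 hI⟩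

/-- A stable curve is determined up to isomorphism by its split coordinates. -/
lemma class_eq_of_coord_eq {C D : TropCurve n} (hC : C.IsStable 1) (hD : D.IsStable 1)
    (h : C.coord r = D.coord r) : (⟦C⟧ : CurveClass n) = ⟦D⟧ := by
  have key : ∀ {C : TropCurve n} (hC : C.IsStable 1) (h1 : IsLam 1 r (supp (C.coord r)))
      (h2 : ∀ I ∈ supp (C.coord r), 0 < C.coord r I),
      TropCurve.Iso C (Canon.curve h1 (C.coord r) h2) := fun hC h1 h2 =>
    (isContraction_self _).iso (Canon.isContraction hC h1 h2)
  have hc := TropCurve.isCoord_coord (r := r) hC fun _ => zero_le_one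
  have hd := TropCurve.isCoord_coord (r := r) hD fun _ => zero_le_one
  refine Quotient.sound ((key hC hc.2 fun I hI => hc.pos hI).trans
    (TropCurve.Iso.trans ?_ (key hD hd.2 fun I hI => hd.pos hI).symm))
  have : ∀ c d : Finset (Fin n) → ℝ, c = d → ∀ h1 h2 h3 h4,
      TropCurve.Iso (Canon.curve (w := 1) (r := r) (𝓛 := supp c) h1 c h2)
        (Canon.curve (w := 1) (r := r) (𝓛 := supp d) h3 d h4) := by
    rintro c _ rfl _ _ _ _
    exact TropCurve.Iso.refl _
  exact this _ _ h _ _ _ _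

/-- Contracting a stable tree along lengths `ℓ` gives a stable curve with the corresponding split
coordinates. -/
lemma exists_contraction (hpos : ∀ i, 0 < w i) (hle : ∀ i, w i ≤ 1) (hsum : 2 < ∑ i, w i)
    {T : MarkedTree n} (hT : T.IsStable w) {ℓ : T.graph.edgeSet → ℝ} (hℓ : ∀ e, 0 ≤ ℓ e) :
    ∃ C : TropCurve n, C.IsStable w ∧ C.coord r = T.push r ℓ ∧ IsContraction T ℓ C := by
  have hn : 2 < n := by
    have : ∑ i, w i ≤ ∑ i : Fin n, (1 : ℚ) := Finset.sum_le_sum fun i _ => hle i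
    rw [Finset.sum_const, Finset.card_univ, Fintype.card_fin, nsmul_eq_mul, mul_one] at this
    exact_mod_cast hsum.trans_le this
  have h := isCoord_push (r := r) hT (fun i => (hpos i).le) hℓ
  exact ⟨Canon.curve (h.2.one hle) (T.push r ℓ) fun I hI => h.pos hI,
    Canon.isStable hpos hle hsum h.2,
    Canon.coord_curve hn _ _ _ fun I hI => notMem_supp.1 hI,
    Canon.isContraction (hT.one hle) _ _⟩

/-- The cone of a stable tree consists of the stable curves all of whose splits are splits of
the tree. -/
lemma mem_cone_iff (hpos : ∀ i, 0 < w i) (hle : ∀ i, w i ≤ 1) (hsum : 2 < ∑ i, w i)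
    {T : MarkedTree n} (hT : T.IsStable w) {x : CurveClass n} :
    x ∈ T.cone ↔ ∃ C : TropCurve n, C.IsStable w ∧ supp (C.coord r) ⊆ T.sides r ∧ x = ⟦C⟧ := by
  have hw : ∀ i, 0 ≤ w i := fun i => (hpos i).le
  constructor
  · rintro ⟨ℓ, D, hℓ, hD, rfl⟩
    obtain ⟨C, hC, hC', hC''⟩ := exists_contraction (r := r) hpos hle hsum hT hℓ
    refine ⟨C, hC, ?_, Quotient.sound (hD.iso hC'')⟩
    rw [hC']
    intro I hI
    by_contra hn
    exact mem_supp.1 hI (MarkedTree.push_of_notMem ℓ hn)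
  · rintro ⟨C, hC, hs, rfl⟩
    have hℓ : ∀ e : T.graph.edgeSet, 0 ≤ C.coord r (T.sideSet r e) := fun e =>
      (TropCurve.isCoord_coord hC hw).1 _
    obtain ⟨D, hD, hD', hD''⟩ := exists_contraction (r := r) hpos hle hsum hT hℓ
    refine ⟨_, D, hℓ, hD'', class_eq_of_coord_eq (r := r) (hC.one hle) (hD.one hle) ?_⟩
    rw [hD']
    funext I
    by_cases hI : I ∈ T.sides r
    · obtain ⟨e, rfl⟩ := MarkedTree.mem_sides.1 hI
      rw [hT.push_sideSet hw]
    · rw [MarkedTree.push_of_notMem _ hI]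
      exact notMem_supp.1 fun h => hI (hs h)

/-- Every laminar family of admissible sets is the family of sides of a stable tree. -/
lemma exists_tree (hpos : ∀ i, 0 < w i) (hle : ∀ i, w i ≤ 1) (hsum : 2 < ∑ i, w i)
    {𝓛 : Finset (Finset (Fin n))} (h : IsLam w r 𝓛) :
    ∃ T : MarkedTree n, T.IsStable w ∧ T.sides r = 𝓛 := by
  classical
  set c : Finset (Fin n) → ℝ := fun I => if I ∈ 𝓛 then 1 else 0 with hc
  have hs : supp c = 𝓛 := by
    ext I
    simp [mem_supp, hc]
  obtain ⟨C, hC, hC'⟩ := exists_curve (r := r) (c := c) hpos hle hsum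
    ⟨fun I => by simp only [hc]; split_ifs <;> norm_num, hs.symm ▸ h⟩
  refine ⟨C.toMarkedTree, hC, ?_⟩
  rw [← TropCurve.supp_coord hC fun i => (hpos i).le, hC', hs]

/-! ### Distances in split coordinates -/

open Classical in
lemma TropCurve.dist_eq_sum (C : TropCurve n) (i j : Fin n) :
    C.dist i j = ∑ e ∈ (Finset.univ : Finset C.graph.edgeSet).filter
      fun e => Sep C.graph e.1 (C.mark i) (C.mark j), C.len e := by
  unfold TropCurve.dist
  rw [finsum_mem_eq_finite_toFinset_sum _ (Set.toFinite _)]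
  refine Finset.sum_congr ?_ fun _ _ => rfl
  ext e
  simp [mem_edges_iff_sep C.isTree (C.path_isPath _ _)]

open Classical in
/-- The vector `v_I`: it is `-1` at the edges with both ends in `I` and zero at all others. -/
def negClique {a : Fin n} (G : SimpleGraph (Others a)) (I : Finset (Fin n)) : G.edgeSet → ℝ :=
  fun e => if ∀ k ∈ e.1, k.1 ∈ I then -1 else 0

/-- The linear map `c ↦ ∑ c_I v_I`. -/
def splitMap {a : Fin n} (G : SimpleGraph (Others a)) :
    (Finset (Fin n) → ℝ) →ₗ[ℝ] (G.edgeSet → ℝ) :=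
  Fintype.linearCombination ℝ (negClique G)

open Classical in
lemma splitMap_apply {a : Fin n} (G : SimpleGraph (Others a)) (c : Finset (Fin n) → ℝ)
    {k l : Others a} (h : s(k, l) ∈ G.edgeSet) :
    splitMap G c ⟨s(k, l), h⟩ =
      - ∑ I ∈ Finset.univ.filter (fun I : Finset (Fin n) => k.1 ∈ I ∧ l.1 ∈ I), c I := by
  rw [splitMap, Fintype.linearCombination_apply, Finset.sum_apply, Finset.sum_filter,
    ← Finset.sum_neg_distrib]
  refine Finset.sum_congr rfl fun I _ => ?_
  by_cases hI : k.1 ∈ I ∧ l.1 ∈ I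
  · simp [negClique, hI]
  · rw [if_neg hI]
    have : ¬ ∀ x ∈ s(k, l), x.1 ∈ I := by simpa using hI
    simp only [Pi.smul_apply, negClique, this, if_false, smul_zero, neg_zero]

lemma pairCoord_distVec (C : TropCurve n) {i j : Fin n} (h : i ≠ j) :
    pairCoord i j C.distVec = C.dist i j := by
  simp [pairCoord, h, TropCurve.distVec]

lemma edgeCoords_distVec {a : Fin n} (C : TropCurve n) {k l : Others a} (h : k ≠ l) (he) :
    edgeCoords a C.distVec ⟨s(k, l), he⟩ =
      - ∑ I ∈ Finset.univ.filter (fun I : Finset (Fin n) => k.1 ∈ I ∧ l.1 ∈ I), C.coord a I := by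
  classical
  have hkl : k.1 ≠ l.1 := fun h' => h (Subtype.ext h')
  have hk : a ≠ k.1 := fun h => k.2 h.symm
  have hl : a ≠ l.1 := fun h => l.2 h.symm
  have h1 : edgeCoords a C.distVec ⟨s(k, l), he⟩ =
      (1 / 2 : ℝ) * (C.dist k.1 l.1 - C.dist a k.1 - C.dist a l.1) := by
    rw [← pairCoord_distVec C hkl, ← pairCoord_distVec C hk, ← pairCoord_distVec C hl]
    simp [edgeCoords]
  rw [h1]
  simp only [TropCurve.coord, MarkedTree.push_apply]
  rw [Finset.sum_filter]
  have h2 : ∀ I : Finset (Fin n), (if k.1 ∈ I ∧ l.1 ∈ I then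
      ∑ e ∈ (Finset.univ : Finset C.graph.edgeSet).filter
        (fun e => C.sideSet a e.1 = I), C.len e else 0) =
      ∑ e : C.graph.edgeSet, if C.sideSet a e.1 = I then
        (if k.1 ∈ I ∧ l.1 ∈ I then C.len e else 0) else 0 := by
    intro I
    rw [Finset.sum_filter]
    split_ifs
    · rfl
    · simp
  rw [Finset.sum_congr rfl fun I _ => h2 I, Finset.sum_comm]
  simp only [Finset.sum_ite_eq, Finset.mem_univ, if_true]
  rw [C.dist_eq_sum, C.dist_eq_sum, C.dist_eq_sum, Finset.sum_filter, Finset.sum_filter,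
    Finset.sum_filter, ← Finset.sum_sub_distrib, ← Finset.sum_sub_distrib, Finset.mul_sum,
    ← Finset.sum_neg_distrib]
  refine Finset.sum_congr rfl fun e _ => ?_
  simp only [MarkedTree.mem_sideSet]
  have h3 := sep_xor C.isTree e.1 (C.mark a) (C.mark k.1) (C.mark l.1)
  by_cases h4 : Sep C.graph e.1 (C.mark a) (C.mark k.1) <;>
    by_cases h5 : Sep C.graph e.1 (C.mark a) (C.mark l.1) <;>
    simp only [h4, h5, h3, iff_self, iff_true, not_true, not_false_iff, if_true,
      if_false, and_self, and_false, and_true, iff_false] <;> ring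

lemma prW_distMap (w : Fin n → ℚ) (a : Fin n) (C : TropCurve n) :
    prW w a (distMap n ⟦C⟧) =
      (allOnes _).mkQ (splitMap (reducedWeightGraph w a) (C.coord a)) := by
  have h1 : prW w a (distMap n ⟦C⟧) = (allOnes _).mkQ
      (LinearMap.funLeft ℝ ℝ (Set.inclusion (SimpleGraph.edgeSet_mono
        (le_top : reducedWeightGraph w a ≤ ⊤))) (edgeCoords a C.distVec)) := rfl
  rw [h1]
  congr 1
  funext ⟨e, he⟩
  induction e using Sym2.ind with
  | _ k l =>
  classical
  rw [splitMap_apply]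
  exact edgeCoords_distVec C (SimpleGraph.Adj.ne ((SimpleGraph.mem_edgeSet _).1 he))
    (SimpleGraph.edgeSet_mono le_top he)

end

section

variable {n : ℕ} {w : Fin n → ℚ} {r : Fin n}

lemma Sep.map {V W : Type*} {G : SimpleGraph V} {H : SimpleGraph W} (f : G ≃g H) {e : Sym2 V}
    {u v : V} (h : Sep H (e.map f) (f u) (f v)) : Sep G e u v := by
  by_contra hs
  obtain ⟨p, hp⟩ := not_sep_iff.1 hs
  refine not_sep_iff.2 ⟨p.map f.toHom, fun h' => hp ?_⟩ h
  rw [SimpleGraph.Walk.edges_map] at h'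
  exact (List.mem_map_of_injective (Sym2.map.injective f.injective)).1 h'

lemma TropCurve.Iso.coord_eq {C D : TropCurve n} (h : TropCurve.Iso C D) (r : Fin n) :
    C.coord r = D.coord r := by
  classical
  obtain ⟨f, hm, hl⟩ := h
  have hs : ∀ e : C.graph.edgeSet, D.sideSet r (f.mapEdgeSet e).1 = C.sideSet r e.1 := by
    intro e
    ext i
    rw [MarkedTree.mem_sideSet, MarkedTree.mem_sideSet, ← hm, ← hm]
    refine ⟨fun h => Sep.map f h, fun h => Sep.map f.symm ?_⟩
    have he : ((f.mapEdgeSet e).1).map f.symm = e.1 := by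
      change (e.1.map f).map f.symm = e.1
      rw [Sym2.map_map, show (f.symm ∘ f : _ → _) = id from funext f.symm_apply_apply, Sym2.map_id]
      rfl
    rw [he]
    simpa using h
  funext I
  rw [TropCurve.coord, TropCurve.coord, MarkedTree.push_apply, MarkedTree.push_apply]
  refine Finset.sum_equiv f.mapEdgeSet (fun e => ?_) fun e _ => (hl e).symm
  rw [Finset.mem_filter, Finset.mem_filter, hs e]
  simp

/-! ### Conewise linear embeddings in split coordinates -/

section Embedding

variable {V : Type*} [AddCommGroup V] [Module ℝ V]

lemma supp_single {I : Finset (Fin n)} : supp (Pi.single I (1 : ℝ)) = {I} := by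
  ext J
  simp [mem_supp, Pi.single_apply]

/-- In split coordinates, a conewise linear map is the restriction of a linear map. -/
lemma IsConeEmbedding.exists_linear (hpos : ∀ i, 0 < w i) (hle : ∀ i, w i ≤ 1)
    (hsum : 2 < ∑ i, w i) {φ : CurveClass n → V} (hφ : IsConeEmbedding w φ) (r : Fin n) :
    ∃ ψ : (Finset (Fin n) → ℝ) →ₗ[ℝ] V, ∀ C : TropCurve n, C.IsStable w →
      φ ⟦C⟧ = ψ (C.coord r) := by
  classical
  have hw : ∀ i, 0 ≤ w i := fun i => (hpos i).le
  have h1 : ∀ I : Finset (Fin n), ∃ v : V, ∀ D : TropCurve n, D.IsStable w →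
      D.coord r = Pi.single I 1 → φ ⟦D⟧ = v := by
    intro I
    by_cases h : ∃ D : TropCurve n, D.IsStable w ∧ D.coord r = Pi.single I 1
    · obtain ⟨D, hD, hD'⟩ := h
      refine ⟨φ ⟦D⟧, fun E hE hE' => ?_⟩
      rw [class_eq_of_coord_eq (hE.one hle) (hD.one hle) (hE'.trans hD'.symm)]
    · push Not at h
      exact ⟨0, fun D hD hD' => absurd hD' (h D hD)⟩
  choose v hv using h1
  refine ⟨Fintype.linearCombination ℝ v, fun C hC => ?_⟩
  obtain ⟨L, hL⟩ := hφ.linear C.toMarkedTree hC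
  have h2 : ∀ e : C.graph.edgeSet, L (Pi.single e 1) = v (C.sideSet r e) := by
    intro e
    obtain ⟨D, hD, hD', hD''⟩ := exists_contraction (r := r) hpos hle hsum hC
      (ℓ := Pi.single e 1) (fun e' => by
        rw [Pi.single_apply]
        split_ifs <;> norm_num)
    rw [← hL _ D (fun e' => by rw [Pi.single_apply]; split_ifs <;> norm_num) hD'']
    refine hv _ D hD (hD'.trans ?_)
    funext I
    by_cases hI : I ∈ C.sides r
    · obtain ⟨e', rfl⟩ := MarkedTree.mem_sides.1 hI
      rw [hC.push_sideSet hw, Pi.single_apply, Pi.single_apply]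
      refine if_congr ⟨fun h => by rw [h], fun h => ?_⟩ rfl rfl
      exact Subtype.ext (hC.sideSet_injOn hw e'.2 e.2 h)
    · rw [MarkedTree.push_of_notMem _ hI, Pi.single_apply, if_neg]
      rintro rfl
      exact hI (MarkedTree.mem_sides.2 ⟨e, rfl⟩)
  rw [hL _ C (fun e => (C.len_pos e).le) (isContraction_self C),
    Fintype.linearCombination_apply, L.pi_apply_eq_sum_univ]
  have h3 : ∀ I : Finset (Fin n), C.coord r I • v I =
      ∑ e : C.graph.edgeSet, if C.sideSet r e.1 = I then C.len e • v I else 0 := by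
    intro I
    rw [TropCurve.coord, MarkedTree.push_apply, Finset.sum_smul, Finset.sum_filter]
  rw [Finset.sum_congr rfl fun I _ => h3 I, Finset.sum_comm]
  refine Finset.sum_congr rfl fun e _ => ?_
  rw [Finset.sum_ite_eq, if_pos (Finset.mem_univ _), ← h2]
  congr 2
  funext e'
  rw [Pi.single_apply]
  exact if_congr eq_comm rfl rfl

lemma image_mTrop (hpos : ∀ i, 0 < w i) (hle : ∀ i, w i ≤ 1)
    (hsum : 2 < ∑ i, w i) {φ : CurveClass n → V} {ψ : (Finset (Fin n) → ℝ) →ₗ[ℝ] V}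
    (h : ∀ C : TropCurve n, C.IsStable w → φ ⟦C⟧ = ψ (C.coord r)) :
    φ '' MTrop w = ψ '' {c | IsCoord w r c} := by
  ext x
  constructor
  · rintro ⟨_, ⟨C, hC, rfl⟩, rfl⟩
    exact ⟨_, TropCurve.isCoord_coord hC fun i => (hpos i).le, (h C hC).symm⟩
  · rintro ⟨c, hc, rfl⟩
    obtain ⟨C, hC, rfl⟩ := exists_curve hpos hle hsum hc
    exact ⟨_, ⟨C, hC, rfl⟩, h C hC⟩

lemma injOn_of_injOn (hpos : ∀ i, 0 < w i) (hle : ∀ i, w i ≤ 1)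
    (hsum : 2 < ∑ i, w i) {φ : CurveClass n → V} {ψ : (Finset (Fin n) → ℝ) →ₗ[ℝ] V}
    (h : ∀ C : TropCurve n, C.IsStable w → φ ⟦C⟧ = ψ (C.coord r)) (hφ : InjOn φ (MTrop w)) :
    InjOn ψ {c | IsCoord w r c} := by
  intro c hc d hd hcd
  obtain ⟨C, hC, rfl⟩ := exists_curve hpos hle hsum hc
  obtain ⟨D, hD, rfl⟩ := exists_curve hpos hle hsum hd
  have h1 : φ ⟦C⟧ = φ ⟦D⟧ := by rw [h C hC, h D hD, hcd]
  exact TropCurve.Iso.coord_eq (Quotient.exact (hφ ⟨C, hC, rfl⟩ ⟨D, hD, rfl⟩ h1)) r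

/-- Extension by zero of a vector indexed by the members of `𝓛`. -/
def ext0 (𝓛 : Finset (Finset (Fin n))) : (𝓛 → ℝ) →ₗ[ℝ] (Finset (Fin n) → ℝ) :=
  LinearMap.pi fun I => if h : I ∈ 𝓛 then LinearMap.proj ⟨I, h⟩ else 0

lemma ext0_apply_mem {𝓛 : Finset (Finset (Fin n))} (x : 𝓛 → ℝ) {I : Finset (Fin n)} (h : I ∈ 𝓛) :
    ext0 𝓛 x I = x ⟨I, h⟩ := by simp [ext0, h]

lemma ext0_apply_notMem {𝓛 : Finset (Finset (Fin n))} (x : 𝓛 → ℝ) {I : Finset (Fin n)}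
    (h : I ∉ 𝓛) : ext0 𝓛 x I = 0 := by simp [ext0, h]

lemma supp_ext0_subset {𝓛 : Finset (Finset (Fin n))} (x : 𝓛 → ℝ) : supp (ext0 𝓛 x) ⊆ 𝓛 := by
  intro I hI
  by_contra h
  exact mem_supp.1 hI (ext0_apply_notMem x h)

lemma exists_ext0 {𝓛 : Finset (Finset (Fin n))} {c : Finset (Fin n) → ℝ} (h : supp c ⊆ 𝓛) :
    ext0 𝓛 (fun I => c I) = c := by
  funext I
  by_cases hI : I ∈ 𝓛
  · rw [ext0_apply_mem _ hI]
  · rw [ext0_apply_notMem _ hI]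
    exact (notMem_supp.1 fun h' => hI (h h')).symm

lemma ext0_injective (𝓛 : Finset (Finset (Fin n))) : Function.Injective (ext0 𝓛) := by
  intro x y h
  funext ⟨I, hI⟩
  rw [← ext0_apply_mem x hI, h, ext0_apply_mem]

/-- A linear map that is injective on split coordinates is injective on vectors of arbitrary
signs that are supported on a common laminar family. -/
lemma injective_comp_ext0 {ψ : (Finset (Fin n) → ℝ) →ₗ[ℝ] V}
    (hψ : InjOn ψ {c | IsCoord w r c}) {𝓛 : Finset (Finset (Fin n))} (h𝓛 : IsLam w r 𝓛) :
    Function.Injective (ψ ∘ₗ ext0 𝓛) := by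
  intro x y hxy
  set M : ℝ := ∑ I, (|x I| + |y I|) with hM
  have hMx : ∀ I, |x I| + |y I| ≤ M := fun I =>
    Finset.single_le_sum (f := fun I => |x I| + |y I|) (fun I _ => by positivity)
      (Finset.mem_univ I)
  have key : ∀ z : 𝓛 → ℝ, (∀ I, |z I| ≤ M) → IsCoord w r (ext0 𝓛 (z + fun _ => M)) := by
    refine fun z hz => ⟨fun I => ?_, h𝓛.mono (supp_ext0_subset _)⟩
    by_cases hI : I ∈ 𝓛
    · rw [ext0_apply_mem _ hI]
      have := neg_le_of_abs_le (hz ⟨I, hI⟩)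
      simp only [Pi.add_apply]
      linarith
    · rw [ext0_apply_notMem _ hI]
  have h1 := hψ (key x fun I => by linarith [hMx I, abs_nonneg (y I)])
    (key y fun I => by linarith [hMx I, abs_nonneg (x I)]) (by
      rw [map_add, map_add, map_add, map_add]
      exact congrArg (· + _) hxy)
  exact add_right_cancel (ext0_injective 𝓛 h1)

lemma linSpan_hull (S : Set V) : linSpan (PointedCone.hull ℝ S) = Submodule.span ℝ S := by
  refine le_antisymm (Submodule.span_le.2 fun x hx => ?_)
    (Submodule.span_mono Submodule.subset_span)
  exact PointedCone.hull_le_span (R := ℝ) S hx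

lemma linSpan_mono {σ τ : PointedCone ℝ V} (h : σ ≤ τ) : linSpan σ ≤ linSpan τ :=
  Submodule.span_mono h

lemma mem_linSpan {σ : PointedCone ℝ V} {x : V} (h : x ∈ σ) : x ∈ linSpan σ :=
  Submodule.subset_span h

lemma IsTropicalFan.finiteDimensional {N : Submodule ℤ V} {X : Set (PointedCone ℝ V)} {d : ℕ}
    {ω : PointedCone ℝ V → ℕ} (hX : IsTropicalFan N X d ω) {σ : PointedCone ℝ V} (hσ : σ ∈ X) :
    FiniteDimensional ℝ (linSpan σ) := by
  obtain ⟨S, hS, -, rfl⟩ := hX.rational σ hσ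
  rw [linSpan_hull]
  exact FiniteDimensional.span_of_finite ℝ hS

end Embedding

/-! ### The local structure of a tropical fan -/

section Local

variable {V : Type*} [AddCommGroup V] [Module ℝ V] {ψ : (Finset (Fin n) → ℝ) →ₗ[ℝ] V}
  {N : Submodule ℤ V} {X : Set (PointedCone ℝ V)} {d : ℕ} {ω : PointedCone ℝ V → ℕ}

/-- The linear span of the image of the cone of a laminar family. -/
def lamSpan (ψ : (Finset (Fin n) → ℝ) →ₗ[ℝ] V) (𝓛 : Finset (Finset (Fin n))) : Submodule ℝ V :=
  LinearMap.range (ψ ∘ₗ ext0 𝓛)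

lemma mem_lamSpan {𝓛 : Finset (Finset (Fin n))} {c : Finset (Fin n) → ℝ} (h : supp c ⊆ 𝓛) :
    ψ c ∈ lamSpan ψ 𝓛 := ⟨_, congrArg ψ (exists_ext0 h)⟩

lemma finrank_lamSpan (hψ : InjOn ψ {c | IsCoord w r c}) {𝓛 : Finset (Finset (Fin n))}
    (h𝓛 : IsLam w r 𝓛) : Module.finrank ℝ (lamSpan ψ 𝓛) = 𝓛.card := by
  rw [lamSpan, LinearMap.finrank_range_of_inj (injective_comp_ext0 hψ h𝓛)]
  simp

/-- Moving from a point `q` of a cone far enough in the direction of another point `ψ c` of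
this cone leads to a curve that has all splits of `c`. -/
lemma exists_coord_of_mem (hψ : InjOn ψ {c | IsCoord w r c})
    (hX : ψ '' {c | IsCoord w r c} = support X) {σ : PointedCone ℝ V} (hσ : σ ∈ X)
    {c : Finset (Fin n) → ℝ} (hc : IsCoord w r c) (hcσ : ψ c ∈ σ) {q : V} (hq : q ∈ σ) :
    ∃ (t : ℝ) (c' : Finset (Fin n) → ℝ), 0 < t ∧ IsCoord w r c' ∧ supp c ⊆ supp c' ∧
      q = ψ (c' - t • c) := by
  have h1 : ∀ t : ℕ, ∃ c' : Finset (Fin n) → ℝ, IsCoord w r c' ∧ ψ c' = q + (t : ℝ) • ψ c := by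
    intro t
    have : q + (t : ℝ) • ψ c ∈ support X :=
      ⟨σ, hσ, σ.add_mem hq (σ.smul_mem (Nat.cast_nonneg t) hcσ)⟩
    rw [← hX] at this
    obtain ⟨c', hc', h⟩ := this
    exact ⟨c', hc', h⟩
  choose g hg hg' using h1
  -- infinitely many of these points lie in the interior of the same cone
  obtain ⟨𝓜, h𝓜⟩ := Finite.exists_infinite_fiber fun t => supp (g t)
  have hinf : {t | supp (g t) = 𝓜}.Infinite := Set.infinite_coe_iff.1 h𝓜
  obtain ⟨t₀, ht₀, ht₀'⟩ := hinf.exists_gt 0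
  obtain ⟨t₁, ht₁, ht₁'⟩ := hinf.exists_gt t₀
  have h𝓜L : IsLam w r 𝓜 := ht₀ ▸ (hg t₀).2
  have hpos : (0 : ℝ) < t₁ - t₀ := sub_pos.2 (by exact_mod_cast ht₁')
  have hsub : ∀ {x y : Finset (Fin n) → ℝ}, supp x ⊆ 𝓜 → supp y ⊆ 𝓜 → ψ x = ψ y → x = y := by
    intro x y hx hy hxy
    rw [← exists_ext0 hx, ← exists_ext0 hy] at hxy ⊢
    exact congrArg _ (injective_comp_ext0 hψ h𝓜L hxy)
  set u : Finset (Fin n) → ℝ := ((t₁ : ℝ) - t₀)⁻¹ • (g t₁ - g t₀) with hu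
  have hsupp : ∀ {t}, supp (g t) = 𝓜 → ∀ I ∉ 𝓜, g t I = 0 := fun ht I hI =>
    notMem_supp.1 (ht.symm ▸ hI)
  have huM : ∀ I ∉ 𝓜, u I = 0 := fun I hI => by
    simp [hu, hsupp ht₀ I hI, hsupp ht₁ I hI]
  have hsuppM : ∀ {x : Finset (Fin n) → ℝ}, (∀ I ∉ 𝓜, x I = 0) → supp x ⊆ 𝓜 := by
    intro x hx I hI
    by_contra h
    exact mem_supp.1 hI (hx I h)
  have hψu : ψ u = ψ c := by
    rw [hu, map_smul, map_sub, hg', hg', add_sub_add_left_eq_sub, ← sub_smul, smul_smul,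
      inv_mul_cancel₀ hpos.ne', one_smul]
  have hline : ∀ t, supp (g t) = 𝓜 → g t = g t₀ + ((t : ℝ) - t₀) • u := by
    intro t ht
    refine hsub ht.subset (hsuppM fun I hI => ?_) ?_
    · simp [hsupp ht₀ I hI, huM I hI]
    · rw [map_add, map_smul, hψu, hg', hg', sub_smul]
      abel
  have hu0 : ∀ I, 0 ≤ u I := by
    intro I
    by_contra! hneg
    obtain ⟨m, hm⟩ := exists_nat_gt (t₀ + g t₀ I / (- u I))
    obtain ⟨t, ht, htm⟩ := hinf.exists_gt m
    have h2 := (hg t).1 I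
    rw [hline t ht] at h2
    simp only [Pi.add_apply, Pi.smul_apply, smul_eq_mul] at h2
    have h3 : (m : ℝ) < t := by exact_mod_cast htm
    have h4 : g t₀ I / (- u I) < t - t₀ := by linarith
    rw [div_lt_iff₀ (by linarith)] at h4
    linarith
  have huc : u = c := hψ ⟨hu0, h𝓜L.mono (hsuppM huM)⟩ hc hψu
  refine ⟨t₀, g t₀, by exact_mod_cast ht₀', hg t₀, ?_, ?_⟩
  · rw [show supp (g t₀) = 𝓜 from ht₀, ← huc]
    exact hsuppM huM
  · rw [map_sub, map_smul, hg']
    abel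

/-- A general point of the cone of a laminar family: if it lies in the linear span of one of
finitely many cones, then so does the whole cone. -/
lemma exists_general (hfin : X.Finite) {𝓛 : Finset (Finset (Fin n))} (h𝓛 : IsLam w r 𝓛) :
    ∃ c, IsCoord w r c ∧ supp c = 𝓛 ∧ ∀ σ ∈ X, ψ c ∈ linSpan σ → lamSpan ψ 𝓛 ≤ linSpan σ := by
  set S : Set (PointedCone ℝ V) := {σ | σ ∈ X ∧ ¬ lamSpan ψ 𝓛 ≤ linSpan σ} with hS
  set W : PointedCone ℝ V → Submodule ℝ (𝓛 → ℝ) := fun σ =>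
    (linSpan σ).comap (ψ ∘ₗ ext0 𝓛) with hW
  have hnull : MeasureTheory.volume (⋃ σ ∈ S, (W σ : Set (𝓛 → ℝ))) = 0 := by
    rw [MeasureTheory.measure_biUnion_null_iff (hfin.subset fun σ hσ => hσ.1).countable]
    intro σ hσ
    refine MeasureTheory.Measure.addHaar_submodule _ _ fun htop => hσ.2 ?_
    rintro _ ⟨x, rfl⟩
    exact (htop ▸ Submodule.mem_top : x ∈ W σ)
  have hopen : IsOpen (Set.pi Set.univ fun _ : 𝓛 => Set.Ioi (0 : ℝ)) :=
    isOpen_set_pi Set.finite_univ fun _ _ => isOpen_Ioi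
  have hne : (Set.pi Set.univ fun _ : 𝓛 => Set.Ioi (0 : ℝ)).Nonempty :=
    ⟨fun _ => 1, fun _ _ => by simp⟩
  obtain ⟨x, hx, hx'⟩ : ((Set.pi Set.univ fun _ : 𝓛 => Set.Ioi (0 : ℝ)) \
      ⋃ σ ∈ S, (W σ : Set (𝓛 → ℝ))).Nonempty := by
    by_contra h
    rw [Set.not_nonempty_iff_eq_empty, Set.sdiff_eq_empty] at h
    exact (hopen.measure_pos MeasureTheory.volume hne).ne' (MeasureTheory.measure_mono_null h hnull)
  have hx0 : ∀ I, 0 < x I := fun I => hx I (Set.mem_univ _)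
  have hsupp : supp (ext0 𝓛 x) = 𝓛 := by
    refine (supp_ext0_subset x).antisymm fun I hI => mem_supp.2 ?_
    rw [ext0_apply_mem x hI]
    exact (hx0 _).ne'
  refine ⟨ext0 𝓛 x, ⟨fun I => ?_, hsupp.symm ▸ h𝓛⟩, hsupp, fun σ hσ hxσ => ?_⟩
  · by_cases hI : I ∈ 𝓛
    · rw [ext0_apply_mem x hI]
      exact (hx0 _).le
    · rw [ext0_apply_notMem x hI]
  · by_contra hn
    exact hx' (Set.mem_biUnion (x := σ) ⟨hσ, hn⟩ hxσ)

lemma card_le_of_isTropicalFan (hψ : InjOn ψ {c | IsCoord w r c})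
    (hX : ψ '' {c | IsCoord w r c} = support X) (hfan : IsTropicalFan N X d ω)
    {𝓛 : Finset (Finset (Fin n))} (h𝓛 : IsLam w r 𝓛) : 𝓛.card ≤ d := by
  obtain ⟨c, hc, -, hgen⟩ := exists_general (ψ := ψ) hfan.finite h𝓛
  obtain ⟨σ, hσ, hcσ⟩ : ψ c ∈ support X := hX ▸ ⟨c, hc, rfl⟩
  obtain ⟨τ, hτ, hστ, rfl⟩ := hfan.pure σ hσ
  have := hfan.finiteDimensional hτ
  rw [← finrank_lamSpan hψ h𝓛]
  exact Submodule.finrank_mono ((hgen σ hσ (mem_linSpan hcσ)).trans (linSpan_mono hστ))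

/-- A maximal laminar family has as many members as the dimension of the tropical fan. -/
lemma le_card_of_maximal (hψ : InjOn ψ {c | IsCoord w r c})
    (hX : ψ '' {c | IsCoord w r c} = support X) (hfan : IsTropicalFan N X d ω)
    {𝓛 : Finset (Finset (Fin n))} (h𝓛 : IsLam w r 𝓛)
    (hmax : ∀ 𝓜, IsLam w r 𝓜 → 𝓛 ⊆ 𝓜 → 𝓜 = 𝓛) : d ≤ 𝓛.card := by
  obtain ⟨c, hc, rfl, -⟩ := exists_general (ψ := ψ) hfan.finite h𝓛
  obtain ⟨σ, hσ, hcσ⟩ : ψ c ∈ support X := hX ▸ ⟨c, hc, rfl⟩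
  obtain ⟨τ, hτ, hστ, rfl⟩ := hfan.pure σ hσ
  rw [← finrank_lamSpan hψ h𝓛, coneDim]
  have : FiniteDimensional ℝ (lamSpan ψ (supp c)) := by
    unfold lamSpan
    infer_instance
  refine Submodule.finrank_mono (Submodule.span_le.2 fun q hq => ?_)
  obtain ⟨t, c', -, hc', hs, rfl⟩ := exists_coord_of_mem hψ hX hτ hc (hστ hcσ) hq
  refine mem_lamSpan fun I hI => ?_
  by_contra h
  have h1 : I ∉ supp c' := hmax _ hc'.2 hs ▸ h
  rw [notMem_supp] at h h1
  exact mem_supp.1 hI (by simp [h, h1])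

/-- A tropical fan has no boundary: no cone of codimension one lies in just one larger cone,
since the primitive normal vector of that cone would have to vanish. -/
lemma false_of_unique_refinement (hψ : InjOn ψ {c | IsCoord w r c})
    (hX : ψ '' {c | IsCoord w r c} = support X) (hfan : IsTropicalFan N X d ω)
    {𝓛 : Finset (Finset (Fin n))} {J₀ : Finset (Fin n)} (hJ₀ : J₀ ∉ 𝓛)
    (h𝓛 : IsLam w r (insert J₀ 𝓛))
    (huniq : ∀ 𝓜, IsLam w r 𝓜 → 𝓛 ⊆ 𝓜 → 𝓜 ⊆ insert J₀ 𝓛) : False := by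
  have h𝓛' : IsLam w r 𝓛 := h𝓛.mono (Finset.subset_insert _ _)
  obtain ⟨c, hc, rfl, hgen⟩ := exists_general (ψ := ψ) hfan.finite h𝓛'
  set 𝓛 := supp c
  set 𝓜 := insert J₀ 𝓛 with h𝓜
  -- the coordinate of `J₀` as a linear form
  obtain ⟨g, hg⟩ := (ψ ∘ₗ ext0 𝓜).exists_leftInverse_of_injective
    (LinearMap.ker_eq_bot.2 (injective_comp_ext0 hψ h𝓛))
  set lam : V →ₗ[ℝ] ℝ := LinearMap.proj ⟨J₀, Finset.mem_insert_self _ _⟩ ∘ₗ g with hlam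
  have hlamc : ∀ x : Finset (Fin n) → ℝ, supp x ⊆ 𝓜 → lam (ψ x) = x J₀ := by
    intro x hx
    have h1 : g (ψ (ext0 𝓜 fun I => x I)) = fun I : 𝓜 => x I :=
      LinearMap.congr_fun hg fun I : 𝓜 => x I
    rw [exists_ext0 hx] at h1
    rw [hlam, LinearMap.comp_apply, h1]
    rfl
  have hloc : ∀ σ ∈ X, ψ c ∈ σ → ∀ q ∈ σ, ∃ x : Finset (Fin n) → ℝ,
      supp x ⊆ 𝓜 ∧ 0 ≤ x J₀ ∧ q = ψ x := by
    intro σ hσ hcσ q hq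
    obtain ⟨t, c', ht, hc', hs, rfl⟩ := exists_coord_of_mem hψ hX hσ hc hcσ hq
    have h1 := huniq _ hc'.2 hs
    refine ⟨_, fun I hI => ?_, ?_, rfl⟩
    · by_contra h
      have h2 : c' I = 0 := notMem_supp.1 fun h' => h (h1 h')
      have h3 : c I = 0 := notMem_supp.1 fun h' => h (h1 (hs h'))
      exact mem_supp.1 hI (by simp [h2, h3])
    · have h3 : c J₀ = 0 := notMem_supp.1 hJ₀
      simpa [h3] using hc'.1 J₀
  have hker : ∀ x : Finset (Fin n) → ℝ, supp x ⊆ 𝓜 → x J₀ = 0 → supp x ⊆ 𝓛 := by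
    intro x hx h0 I hI
    refine (Finset.mem_insert.1 (hx hI)).resolve_left ?_
    rintro rfl
    exact mem_supp.1 hI h0
  obtain ⟨σ, hσ, hcσ⟩ : ψ c ∈ support X := hX ▸ ⟨c, hc, rfl⟩
  obtain ⟨τ, hτ, hστ, hτd⟩ := hfan.pure σ hσ
  have hcτ := hστ hcσ
  have hd : 𝓜.card ≤ d := card_le_of_isTropicalFan hψ hX hfan h𝓛
  have hcard : 𝓜.card = 𝓛.card + 1 := Finset.card_insert_of_notMem hJ₀
  have hnn : ∀ σ ∈ X, ψ c ∈ σ → ∀ q ∈ σ, 0 ≤ lam q := by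
    intro σ hσ hcσ q hq
    obtain ⟨x, hx, hx0, rfl⟩ := hloc σ hσ hcσ q hq
    rwa [hlamc x hx]
  -- `lam` cannot vanish on `τ` for dimension reasons
  have hτlam : ¬ ∀ q ∈ τ, lam q = 0 := by
    intro h0
    have h1 : linSpan τ ≤ lamSpan ψ 𝓛 := by
      refine Submodule.span_le.2 fun q hq => ?_
      obtain ⟨x, hx, hx0, rfl⟩ := hloc τ hτ hcτ q hq
      have h2 := h0 _ hq
      rw [hlamc x hx] at h2
      exact mem_lamSpan (hker x hx h2)
    have : FiniteDimensional ℝ (lamSpan ψ 𝓛) := by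
      unfold lamSpan
      infer_instance
    have h2 := Submodule.finrank_mono h1
    rw [finrank_lamSpan hψ h𝓛'] at h2
    change coneDim τ ≤ _ at h2
    omega
  -- the facet of `τ` on which `lam` vanishes
  set F : PointedCone ℝ V := τ ⊓ PointedCone.ofSubmodule (LinearMap.ker lam) with hF
  have hFmem : ∀ q, q ∈ F ↔ q ∈ τ ∧ lam q = 0 := fun q => Iff.rfl
  have hFface : F.IsFaceOf τ := by
    refine ⟨inf_le_left, fun {x y a} hx hy ha hxy => (hFmem x).2 ⟨hx, ?_⟩⟩
    have h1 := ((hFmem _).1 hxy).2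
    rw [map_add, map_smul, smul_eq_mul] at h1
    have h2 := hnn τ hτ hcτ x hx
    have h3 := hnn τ hτ hcτ y hy
    have h4 : a * lam x = 0 := by
      have := mul_nonneg ha.le h2
      linarith
    exact (mul_eq_zero.1 h4).resolve_left ha.ne'
  have hFX := hfan.face_mem τ hτ F hFface
  have hcF : ψ c ∈ F := by
    refine (hFmem _).2 ⟨hcτ, ?_⟩
    rw [hlamc c (Finset.subset_insert _ _)]
    exact notMem_supp.1 hJ₀
  have hFspan : linSpan F = lamSpan ψ 𝓛 := by
    refine le_antisymm (Submodule.span_le.2 fun q hq => ?_) (hgen F hFX (mem_linSpan hcF))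
    obtain ⟨x, hx, hx0, rfl⟩ := hloc τ hτ hcτ q hq.1
    have h2 := ((hFmem _).1 hq).2
    rw [hlamc x hx] at h2
    exact mem_lamSpan (hker x hx h2)
  have hFlam : ∀ q ∈ linSpan F, lam q = 0 := by
    have : linSpan F ≤ LinearMap.ker lam := Submodule.span_le.2 fun q hq => ((hFmem q).1 hq).2
    exact fun q hq => this hq
  have hτle : d ≤ 𝓜.card := by
    rw [← hτd, ← finrank_lamSpan hψ h𝓛, coneDim]
    have : FiniteDimensional ℝ (lamSpan ψ 𝓜) := by
      unfold lamSpan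
      infer_instance
    refine Submodule.finrank_mono (Submodule.span_le.2 fun q hq => ?_)
    obtain ⟨x, hx, -, rfl⟩ := hloc τ hτ hcτ q hq
    exact mem_lamSpan hx
  obtain ⟨u, hu, hbal⟩ := hfan.balanced F hFX (by
    rw [coneDim, hFspan, finrank_lamSpan hψ h𝓛']
    omega)
  have hfin : {σ | σ ∈ X ∧ coneDim σ = d ∧ F ≤ σ}.Finite := hfan.finite.subset fun σ h => h.1
  have h0 := hFlam _ hbal
  rw [finsum_mem_eq_finite_toFinset_sum _ hfin, map_sum] at h0
  have hterm : ∀ σ ∈ hfin.toFinset, 0 ≤ lam (ω σ • u σ) := by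
    intro σ hσ
    obtain ⟨h1, h2, h3⟩ := hfin.mem_toFinset.1 hσ
    rw [map_nsmul]
    exact nsmul_nonneg (hnn σ h1 (h3 hcF) _ (hu σ h1 h2 h3).2.1) _
  have hτF : τ ∈ hfin.toFinset := hfin.mem_toFinset.2 ⟨hτ, hτd, inf_le_left⟩
  have h1 := (Finset.sum_eq_zero_iff_of_nonneg hterm).1 h0 τ hτF
  rw [map_nsmul, nsmul_eq_mul] at h1
  have h2 : lam (u τ) = 0 := (mul_eq_zero.1 h1).resolve_left
    (by exact_mod_cast (hfan.weight_pos τ hτ hτd).ne')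
  obtain ⟨S, -, hSN, hSτ⟩ := hfan.rational τ hτ
  refine hτlam ?_
  have h3 : linSpan τ ≤ LinearMap.ker lam := by
    rw [hSτ, linSpan_hull, Submodule.span_le]
    intro s hs
    obtain ⟨k, hk⟩ := (hu τ hτ hτd inf_le_left).2.2 s (hSN hs)
      (mem_linSpan (hSτ ▸ Submodule.subset_span hs))
    have h4 := hFlam _ hk
    rw [map_sub, map_zsmul, h2, smul_zero, sub_zero] at h4
    exact h4
  exact fun q hq => h3 (mem_linSpan hq)

end Local

end

section

/-! ### Flags of sets, and weights that are not heavy/light -/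

/-- A maximal chain of sets between `A` and `B`. -/
lemma exists_flag {α : Type*} [DecidableEq α] {A B : Finset α} (h : A ⊆ B) :
    ∃ 𝓒 : Finset (Finset α), (∀ C ∈ 𝓒, A ⊆ C ∧ C ⊆ B) ∧ A ∈ 𝓒 ∧ B ∈ 𝓒 ∧
      (∀ C ∈ 𝓒, ∀ D ∈ 𝓒, C ⊆ D ∨ D ⊆ C) ∧ 𝓒.card + A.card = B.card + 1 ∧
      (∀ J, A ⊆ J → J ⊆ B → (∀ C ∈ 𝓒, C ⊆ J ∨ J ⊆ C) → J ∈ 𝓒) ∧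
      ∀ x ∈ B, x ∉ A → ∀ y ∈ B, y ∉ A → x ≠ y →
        ∃ C ∈ 𝓒, (x ∈ C ∧ y ∉ C) ∨ (y ∈ C ∧ x ∉ C) := by
  obtain ⟨D, hD, rfl⟩ : ∃ D, Disjoint A D ∧ A ∪ D = B :=
    ⟨B \ A, Finset.disjoint_sdiff, Finset.union_sdiff_of_subset h⟩
  clear h
  induction D using Finset.induction_on with
  | empty =>
    refine ⟨{A}, by simp, by simp, by simp, by simp, by simp [add_comm], fun J h1 h2 _ => ?_, ?_⟩
    · rw [Finset.union_empty] at h2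
      exact Finset.mem_singleton.2 (h2.antisymm h1)
    · intro x hx hxA
      rw [Finset.union_empty] at hx
      exact absurd hx hxA
  | @insert z D hz ih =>
    rw [Finset.disjoint_insert_right] at hD
    obtain ⟨𝓒, h1, h2, h3, h4, h5, h6, h7⟩ := ih hD.2
    have hzB : z ∉ A ∪ D := by simp [hz, hD.1]
    have hB : A ∪ insert z D = insert z (A ∪ D) := Finset.union_insert _ _ _
    rw [hB]
    set B := A ∪ D
    have hnew : insert z B ∉ 𝓒 := fun h => hzB ((h1 _ h).2 (Finset.mem_insert_self _ _))
    refine ⟨insert (insert z B) 𝓒, ?_, Finset.mem_insert_of_mem h2, Finset.mem_insert_self _ _,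
      ?_, ?_, ?_, ?_⟩
    · intro C hC
      rcases Finset.mem_insert.1 hC with rfl | hC
      · exact ⟨(h1 _ h3).1.trans (Finset.subset_insert _ _), subset_rfl⟩
      · exact ⟨(h1 C hC).1, (h1 C hC).2.trans (Finset.subset_insert _ _)⟩
    · intro C hC E hE
      rcases Finset.mem_insert.1 hC with rfl | hC <;> rcases Finset.mem_insert.1 hE with rfl | hE
      · exact .inl subset_rfl
      · exact .inr ((h1 E hE).2.trans (Finset.subset_insert _ _))
      · exact .inl ((h1 C hC).2.trans (Finset.subset_insert _ _))
      · exact h4 C hC E hE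
    · rw [Finset.card_insert_of_notMem hnew, Finset.card_insert_of_notMem hzB]
      omega
    · intro J hAJ hJB hJ
      by_cases hzJ : z ∈ J
      · rcases hJ B (Finset.mem_insert_of_mem h3) with h | h
        · rw [hJB.antisymm (Finset.insert_subset hzJ h)]
          exact Finset.mem_insert_self _ _
        · exact absurd (h hzJ) hzB
      · exact Finset.mem_insert_of_mem (h6 J hAJ ((Finset.subset_insert_iff_of_notMem hzJ).1 hJB)
          fun C hC => hJ C (Finset.mem_insert_of_mem hC))
    · intro x hx hxA y hy hyA hxy
      by_cases hxz : x = z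
      · subst hxz
        refine ⟨B, Finset.mem_insert_of_mem h3, .inr ⟨?_, hzB⟩⟩
        exact (Finset.mem_insert.1 hy).resolve_left hxy.symm
      · by_cases hyz : y = z
        · subst hyz
          exact ⟨B, Finset.mem_insert_of_mem h3, .inl ⟨(Finset.mem_insert.1 hx).resolve_left hxz,
            hzB⟩⟩
        · obtain ⟨C, hC, h⟩ := h7 x ((Finset.mem_insert.1 hx).resolve_left hxz) hxA y
            ((Finset.mem_insert.1 hy).resolve_left hyz) hyA hxy
          exact ⟨C, Finset.mem_insert_of_mem hC, h⟩

variable {n : ℕ} {w : Fin n → ℚ} {a : Fin n}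

lemma adm_of_subset (hpos : ∀ i, 0 < w i) {A B C : Finset (Fin n)} (hA : 1 < ∑ i ∈ A, w i)
    (hB : 1 < ∑ i ∈ Bᶜ, w i) (haB : a ∉ B) (hAC : A ⊆ C) (hCB : C ⊆ B) : Adm w a C :=
  ⟨fun h => haB (hCB h),
    hA.trans_le (Finset.sum_le_sum_of_subset_of_nonneg hAC fun i _ _ => (hpos i).le),
    hB.trans_le (Finset.sum_le_sum_of_subset_of_nonneg (Finset.compl_subset_compl.2 hCB)
      fun i _ _ => (hpos i).le)⟩

/-- A laminar family of admissible sets that contains a maximal chain from `A` to the complement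
of `{a, b}` can only contain proper subsets of `A` in addition. -/
lemma mem_flag_or_ssubset {b : Fin n} {A B : Finset (Fin n)} {𝓒 : Finset (Finset (Fin n))}
    (hA : A.Nonempty) (hB : ∀ x, x ∈ B ↔ x ≠ a ∧ x ≠ b)
    (h1 : ∀ C ∈ 𝓒, A ⊆ C ∧ C ⊆ B) (h2 : A ∈ 𝓒) (h3 : B ∈ 𝓒)
    (h6 : ∀ J, A ⊆ J → J ⊆ B → (∀ C ∈ 𝓒, C ⊆ J ∨ J ⊆ C) → J ∈ 𝓒)
    (h7 : ∀ x ∈ B, x ∉ A → ∀ y ∈ B, y ∉ A → x ≠ y →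
        ∃ C ∈ 𝓒, (x ∈ C ∧ y ∉ C) ∨ (y ∈ C ∧ x ∉ C))
    {J : Finset (Fin n)} (hJ : Adm 1 a J) (hc : ∀ C ∈ 𝓒, Compat J C) : J ∈ 𝓒 ∨ J ⊂ A := by
  obtain ⟨haJ, hJ1, hJ2⟩ := adm_one_iff.1 hJ
  obtain ⟨z, hz⟩ := hA
  rcases hc A h2 with h | h | h
  · rcases h.eq_or_ssubset with rfl | h
    · exact .inl h2
    · exact .inr h
  · left
    have hbJ : b ∉ J ∨ ¬ B ⊆ J := by
      by_contra! h'
      have : Jᶜ ⊆ {a} := by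
        intro x hx
        rw [Finset.mem_compl] at hx
        by_contra hxa
        rw [Finset.mem_singleton] at hxa
        refine hx (h'.2 ((hB x).2 ⟨hxa, ?_⟩))
        rintro rfl
        exact hx h'.1
      have := Finset.card_le_card this
      rw [Finset.card_singleton] at this
      omega
    have hcomp : ∀ C ∈ 𝓒, C ⊆ J ∨ J ⊆ C := by
      intro C hC
      rcases hc C hC with h' | h' | h'
      · exact .inr h'
      · exact .inl h'
      · exact absurd ((h1 C hC).1 hz) (Finset.disjoint_left.1 h' (h hz))
    refine h6 J h ?_ hcomp
    rcases hbJ with hb | hb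
    · intro x hx
      rw [hB]
      exact ⟨fun h => haJ (h ▸ hx), fun h => hb (h ▸ hx)⟩
    · exact (hcomp B h3).resolve_left hb
  · exfalso
    have hsep : ∀ C ∈ 𝓒, ∀ x ∈ J, ∀ y ∈ J, x ∈ C → y ∉ C → False := by
      intro C hC x hx y hy hxC hyC
      rcases hc C hC with h' | h' | h'
      · exact hyC (h' hy)
      · exact Finset.disjoint_left.1 h (h' ((h1 C hC).1 hz)) hz
      · exact Finset.disjoint_left.1 h' hx hxC
    obtain ⟨x, hx, y, hy, hxy⟩ := Finset.one_lt_card.1 hJ1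
    have hxA := Finset.disjoint_left.1 h hx
    have hyA := Finset.disjoint_left.1 h hy
    have hxa : x ≠ a := fun h => haJ (h ▸ hx)
    have hya : y ≠ a := fun h => haJ (h ▸ hy)
    by_cases hxB : x ∈ B
    · by_cases hyB : y ∈ B
      · obtain ⟨C, hC, h' | h'⟩ := h7 x hxB hxA y hyB hyA hxy
        · exact hsep C hC x hx y hy h'.1 h'.2
        · exact hsep C hC y hy x hx h'.1 h'.2
      · exact hsep B h3 x hx y hy hxB hyB
    · have hxb : x = b := by
        by_contra hne
        exact hxB ((hB x).2 ⟨hxa, hne⟩)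
      exact hsep B h3 y hy x hx ((hB y).2 ⟨hya, fun h => hxy (hxb.trans h.symm)⟩) hxB

variable {V : Type*} [AddCommGroup V] [Module ℝ V] {ψ : (Finset (Fin n) → ℝ) →ₗ[ℝ] V}
  {N : Submodule ℤ V} {X : Set (PointedCone ℝ V)} {d : ℕ} {ω : PointedCone ℝ V → ℕ}

/-- If among three ends only the pair `i`, `j` has weight greater than one, then a maximal chain of
sets above `{i, j, k}` gives a cone that lies in just one larger cone, namely the one with the
additional split `{i, j}`. -/
lemma false_of_triple (hpos : ∀ i, 0 < w i) (hle : ∀ i, w i ≤ 1)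
    (hψ : InjOn ψ {c | IsCoord w a c})
    (hX : ψ '' {c | IsCoord w a c} = support X) (hfan : IsTropicalFan N X d ω)
    {b : Fin n} (hab : a ≠ b) (hha : IsHeavy w a) (hhb : IsHeavy w b) {i j k : Fin n}
    (hi : ¬ IsHeavy w i) (hj : ¬ IsHeavy w j) (hij : i ≠ j) (hik : i ≠ k) (hjk : j ≠ k)
    (h1 : 1 < w i + w j) (h2 : w i + w k ≤ 1) (h3 : w j + w k ≤ 1) : False := by
  have hk : ¬ IsHeavy w k := fun h => by linarith [h i hik]
  have ne : ∀ {x y}, IsHeavy w x → ¬ IsHeavy w y → y ≠ x := fun h h' he => h' (he ▸ h)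
  set A : Finset (Fin n) := {i, j, k} with hA
  set B : Finset (Fin n) := Finset.univ.filter fun x => x ≠ a ∧ x ≠ b with hB
  have hBmem : ∀ x, x ∈ B ↔ x ≠ a ∧ x ≠ b := by simp [hB]
  have hAB : A ⊆ B := by
    intro x hx
    rw [hBmem]
    simp only [hA, Finset.mem_insert, Finset.mem_singleton] at hx
    rcases hx with rfl | rfl | rfl
    · exact ⟨ne hha hi, ne hhb hi⟩
    · exact ⟨ne hha hj, ne hhb hj⟩
    · exact ⟨ne hha hk, ne hhb hk⟩
  have hBc : Bᶜ = {a, b} := by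
    ext x
    simp [hB]
    tauto
  have hsumB : 1 < ∑ i ∈ Bᶜ, w i := by
    rw [hBc, Finset.sum_pair hab]
    exact hha b hab.symm
  have hsum2 : 1 < ∑ x ∈ ({i, j} : Finset (Fin n)), w x := by
    rwa [Finset.sum_pair hij]
  have hijA : ({i, j} : Finset (Fin n)) ⊆ A := by
    intro x
    simp only [hA, Finset.mem_insert, Finset.mem_singleton]
    tauto
  have haB : a ∉ B := by simp [hB]
  obtain ⟨𝓒, f1, f2, f3, f4, -, f6, f7⟩ := exists_flag hAB
  have hJA : ∀ C ∈ 𝓒, ({i, j} : Finset (Fin n)) ⊆ C := fun C hC => hijA.trans (f1 C hC).1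
  refine false_of_unique_refinement (r := a) (𝓛 := 𝓒) (J₀ := {i, j}) hψ hX hfan ?_ ⟨?_, ?_⟩ ?_
  · intro h
    have : k ∈ ({i, j} : Finset (Fin n)) := (f1 _ h).1 (by simp [hA])
    simp only [Finset.mem_insert, Finset.mem_singleton] at this
    exact this.elim hik.symm hjk.symm
  · intro C hC
    rcases Finset.mem_insert.1 hC with rfl | hC
    · exact adm_of_subset hpos hsum2 hsumB haB subset_rfl (hijA.trans hAB)
    · exact adm_of_subset hpos hsum2 hsumB haB (hJA C hC) (f1 C hC).2
  · intro C hC D hD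
    rcases Finset.mem_insert.1 hC with rfl | hC <;> rcases Finset.mem_insert.1 hD with rfl | hD
    · exact .inl subset_rfl
    · exact .inl (hJA D hD)
    · exact .inr (.inl (hJA C hC))
    · exact (f4 C hC D hD).imp id .inl
  · intro 𝓜 h𝓜 hs J hJ
    rcases mem_flag_or_ssubset ⟨i, by simp [hA]⟩ hBmem f1 f2 f3 f6 f7 ((h𝓜.1 J hJ).one hle)
      (fun C hC => h𝓜.2 J hJ C (hs hC)) with h | h
    · exact Finset.mem_insert_of_mem h
    · have hsum := (h𝓜.1 J hJ).2.1
      have hsub : ∀ {D : Finset (Fin n)}, J ⊆ D → 1 < ∑ x ∈ D, w x := fun hD =>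
        hsum.trans_le (Finset.sum_le_sum_of_subset_of_nonneg hD fun i _ _ => (hpos i).le)
      have hmem : ∀ x ∈ J, x = i ∨ x = j ∨ x = k := fun x hx => by
        simpa [hA] using h.subset hx
      have hiJ : i ∈ J := by
        by_contra hiJ
        have : J ⊆ {j, k} := fun x hx => by
          rcases hmem x hx with rfl | h | h
          · exact absurd hx hiJ
          · simp [h]
          · simp [h]
        have := hsub this
        rw [Finset.sum_pair hjk] at this
        linarith
      have hjJ : j ∈ J := by
        by_contra hjJ
        have : J ⊆ {i, k} := fun x hx => by
          rcases hmem x hx with h | rfl | h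
          · simp [h]
          · exact absurd hx hjJ
          · simp [h]
        have := hsub this
        rw [Finset.sum_pair hik] at this
        linarith
      have hkJ : k ∉ J := fun hkJ => h.2 fun x hx => by
        simp only [hA, Finset.mem_insert, Finset.mem_singleton] at hx
        rcases hx with rfl | rfl | rfl <;> assumption
      refine Finset.mem_insert.2 (.inl ?_)
      ext x
      simp only [Finset.mem_insert, Finset.mem_singleton]
      constructor
      · intro hx
        rcases hmem x hx with h | h | rfl
        · exact .inl h
        · exact .inr h
        · exact absurd hx hkJ
      · rintro (rfl | rfl) <;> assumption

/-- A maximal chain of sets above a minimal set `S` of weight greater than one gives a maximal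
cone. If `S` has more than two elements, then the dimension of this cone is smaller than that
of the cone of a maximal chain above `{b, x}` for an element `x` of `S`. -/
lemma false_of_minimal (hpos : ∀ i, 0 < w i) (hle : ∀ i, w i ≤ 1)
    (hψ : InjOn ψ {c | IsCoord w a c})
    (hX : ψ '' {c | IsCoord w a c} = support X) (hfan : IsTropicalFan N X d ω)
    {b : Fin n} (hab : a ≠ b) (hha : IsHeavy w a) (hhb : IsHeavy w b) {S : Finset (Fin n)}
    (haS : a ∉ S) (hbS : b ∉ S) (hS : 1 < ∑ i ∈ S, w i) (hcard : 2 < S.card)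
    (hmin : ∀ J, J ⊂ S → ∑ i ∈ J, w i ≤ 1) : False := by
  have hSne : S.Nonempty := Finset.card_pos.1 (by omega)
  set B : Finset (Fin n) := Finset.univ.filter fun x => x ≠ a ∧ x ≠ b with hB
  have hBmem : ∀ x, x ∈ B ↔ x ≠ a ∧ x ≠ b := by simp [hB]
  have hSB : S ⊆ B := fun x hx => (hBmem x).2 ⟨fun h => haS (h ▸ hx), fun h => hbS (h ▸ hx)⟩
  have hpair : ∀ {x y : Fin n}, x ≠ y → (Finset.univ.filter fun z => z ≠ x ∧ z ≠ y)ᶜ = {x, y} := by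
    intro x y _
    ext z
    simp
    tauto
  have hcardB : ∀ {x y : Fin n}, x ≠ y →
      (Finset.univ.filter fun z => z ≠ x ∧ z ≠ y).card + 2 = n := by
    intro x y hxy
    have := Finset.card_add_card_compl (Finset.univ.filter fun z => z ≠ x ∧ z ≠ y)
    rw [hpair hxy, Finset.card_pair hxy, Fintype.card_fin] at this
    exact this
  have hsumB : ∀ {y : Fin n}, a ≠ y →
      1 < ∑ i ∈ (Finset.univ.filter fun z => z ≠ a ∧ z ≠ y)ᶜ, w i := by
    intro y hy
    rw [hpair hy, Finset.sum_pair hy]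
    exact hha y hy.symm
  -- a maximal cone of small dimension
  obtain ⟨𝓒, f1, f2, f3, f4, f5, f6, f7⟩ := exists_flag hSB
  have hlam : IsLam w a 𝓒 :=
    ⟨fun C hC => adm_of_subset hpos hS (hsumB hab) (by simp) (f1 C hC).1 (f1 C hC).2,
      fun C hC D hD => (f4 C hC D hD).imp id .inl⟩
  have hd1 : d ≤ 𝓒.card := by
    refine le_card_of_maximal hψ hX hfan hlam fun 𝓜 h𝓜 hs => Finset.Subset.antisymm ?_ hs
    intro J hJ
    rcases mem_flag_or_ssubset hSne hBmem f1 f2 f3 f6 f7 ((h𝓜.1 J hJ).one hle)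
      (fun C hC => h𝓜.2 J hJ C (hs hC)) with h | h
    · exact h
    · exact absurd (h𝓜.1 J hJ).2.1 (not_lt.2 (hmin J h))
  -- a cone of larger dimension
  obtain ⟨x, hx, y, hy, hxy⟩ := Finset.one_lt_card.1 (show 1 < S.card by omega)
  have hay : a ≠ y := fun h => haS (h ▸ hy)
  have hbx : b ≠ x := fun h => hbS (h ▸ hx)
  have hsub : ({b, x} : Finset (Fin n)) ⊆ Finset.univ.filter fun z => z ≠ a ∧ z ≠ y := by
    intro z hz
    simp only [Finset.mem_insert, Finset.mem_singleton] at hz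
    simp only [Finset.mem_filter, Finset.mem_univ, true_and]
    rcases hz with rfl | rfl
    · exact ⟨hab.symm, fun h => hbS (h ▸ hy)⟩
    · exact ⟨fun h => haS (h ▸ hx), hxy⟩
  obtain ⟨𝓓, g1, -, -, g4, g5, -, -⟩ := exists_flag hsub
  have hlam' : IsLam w a 𝓓 :=
    ⟨fun C hC => adm_of_subset hpos (by rw [Finset.sum_pair hbx]; exact hhb x hbx.symm)
      (hsumB hay) (by simp) (g1 C hC).1 (g1 C hC).2,
      fun C hC D hD => (g4 C hC D hD).imp id .inl⟩
  have hd2 := card_le_of_isTropicalFan hψ hX hfan hlam'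
  have h1 := hcardB hay
  have h2 : B.card + 2 = n := hcardB hab
  rw [Finset.card_pair hbx] at g5
  omega

/-- If `w` is not heavy/light, then there are three ends as in `false_of_triple` or a set as in
`false_of_minimal`. -/
theorem not_hasBalancedEmbedding (hpos : ∀ i, 0 < w i) (hle : ∀ i, w i ≤ 1)
    (hsum : 2 < ∑ i, w i) {b : Fin n} (hab : a ≠ b) (hha : IsHeavy w a) (hhb : IsHeavy w b)
    (hw : ¬ IsHeavyLight w) : ¬ HasBalancedEmbedding w V := by
  classical
  rintro ⟨φ, N, X, d, ω, hφ, hfan, hX⟩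
  obtain ⟨ψ, hψ⟩ := hφ.exists_linear hpos hle hsum a
  have hinj := injOn_of_injOn hpos hle hsum hψ hφ.injOn
  rw [image_mTrop hpos hle hsum hψ] at hX
  unfold IsHeavyLight at hw
  push Not at hw
  obtain ⟨i, hi, hi'⟩ := hw
  by_cases hp : ∃ i j, i ≠ j ∧ ¬ IsHeavy w i ∧ ¬ IsHeavy w j ∧ 1 < w i + w j
  · obtain ⟨i, j, hij, hi, hj, h⟩ := hp
    obtain ⟨k, hk, hik⟩ : ∃ k, k ≠ i ∧ w i + w k ≤ 1 := by
      by_contra! h'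
      exact hi h'
    obtain ⟨l, hl, hjl⟩ : ∃ l, l ≠ j ∧ w j + w l ≤ 1 := by
      by_contra! h'
      exact hj h'
    by_cases h1 : w j + w k ≤ 1
    · refine false_of_triple hpos hle hinj hX hfan hab hha hhb hi hj hij hk.symm ?_ h hik h1
      rintro rfl
      linarith
    · refine false_of_triple hpos hle hinj hX hfan hab hha hhb hi hj hij ?_ hl.symm h
        (by linarith) hjl
      rintro rfl
      linarith
  · push Not at hp
    have hsm : ∀ s, IsSmall w s → ¬ IsHeavy w s := by
      intro s hs hh
      by_cases his : i = s
      · exact hi (his ▸ hh)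
      · exact hi (hs i his (hh i his))
    have hismall : IsSmall w i := by
      intro j hj h
      by_contra hj'
      linarith [hp i j hj.symm hi hj']
    have hsumS : 1 < ∑ j ∈ Finset.univ.filter (IsSmall w), w j := by
      by_contra! h
      refine hi' ⟨hismall, ?_⟩
      rw [finsum_mem_eq_finite_toFinset_sum _ (Set.toFinite _)]
      refine le_trans (le_of_eq (Finset.sum_congr ?_ fun _ _ => rfl)) h
      ext j
      simp
    obtain ⟨S, hS, hmin⟩ := Finset.exists_min_image
      ((Finset.univ.filter (IsSmall w)).powerset.filter fun S => 1 < ∑ j ∈ S, w j) Finset.card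
      ⟨_, Finset.mem_filter.2 ⟨Finset.mem_powerset_self _, hsumS⟩⟩
    rw [Finset.mem_filter, Finset.mem_powerset] at hS
    have hSs : ∀ s ∈ S, IsSmall w s := fun s hs => (Finset.mem_filter.1 (hS.1 hs)).2
    refine false_of_minimal hpos hle hinj hX hfan hab hha hhb (fun h => hsm a (hSs a h) hha)
      (fun h => hsm b (hSs b h) hhb) hS.2 ?_ fun J hJ => ?_
    · by_contra! hc
      have h2 := hS.2
      interval_cases hcard : S.card
      · rw [Finset.card_eq_zero.1 hcard, Finset.sum_empty] at h2
        norm_num at h2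
      · obtain ⟨x, hx⟩ := Finset.card_eq_one.1 hcard
        rw [hx, Finset.sum_singleton] at h2
        linarith [hle x]
      · obtain ⟨x, y, hxy, hx⟩ := Finset.card_eq_two.1 hcard
        rw [hx, Finset.sum_pair hxy] at h2
        exact hsm y (hSs y (by simp [hx])) (hSs x (by simp [hx]) y hxy.symm h2)
    · by_contra! h
      have := hmin J (Finset.mem_filter.2 ⟨Finset.mem_powerset.2 (hJ.subset.trans hS.1), h⟩)
      exact absurd (Finset.card_lt_card hJ) (not_lt.2 this)

end

section

/-! ### Heavy/light weights -/

variable {n : ℕ} {w : Fin n → ℚ} {a : Fin n}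

/-- For heavy/light weights, the total weight of any set of markings that are not heavy is at
most one. -/
lemma IsHeavyLight.sum_le_one (h : IsHeavyLight w) (hpos : ∀ i, 0 < w i) {I : Finset (Fin n)}
    (hI : ∀ i ∈ I, ¬ IsHeavy w i) : ∑ i ∈ I, w i ≤ 1 := by
  classical
  rcases I.eq_empty_or_nonempty with rfl | ⟨i, hi⟩
  · simp
  · have h1 := ((h i).resolve_left (hI i hi)).2
    rw [finsum_mem_eq_finite_toFinset_sum _ (Set.toFinite _)] at h1
    refine le_trans (Finset.sum_le_sum_of_subset_of_nonneg (fun j hj => ?_)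
      fun i _ _ => (hpos i).le) h1
    simpa using ((h j).resolve_left (hI j hj)).1

lemma IsHeavyLight.adm_iff (h : IsHeavyLight w) (hpos : ∀ i, 0 < w i) (hle : ∀ i, w i ≤ 1)
    (ha : IsHeavy w a) {I : Finset (Fin n)} :
    Adm w a I ↔ Adm 1 a I ∧ ∃ i ∈ I, IsHeavy w i := by
  have key : ∀ {J : Finset (Fin n)} {i}, i ∈ J → IsHeavy w i → 1 < J.card →
      1 < ∑ j ∈ J, w j := by
    intro J i hi hh hc
    obtain ⟨j, hj, hji⟩ := Finset.exists_mem_ne hc i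
    refine (hh j hji).trans_le ?_
    rw [← Finset.sum_pair hji.symm]
    refine Finset.sum_le_sum_of_subset_of_nonneg ?_ fun i _ _ => (hpos i).le
    intro x hx
    rcases Finset.mem_insert.1 hx with rfl | hx
    · exact hi
    · exact Finset.mem_singleton.1 hx ▸ hj
  constructor
  · refine fun hI => ⟨hI.one hle, ?_⟩
    by_contra! h'
    exact absurd hI.2.1 (not_lt.2 (h.sum_le_one hpos h'))
  · rintro ⟨hI, i, hi, hh⟩
    obtain ⟨h1, h2, h3⟩ := adm_one_iff.1 hI
    exact ⟨h1, key hi hh h2, key (Finset.mem_compl.2 h1) ha h3⟩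

lemma IsHeavyLight.adj_iff (h : IsHeavyLight w) (hpos : ∀ i, 0 < w i) {k l : Others a} :
    (reducedWeightGraph w a).Adj k l ↔ k ≠ l ∧ (IsHeavy w k ∨ IsHeavy w l) := by
  have h1 : (reducedWeightGraph w a).Adj k l ↔ k.1 ≠ l.1 ∧ 1 < w k + w l := Iff.rfl
  rw [h1, Ne, Ne, Subtype.ext_iff]
  refine and_congr_right fun hkl => ⟨fun h2 => ?_, ?_⟩
  · by_contra! h3
    have := h.sum_le_one hpos (I := {k.1, l.1}) (by
      intro i hi
      rcases Finset.mem_insert.1 hi with rfl | hi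
      · exact h3.1
      · exact Finset.mem_singleton.1 hi ▸ h3.2)
    rw [Finset.sum_pair hkl] at this
    linarith
  · rintro (h2 | h2)
    · exact h2 l.1 (Ne.symm hkl)
    · rw [add_comm]
      exact h2 k.1 hkl

/-! ### Recovering the split coordinates from the image -/

/-- The sets with at least two elements, one of them heavy, that do not contain `a`: these are
the vertex sets of the connected subgraphs of `G(w)` with at least one edge. -/
def Big (w : Fin n → ℚ) (a : Fin n) (I : Finset (Fin n)) : Prop :=
  a ∉ I ∧ 1 < I.card ∧ ∃ i ∈ I, IsHeavy w i

lemma Big.subset {I : Finset (Fin n)} (h : Big w a I) : I ⊆ Finset.univ.erase a := fun _ hx =>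
  Finset.mem_erase.2 ⟨fun he => h.1 (he ▸ hx), Finset.mem_univ _⟩

lemma IsHeavyLight.big (h : IsHeavyLight w) (hpos : ∀ i, 0 < w i) (hle : ∀ i, w i ≤ 1)
    (ha : IsHeavy w a) {I : Finset (Fin n)} (hI : Adm w a I) : Big w a I := by
  obtain ⟨h1, h2⟩ := (h.adm_iff hpos hle ha).1 hI
  exact ⟨hI.1, (adm_one_iff.1 h1).2.1, h2⟩

lemma IsHeavyLight.adm_of_big (h : IsHeavyLight w) (hpos : ∀ i, 0 < w i) (hle : ∀ i, w i ≤ 1)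
    (ha : IsHeavy w a) {I : Finset (Fin n)} (hI : Big w a I) (hne : I ≠ Finset.univ.erase a) :
    Adm w a I := by
  refine (h.adm_iff hpos hle ha).2 ⟨adm_one_iff.2 ⟨hI.1, hI.2.1, ?_⟩, hI.2.2⟩
  obtain ⟨x, hx, hxI⟩ := Finset.exists_of_ssubset (hI.subset.ssubset_of_ne hne)
  exact Finset.one_lt_card.2 ⟨x, Finset.mem_compl.2 hxI, a, Finset.mem_compl.2 hI.1,
    Finset.ne_of_mem_erase hx⟩

lemma Adm.ne_erase {I : Finset (Fin n)} (h : Adm 1 a I) : I ≠ Finset.univ.erase a := by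
  rintro rfl
  have h1 := (adm_one_iff.1 h).2.2
  have : (Finset.univ.erase a)ᶜ = {a} := by
    ext x
    simp
  rw [this, Finset.card_singleton] at h1
  exact lt_irrefl _ h1

/-- In a connected vertex set there is an edge that lies in no member of a given laminar family
but those containing the whole set. -/
lemma exists_edge {I : Finset (Fin n)} (hI : Big w a I) {𝓛 : Finset (Finset (Fin n))}
    (h𝓛 : ∀ J ∈ 𝓛, ∀ K ∈ 𝓛, Compat J K) :
    ∃ h ∈ I, ∃ l ∈ I, IsHeavy w h ∧ l ≠ h ∧ ∀ J ∈ 𝓛, h ∈ J → l ∈ J → I ⊆ J := by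
  obtain ⟨-, hcard, h, hh, hheavy⟩ := hI
  by_cases hex : ∃ J ∈ 𝓛, h ∈ J ∧ ¬ I ⊆ J
  · obtain ⟨J₀, hJ₀, hmax⟩ := Finset.exists_max_image (𝓛.filter fun J => h ∈ J ∧ ¬ I ⊆ J)
      Finset.card (by obtain ⟨J, hJ⟩ := hex; exact ⟨J, by simpa using hJ⟩)
    rw [Finset.mem_filter] at hJ₀
    obtain ⟨l, hl, hlJ⟩ := Finset.not_subset.1 hJ₀.2.2
    refine ⟨h, hh, l, hl, hheavy, fun he => hlJ (he ▸ hJ₀.2.1), fun J hJ hhJ hlJ' => ?_⟩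
    by_contra hIJ
    have h1 := hmax J (Finset.mem_filter.2 ⟨hJ, hhJ, hIJ⟩)
    rcases h𝓛 J hJ J₀ hJ₀.1 with h2 | h2 | h2
    · exact hlJ (h2 hlJ')
    · exact hlJ (Finset.eq_of_subset_of_card_le h2 h1 ▸ hlJ')
    · exact Finset.disjoint_left.1 h2 hhJ hJ₀.2.1
  · push Not at hex
    obtain ⟨l, hl, hlh⟩ := Finset.exists_mem_ne hcard h
    exact ⟨h, hh, l, hl, hheavy, hlh, fun J hJ hhJ _ => hex J hJ hhJ⟩

/-- Split coordinates extended by a coordinate of arbitrary sign at the set of all markings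
but `a`. -/
structure IsExt (w : Fin n → ℚ) (a : Fin n) (c : Finset (Fin n) → ℝ) : Prop where
  big : ∀ I ∈ supp c, Big w a I
  nonneg : ∀ I, I ≠ Finset.univ.erase a → 0 ≤ c I
  compat : ∀ I ∈ supp c, ∀ J ∈ supp c, Compat I J

/-- The sum of the coordinates at all sets containing `I` is, up to the sign, the maximum of the
image over the edges in `I`. -/
lemma IsExt.isGreatest (h : IsHeavyLight w) (hpos : ∀ i, 0 < w i) {c : Finset (Fin n) → ℝ}
    (hc : IsExt w a c) {I : Finset (Fin n)} (hI : Big w a I) :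
    IsGreatest (splitMap (reducedWeightGraph w a) c '' {e | ∀ k ∈ e.1, k.1 ∈ I})
      (- ∑ J ∈ Finset.univ.filter (fun J => I ⊆ J), c J) := by
  classical
  constructor
  · obtain ⟨k, hk, l, hl, hheavy, hne, hJ⟩ := exists_edge hI hc.compat
    have hka : k ∈ ({a}ᶜ : Set (Fin n)) := fun he => hI.1 (he ▸ hk)
    have hla : l ∈ ({a}ᶜ : Set (Fin n)) := fun he => hI.1 (he ▸ hl)
    have hadj : s((⟨k, hka⟩ : Others a), ⟨l, hla⟩) ∈ (reducedWeightGraph w a).edgeSet :=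
      (SimpleGraph.mem_edgeSet _).2 <|
        (h.adj_iff hpos).2 ⟨fun he => hne (congrArg Subtype.val he).symm, .inl hheavy⟩
    refine ⟨⟨s(⟨k, hka⟩, ⟨l, hla⟩), hadj⟩, ?_, ?_⟩
    · intro x hx
      rcases Sym2.mem_iff.1 hx with rfl | rfl
      · exact hk
      · exact hl
    · refine (splitMap_apply _ c hadj).trans (neg_inj.2 ?_)
      symm
      refine Finset.sum_subset (fun J hJ' => ?_) fun J hJ1 hJ2 => ?_
      · simp only [Finset.mem_filter, Finset.mem_univ, true_and] at hJ' ⊢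
        exact ⟨hJ' hk, hJ' hl⟩
      · simp only [Finset.mem_filter, Finset.mem_univ, true_and] at hJ1 hJ2
        rw [← notMem_supp]
        exact fun hs => hJ2 (hJ J hs hJ1.1 hJ1.2)
  · rintro _ ⟨⟨e, he⟩, hmem, rfl⟩
    induction e using Sym2.ind with
    | _ k l =>
    rw [splitMap_apply, neg_le_neg_iff]
    have hk : k.1 ∈ I := hmem k (Sym2.mem_mk_left _ _)
    have hl : l.1 ∈ I := hmem l (Sym2.mem_mk_right _ _)
    refine Finset.sum_le_sum_of_subset_of_nonneg (fun J hJ' => ?_) fun J _ hJ2 => ?_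
    · simp only [Finset.mem_filter, Finset.mem_univ, true_and] at hJ' ⊢
      exact ⟨hJ' hk, hJ' hl⟩
    · simp only [Finset.mem_filter, Finset.mem_univ, true_and] at hJ2
      exact hc.nonneg J fun he => hJ2 (he ▸ hI.subset)

/-- Inversion of summation over supersets. -/
lemma mem_of_forall_sum_mem {A : AddSubgroup ℝ} {D : Finset (Fin n) → ℝ}
    (h0 : ∀ I, ¬ Big w a I → D I = 0)
    (h : ∀ I, Big w a I → ∑ J ∈ Finset.univ.filter (fun J => I ⊆ J), D J ∈ A)
    (I : Finset (Fin n)) : D I ∈ A := by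
  have main : ∀ k : ℕ, ∀ I : Finset (Fin n), Iᶜ.card = k → D I ∈ A := by
    intro k
    induction k using Nat.strong_induction_on with
    | _ k ih =>
    intro I hk
    by_cases hI : Big w a I
    · have h1 := h I hI
      have h2 : Finset.univ.filter (fun J => I ⊆ J) =
          insert I (Finset.univ.filter fun J => I ⊂ J) := by
        ext J
        simp only [Finset.mem_filter, Finset.mem_univ, true_and, Finset.mem_insert]
        rw [eq_comm (a := J)]
        exact le_iff_eq_or_lt
      rw [h2, Finset.sum_insert (by simp)] at h1
      refine (A.add_mem_cancel_right (A.sum_mem fun J hJ => ?_)).1 h1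
      refine ih _ ?_ J rfl
      rw [← hk]
      exact Finset.card_lt_card (Finset.compl_ssubset_compl.2 (Finset.mem_filter.1 hJ).2)
    · rw [h0 I hI]
      exact A.zero_mem
  exact main _ I rfl

lemma IsExt.eq_of_splitMap_eq (h : IsHeavyLight w) (hpos : ∀ i, 0 < w i)
    {c d : Finset (Fin n) → ℝ} (hc : IsExt w a c) (hd : IsExt w a d)
    (hcd : splitMap (reducedWeightGraph w a) c = splitMap (reducedWeightGraph w a) d) :
    c = d := by
  funext I
  have h1 := mem_of_forall_sum_mem (w := w) (a := a) (A := ⊥) (D := c - d) (fun I hI => ?_)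
    (fun I hI => ?_) I
  · exact sub_eq_zero.1 (AddSubgroup.mem_bot.1 h1)
  · have h2 : c I = 0 := notMem_supp.1 fun h => hI (hc.big I h)
    have h3 : d I = 0 := notMem_supp.1 fun h => hI (hd.big I h)
    simp [h2, h3]
  · have h2 := hc.isGreatest h hpos hI
    rw [hcd] at h2
    have h3 := h2.unique (hd.isGreatest h hpos hI)
    rw [AddSubgroup.mem_bot]
    simp only [Pi.sub_apply, Finset.sum_sub_distrib]
    linarith

lemma IsExt.integral (h : IsHeavyLight w) (hpos : ∀ i, 0 < w i)
    {c : Finset (Fin n) → ℝ} (hc : IsExt w a c)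
    (hz : ∀ e, ∃ k : ℤ, splitMap (reducedWeightGraph w a) c e = k) (I : Finset (Fin n)) :
    ∃ k : ℤ, c I = k := by
  have h1 := mem_of_forall_sum_mem (w := w) (a := a) (A := (Int.castAddHom ℝ).range) (D := c)
    (fun I hI => notMem_supp.1 fun h => hI (hc.big I h))
    (fun I hI => ?_) I
  · obtain ⟨k, hk⟩ := h1
    exact ⟨k, hk.symm⟩
  · obtain ⟨e, -, he⟩ := (hc.isGreatest h hpos hI).1
    obtain ⟨k, hk⟩ := hz e
    exact ⟨-k, by rw [hk] at he; simp only [Int.coe_castAddHom, Int.cast_neg]; linarith⟩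

lemma splitMap_single (G : SimpleGraph (Others a)) (I : Finset (Fin n)) (t : ℝ) :
    splitMap G (Pi.single I t) = t • negClique G I := by
  rw [splitMap, Fintype.linearCombination_apply_single]

lemma negClique_erase (G : SimpleGraph (Others a)) :
    negClique G (Finset.univ.erase a) = fun _ => -1 := by
  funext e
  refine if_pos fun k _ => Finset.mem_erase.2 ⟨k.2, Finset.mem_univ _⟩

lemma IsHeavyLight.negClique_eq_zero (h : IsHeavyLight w) (hpos : ∀ i, 0 < w i)
    {I : Finset (Fin n)} (hI : ∀ i ∈ I, ¬ IsHeavy w i) :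
    negClique (reducedWeightGraph w a) I = 0 := by
  funext ⟨e, he⟩
  induction e using Sym2.ind with
  | _ k l =>
  refine if_neg fun hkl => ?_
  rcases ((h.adj_iff hpos).1 he).2 with h1 | h1
  · exact hI _ (hkl k (Sym2.mem_mk_left _ _)) h1
  · exact hI _ (hkl l (Sym2.mem_mk_right _ _)) h1

lemma negClique_singleton (G : SimpleGraph (Others a)) (k : Fin n) :
    negClique G {k} = 0 := by
  funext ⟨e, he⟩
  induction e using Sym2.ind with
  | _ x y =>
  refine if_neg fun hkl => ?_
  have h1 := Finset.mem_singleton.1 (hkl x (Sym2.mem_mk_left _ _))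
  have h2 := Finset.mem_singleton.1 (hkl y (Sym2.mem_mk_right _ _))
  exact SimpleGraph.Adj.ne he (Subtype.ext (h1.trans h2.symm))

lemma IsCoord.isExt (h : IsHeavyLight w) (hpos : ∀ i, 0 < w i) (hle : ∀ i, w i ≤ 1)
    (ha : IsHeavy w a) (hO : Big w a (Finset.univ.erase a)) {c : Finset (Fin n) → ℝ}
    (hc : IsCoord w a c) (t : ℝ) : IsExt w a (c + Pi.single (Finset.univ.erase a) t) := by
  have hs : ∀ I ∈ supp (c + Pi.single (Finset.univ.erase a) t),
      I = Finset.univ.erase a ∨ I ∈ supp c := by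
    intro I hI
    by_contra! h'
    refine mem_supp.1 hI ?_
    rw [Pi.add_apply, notMem_supp.1 h'.2, Pi.single_eq_of_ne h'.1, add_zero]
  have hbig : ∀ I ∈ supp (c + Pi.single (Finset.univ.erase a) t), Big w a I := by
    intro I hI
    rcases hs I hI with rfl | h'
    · exact hO
    · exact h.big hpos hle ha (hc.2.1 I h')
  refine ⟨hbig, fun I hI => ?_, fun I hI J hJ => ?_⟩
  · rw [Pi.add_apply, Pi.single_eq_of_ne hI, add_zero]
    exact hc.1 I
  · rcases hs I hI with rfl | h1
    · exact .inr (.inl (hbig J hJ).subset)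
    · rcases hs J hJ with rfl | h2
      · exact .inl (hbig I hI).subset
      · exact hc.2.2 I h1 J h2

end

section

/-! ### Blocks of a laminar family -/

section Blocks

variable {α : Type*} {U : Finset α} {𝓛 : Finset (Finset α)}

/-- A laminar family of proper subsets of `U` with at least two elements each. -/
structure IsProperLaminar (U : Finset α) (𝓛 : Finset (Finset α)) : Prop where
  ssubset : ∀ J ∈ 𝓛, J ⊂ U
  card : ∀ J ∈ 𝓛, 1 < J.card
  compat : ∀ J ∈ 𝓛, ∀ K ∈ 𝓛, Compat J K
  top : 1 < U.card

lemma IsProperLaminar.subset_top (h : IsProperLaminar U 𝓛) {J : Finset α} (hJ : J ∈ 𝓛) : J ⊆ U :=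
  (h.ssubset J hJ).subset

lemma IsProperLaminar.notMem (h : IsProperLaminar U 𝓛) : U ∉ 𝓛 := fun hU => (h.ssubset U hU).ne rfl

variable [DecidableEq α]

/-- The blocks of a member `I` of a laminar family or of the whole set: the maximal members of the
family properly contained in `I`, and the singletons of the elements of `I` in none of them. -/
def blocks (U : Finset α) (𝓛 : Finset (Finset α)) (I : Finset α) : Finset (Finset α) :=
  (𝓛 ∪ U.image fun k => {k}).filter fun β => par U 𝓛 β = I

namespace IsProperLaminar

variable (h : IsProperLaminar U 𝓛) {I J β β' : Finset α}

lemma mem_cases (hβ : β ∈ 𝓛 ∪ U.image fun k => {k}) : β ∈ 𝓛 ∨ ∃ k ∈ U, β = {k} := by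
  rcases Finset.mem_union.1 hβ with h1 | h1
  · exact .inl h1
  · obtain ⟨k, hk, rfl⟩ := Finset.mem_image.1 h1
    exact .inr ⟨k, hk, rfl⟩

include h

lemma base (hβ : β ∈ 𝓛 ∪ U.image fun k => {k}) : β.Nonempty ∧ β ⊂ U := by
  rcases mem_cases hβ with h1 | ⟨k, hk, rfl⟩
  · exact ⟨Finset.card_pos.1 (by have := h.card β h1; omega), h.ssubset β h1⟩
  · refine ⟨Finset.singleton_nonempty k, (Finset.singleton_subset_iff.2 hk).ssubset_of_ne ?_⟩
    intro he
    have := h.top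
    rw [← he, Finset.card_singleton] at this
    exact lt_irrefl _ this

lemma mem_insert_subset (hI : I ∈ insert U 𝓛) : I ⊆ U ∧ 1 < I.card := by
  rcases Finset.mem_insert.1 hI with rfl | hI
  · exact ⟨subset_rfl, h.top⟩
  · exact ⟨h.subset_top hI, h.card I hI⟩

lemma block_ssubset (hβ : β ∈ blocks U 𝓛 I) : β ⊂ I := by
  obtain ⟨h1, rfl⟩ := Finset.mem_filter.1 hβ
  exact ssubset_par (h.base h1).1 (h.base h1).2 (fun J => h.subset_top) h.compat

lemma block_nonempty (hβ : β ∈ blocks U 𝓛 I) : β.Nonempty :=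
  (h.base (Finset.mem_filter.1 hβ).1).1

lemma block_disjoint (hβ : β ∈ blocks U 𝓛 I) (hβ' : β' ∈ blocks U 𝓛 I) (hne : β ≠ β') :
    Disjoint β β' := by
  have hnot : ∀ {β β'}, β ∈ blocks U 𝓛 I → β' ∈ blocks U 𝓛 I → ¬ β ⊂ β' := by
    intro β β' hβ hβ' hlt
    have hβ'𝓛 : β' ∈ 𝓛 := by
      rcases mem_cases (Finset.mem_filter.1 hβ').1 with h1 | ⟨k, hk, rfl⟩
      · exact h1
      · exact absurd (Finset.ssubset_singleton_iff.1 hlt) (h.block_nonempty hβ).ne_empty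
    have h1 := par_subset (U := U) hβ'𝓛 hlt
    rw [(Finset.mem_filter.1 hβ).2] at h1
    exact (h.block_ssubset hβ').not_subset h1
  rcases mem_cases (Finset.mem_filter.1 hβ).1 with h1 | ⟨k, hk, rfl⟩
  · rcases mem_cases (Finset.mem_filter.1 hβ').1 with h2 | ⟨l, hl, rfl⟩
    · rcases h.compat β h1 β' h2 with h3 | h3 | h3
      · exact absurd (h3.ssubset_of_ne hne) (hnot hβ hβ')
      · exact absurd (h3.ssubset_of_ne hne.symm) (hnot hβ' hβ)
      · exact h3
    · rw [Finset.disjoint_singleton_right]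
      exact fun hl => hnot hβ' hβ ((Finset.singleton_subset_iff.2 hl).ssubset_of_ne hne.symm)
  · rw [Finset.disjoint_singleton_left]
    exact fun hl => hnot hβ hβ' ((Finset.singleton_subset_iff.2 hl).ssubset_of_ne hne)

lemma exists_block_superset (hI : I ∈ insert U 𝓛) (hJ : J.Nonempty) (hJI : J ⊂ I)
    (hJB : J ∈ 𝓛 ∪ U.image fun k => {k}) : ∃ β ∈ blocks U 𝓛 I, J ⊆ β := by
  rcases par_eq_or_exists_child (fun J => h.subset_top) hI h.compat hJ hJI with h1 | h1
  · exact ⟨J, Finset.mem_filter.2 ⟨hJB, h1⟩, subset_rfl⟩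
  · obtain ⟨K, hK, -, hKI, hJK⟩ := h1
    exact ⟨K, Finset.mem_filter.2 ⟨Finset.mem_union_left _ hK, hKI⟩, hJK⟩

lemma exists_block (hI : I ∈ insert U 𝓛) {k : α} (hk : k ∈ I) :
    ∃ β ∈ blocks U 𝓛 I, k ∈ β := by
  have h2 := h.mem_insert_subset hI
  obtain ⟨β, hβ, h1⟩ := h.exists_block_superset hI (Finset.singleton_nonempty k)
    ((Finset.singleton_subset_iff.2 hk).ssubset_of_ne fun he => by
      rw [← he, Finset.card_singleton] at h2
      omega)
    (Finset.mem_union_right _ (Finset.mem_image_of_mem _ (h2.1 hk)))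
  exact ⟨β, hβ, Finset.singleton_subset_iff.1 h1⟩

lemma two_le_card_blocks (hI : I ∈ insert U 𝓛) : 2 ≤ (blocks U 𝓛 I).card := by
  obtain ⟨k, hk⟩ := Finset.card_pos.1 (Nat.zero_lt_of_lt (h.mem_insert_subset hI).2)
  obtain ⟨β, hβ, -⟩ := h.exists_block hI hk
  obtain ⟨l, hl, hlβ⟩ := Finset.exists_of_ssubset (h.block_ssubset hβ)
  obtain ⟨β', hβ', hlβ'⟩ := h.exists_block hI hl
  exact Finset.one_lt_card.2 ⟨β, hβ, β', hβ', fun he => hlβ (he ▸ hlβ')⟩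

/-- Every member of the family and every singleton is a block of exactly one set. -/
lemma sum_card_blocks : ∑ I ∈ insert U 𝓛, (blocks U 𝓛 I).card = 𝓛.card + U.card := by
  have h1 : (𝓛 ∪ U.image fun k => ({k} : Finset α)).card = 𝓛.card + U.card := by
    rw [Finset.card_union_of_disjoint, Finset.card_image_of_injective _ Finset.singleton_injective]
    rw [Finset.disjoint_left]
    intro J hJ hJ'
    obtain ⟨k, -, rfl⟩ := Finset.mem_image.1 hJ'
    have := h.card _ hJ
    rw [Finset.card_singleton] at this
    omega
  rw [← h1]
  refine (Finset.card_eq_sum_card_fiberwise fun β hβ => ?_).symm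
  exact par_mem_insert (h.base hβ).1 (fun J => h.subset_top) h.compat

lemma card_le : 𝓛.card + 2 ≤ U.card := by
  have h1 := h.sum_card_blocks
  have h2 := Finset.card_nsmul_le_sum _ _ 2 fun I hI => h.two_le_card_blocks hI
  rw [Finset.card_insert_of_notMem h.notMem, smul_eq_mul] at h2
  omega

lemma exists_three_le (hc : 𝓛.card + 2 < U.card) :
    ∃ I ∈ insert U 𝓛, 3 ≤ (blocks U 𝓛 I).card := by
  by_contra! hlt
  have h1 := h.sum_card_blocks
  have h2 := Finset.sum_le_card_nsmul (insert U 𝓛) (fun I => (blocks U 𝓛 I).card) 2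
    fun I hI => Nat.le_of_lt_succ (hlt I hI)
  rw [Finset.card_insert_of_notMem h.notMem, smul_eq_mul] at h2
  omega

/-- If a family has one member less than possible, then exactly one set has more than two
blocks, namely three. -/
lemma exists_unique_three (hc : 𝓛.card + 3 = U.card) :
    ∃ I ∈ insert U 𝓛, (blocks U 𝓛 I).card = 3 ∧
      ∀ K ∈ insert U 𝓛, K ≠ I → (blocks U 𝓛 K).card = 2 := by
  obtain ⟨I, hI, h3⟩ := h.exists_three_le (by omega)
  have h1 := h.sum_card_blocks
  rw [← Finset.add_sum_erase _ _ hI] at h1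
  have hcard : ((insert U 𝓛).erase I).card = 𝓛.card := by
    rw [Finset.card_erase_of_mem hI, Finset.card_insert_of_notMem h.notMem]
    omega
  have h2 := Finset.card_nsmul_le_sum ((insert U 𝓛).erase I) (fun I => (blocks U 𝓛 I).card) 2
    fun K hK => h.two_le_card_blocks (Finset.mem_of_mem_erase hK)
  rw [hcard, smul_eq_mul] at h2
  refine ⟨I, hI, by omega, fun K hK hKI => ?_⟩
  have hK' : K ∈ (insert U 𝓛).erase I := Finset.mem_erase.2 ⟨hKI, hK⟩
  rw [← Finset.add_sum_erase _ _ hK'] at h1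
  have h4 := Finset.card_nsmul_le_sum (((insert U 𝓛).erase I).erase K)
    (fun I => (blocks U 𝓛 I).card) 2
    fun K hK => h.two_le_card_blocks (Finset.mem_of_mem_erase (Finset.mem_of_mem_erase hK))
  rw [Finset.card_erase_of_mem hK', hcard, smul_eq_mul] at h4
  have h5 := h.two_le_card_blocks hK
  have h6 : 0 < 𝓛.card := hcard ▸ Finset.card_pos.2 ⟨K, hK'⟩
  omega

/-- The complement of a block of `I` in `I` is compatible with the family. -/
lemma compat_sdiff (hI : I ∈ insert U 𝓛) (hβ : β ∈ blocks U 𝓛 I) {K : Finset α}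
    (hK : K ∈ 𝓛) : Compat (I \ β) K := by
  have hIK : I ⊆ K ∨ K ⊂ I ∨ Disjoint I K := by
    rcases Finset.mem_insert.1 hI with rfl | hI'
    · exact .inr (.inl (h.ssubset K hK))
    · rcases h.compat I hI' K hK with h1 | h1 | h1
      · exact .inl h1
      · rcases h1.eq_or_ssubset with rfl | h1
        · exact .inl subset_rfl
        · exact .inr (.inl h1)
      · exact .inr (.inr h1)
  rcases hIK with h1 | h1 | h1
  · exact .inl (Finset.sdiff_subset.trans h1)
  · have hKB := Finset.mem_union_left (U.image fun k => ({k} : Finset α)) hK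
    obtain ⟨β', hβ', hKβ'⟩ := h.exists_block_superset hI (h.base hKB).1 h1 hKB
    by_cases he : β' = β
    · subst he
      exact .inr (.inr (Finset.sdiff_disjoint.mono_right hKβ'))
    · refine .inr (.inl fun x hx => Finset.mem_sdiff.2 ⟨h1.subset hx, fun hxβ => ?_⟩)
      exact Finset.disjoint_left.1 (h.block_disjoint hβ' hβ he) (hKβ' hx) hxβ
  · exact .inr (.inr (h1.mono_left Finset.sdiff_subset))

lemma sdiff_notMem (hI : I ∈ insert U 𝓛) (hβ : β ∈ blocks U 𝓛 I)
    (h3 : 3 ≤ (blocks U 𝓛 I).card) : 1 < (I \ β).card ∧ I \ β ∉ insert U 𝓛 := by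
  have hc : 1 < ((blocks U 𝓛 I).erase β).card := by
    rw [Finset.card_erase_of_mem hβ]
    omega
  obtain ⟨β₁, h1, β₂, h2, hne⟩ := Finset.one_lt_card.1 hc
  obtain ⟨h1β, h1⟩ := Finset.mem_erase.1 h1
  obtain ⟨h2β, h2⟩ := Finset.mem_erase.1 h2
  have hsub : ∀ {γ}, γ ≠ β → γ ∈ blocks U 𝓛 I → γ ⊆ I \ β := fun hne hγ x hx =>
    Finset.mem_sdiff.2 ⟨(h.block_ssubset hγ).subset hx,
      fun hxβ => Finset.disjoint_left.1 (h.block_disjoint hγ hβ hne) hx hxβ⟩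
  obtain ⟨x, hx⟩ := h.block_nonempty h1
  obtain ⟨y, hy⟩ := h.block_nonempty h2
  have hxy : x ≠ y := fun he =>
    Finset.disjoint_left.1 (h.block_disjoint h1 h2 hne) hx (he ▸ hy)
  have hlt : I \ β ⊂ I := by
    obtain ⟨z, hz⟩ := h.block_nonempty hβ
    refine (Finset.ssubset_iff_of_subset Finset.sdiff_subset).2
      ⟨z, (h.block_ssubset hβ).subset hz, fun h' => (Finset.mem_sdiff.1 h').2 hz⟩
  refine ⟨Finset.one_lt_card.2 ⟨x, hsub h1β h1 hx, y, hsub h2β h2 hy, hxy⟩, fun hmem => ?_⟩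
  rcases Finset.mem_insert.1 hmem with he | hmem
  · exact (hlt.trans_subset (h.mem_insert_subset hI).1).ne he
  · obtain ⟨γ, hγ, hsubγ⟩ := h.exists_block_superset hI ⟨x, hsub h1β h1 hx⟩ hlt
      (Finset.mem_union_left _ hmem)
    have h1γ : β₁ = γ := by
      by_contra hn
      exact Finset.disjoint_left.1 (h.block_disjoint h1 hγ hn) hx (hsubγ (hsub h1β h1 hx))
    have h2γ : β₂ = γ := by
      by_contra hn
      exact Finset.disjoint_left.1 (h.block_disjoint h2 hγ hn) hy (hsubγ (hsub h2β h2 hy))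
    exact hne (h1γ.trans h2γ.symm)

/-- A set that is compatible with the family and not in it is a union of at least two, but not of
all blocks of its parent. -/
lemma block_subset_or_disjoint (hJ1 : 1 < J.card) (hJ𝓛 : J ∉ 𝓛)
    (hc : ∀ K ∈ 𝓛, Compat J K) (hβ : β ∈ blocks U 𝓛 (par U 𝓛 J)) :
    β ⊂ J ∨ Disjoint J β := by
  rcases mem_cases (Finset.mem_filter.1 hβ).1 with h1 | ⟨k, hk, rfl⟩
  · rcases hc β h1 with h2 | h2 | h2
    · have h3 : J ⊂ β := h2.ssubset_of_ne fun he => hJ𝓛 (he ▸ h1)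
      exact absurd (par_subset (U := U) h1 h3) (h.block_ssubset hβ).not_subset
    · exact .inl (h2.ssubset_of_ne fun he => hJ𝓛 (he ▸ h1))
    · exact .inr h2
  · by_cases hkJ : k ∈ J
    · refine .inl ((Finset.singleton_subset_iff.2 hkJ).ssubset_of_ne ?_)
      rintro rfl
      rw [Finset.card_singleton] at hJ1
      omega
    · exact .inr (Finset.disjoint_singleton_right.2 hkJ)

lemma eq_sdiff_of_compat (hJ1 : 1 < J.card) (hJU : J ⊂ U) (hJ𝓛 : J ∉ 𝓛)
    (hc : ∀ K ∈ 𝓛, Compat J K) (h3 : (blocks U 𝓛 (par U 𝓛 J)).card ≤ 3) :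
    (blocks U 𝓛 (par U 𝓛 J)).card = 3 ∧
      ∃ β ∈ blocks U 𝓛 (par U 𝓛 J), J = par U 𝓛 J \ β := by
  have hJne : J.Nonempty := Finset.card_pos.1 (by omega)
  set I := par U 𝓛 J with hI
  have hII : I ∈ insert U 𝓛 := par_mem_insert hJne (fun J => h.subset_top) h.compat
  have hJI : J ⊂ I := ssubset_par hJne hJU (fun J => h.subset_top) h.compat
  have hblock : ∀ {γ}, γ ∈ blocks U 𝓛 I → γ ⊂ J ∨ Disjoint J γ := fun hγ =>
    h.block_subset_or_disjoint hJ1 hJ𝓛 hc hγ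
  obtain ⟨k, hkI, hkJ⟩ := Finset.exists_of_ssubset hJI
  obtain ⟨β, hβ, hkβ⟩ := h.exists_block hII hkI
  have hβJ : Disjoint J β := (hblock hβ).resolve_left fun h' => hkJ (h'.subset hkβ)
  -- `J` contains a block, and properly so, hence it meets a second block
  obtain ⟨x, hx⟩ := hJne
  obtain ⟨β₁, h1, hxβ⟩ := h.exists_block hII (hJI.subset hx)
  have h1J : β₁ ⊂ J := (hblock h1).resolve_right fun h' => Finset.disjoint_left.1 h' hx hxβ
  obtain ⟨y, hy, hyβ₁⟩ := Finset.exists_of_ssubset h1J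
  obtain ⟨β₂, h2, hyβ⟩ := h.exists_block hII (hJI.subset hy)
  have h2J : β₂ ⊂ J := (hblock h2).resolve_right fun h' => Finset.disjoint_left.1 h' hy hyβ
  have h12 : β₁ ≠ β₂ := fun he => hyβ₁ (he ▸ hyβ)
  have hβ1 : β ≠ β₁ := fun he => Finset.disjoint_left.1 hβJ hx (he ▸ hxβ)
  have hβ2 : β ≠ β₂ := fun he => Finset.disjoint_left.1 hβJ hy (he ▸ hyβ)
  have hsub : ({β, β₁, β₂} : Finset (Finset α)) ⊆ blocks U 𝓛 I := by
    intro γ hγ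
    simp only [Finset.mem_insert, Finset.mem_singleton] at hγ
    rcases hγ with rfl | rfl | rfl <;> assumption
  have hcard : ({β, β₁, β₂} : Finset (Finset α)).card = 3 :=
    Finset.card_eq_three.2 ⟨β, β₁, β₂, hβ1, hβ2, h12, rfl⟩
  have heq := Finset.eq_of_subset_of_card_le hsub (by rw [hcard]; exact h3)
  refine ⟨by rw [← heq, hcard], β, hβ, Finset.Subset.antisymm (fun z hz => ?_) fun z hz => ?_⟩
  · exact Finset.mem_sdiff.2 ⟨hJI.subset hz, Finset.disjoint_left.1 hβJ hz⟩
  · obtain ⟨hzI, hzβ⟩ := Finset.mem_sdiff.1 hz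
    obtain ⟨γ, hγ, hzγ⟩ := h.exists_block hII hzI
    rw [← heq] at hγ
    simp only [Finset.mem_insert, Finset.mem_singleton] at hγ
    rcases hγ with rfl | rfl | rfl
    · exact absurd hzγ hzβ
    · exact h1J.subset hzγ
    · exact h2J.subset hzγ

end IsProperLaminar

end Blocks

end

section

/-! ### The Bergman fan of a cycle matroid -/

section CycleMatroid

variable {W : Type*} {G : SimpleGraph W} {x : G.edgeSet → ℝ}

lemma cycleMatroid_indep_iff [Finite G.edgeSet] {I : Set G.edgeSet} :
    (cycleMatroid G).Indep I ↔ IsForest G I :=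
  IndepMatroid.matroid_indep_iff ..

/-- The subgraph of a graph with edge weights `x` formed by the edges of weight less than `t`. -/
def lowGraph (x : G.edgeSet → ℝ) (t : ℝ) : SimpleGraph W :=
  SimpleGraph.fromEdgeSet (Subtype.val '' {f : G.edgeSet | x f < t})

lemma lowGraph_adj {t : ℝ} {u v : W} :
    (lowGraph x t).Adj u v ↔ ∃ h : s(u, v) ∈ G.edgeSet, x ⟨s(u, v), h⟩ < t := by
  rw [lowGraph, SimpleGraph.fromEdgeSet_adj]
  constructor
  · rintro ⟨⟨⟨e, he⟩, hlt, rfl⟩, -⟩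
    exact ⟨he, hlt⟩
  · rintro ⟨h, hlt⟩
    exact ⟨⟨_, hlt, rfl⟩, ((SimpleGraph.mem_edgeSet _).1 h).ne⟩

lemma finsum_mem_exchange {E : Type*} [Finite E] (x : E → ℝ) {B : Set E} {e f : E} (he : e ∈ B)
    (hf : f ∉ B) : ∑ᶠ i ∈ insert f B \ {e}, x i + x e = ∑ᶠ i ∈ B, x i + x f := by
  have hfe : f ≠ e := fun h => hf (h ▸ he)
  have h1 : insert f B \ {e} = insert f (B \ {e}) := by
    rw [Set.insert_sdiff_of_notMem _ (by simpa using hfe)]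
  have h2 : ∑ᶠ i ∈ B, x i = x e + ∑ᶠ i ∈ B \ {e}, x i := by
    rw [← finsum_mem_insert _ (by simp) (Set.toFinite _), Set.insert_sdiff_singleton,
      Set.insert_eq_of_mem he]
  rw [h1, finsum_mem_insert _ (fun h => hf h.1) (Set.toFinite _), h2]
  ring

/-- An edge lies in a basis of minimal weight if and only if its end points are not joined by a
path of edges of smaller weight. -/
lemma mem_bergmanFan_iff [Finite G.edgeSet] : x ∈ bergmanFan (cycleMatroid G) ↔
    ∀ u v, ∀ h : s(u, v) ∈ G.edgeSet, ¬ (lowGraph x (x ⟨s(u, v), h⟩)).Reachable u v := by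
  constructor
  · rintro hx u v h ⟨p⟩
    obtain ⟨B, hB, heB, hmin⟩ := hx ⟨s(u, v), h⟩ (Set.mem_univ _)
    set e : G.edgeSet := ⟨s(u, v), h⟩
    have hF : IsForest G B := cycleMatroid_indep_iff.1 hB.indep
    have hnr : ¬ (SimpleGraph.fromEdgeSet (Subtype.val '' (B \ {e}))).Reachable u v := by
      intro hr
      have h1 : IsForest G (insert (⟨s(u, v), h⟩ : G.edgeSet) (B \ {e})) := by
        rwa [Set.insert_sdiff_singleton, Set.insert_eq_of_mem heB]
      unfold IsForest at h1
      rw [fromEdgeSet_insert G _ h, SimpleGraph.isAcyclic_sup_fromEdgeSet_iff] at h1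
      rcases h1.2 hr with h2 | h2
      · exact ((SimpleGraph.mem_edgeSet _).1 h).ne h2
      · obtain ⟨⟨f, hf, hfe⟩, -⟩ := (SimpleGraph.fromEdgeSet_adj _).1 h2
        exact hf.2 (Subtype.ext hfe)
    -- an edge of the path joins the two components of the basis without the edge `e`
    obtain ⟨d, -, hd1, hd2⟩ := p.exists_boundary_dart
      {z | (SimpleGraph.fromEdgeSet (Subtype.val '' (B \ {e}))).Reachable u z}
      (SimpleGraph.Reachable.refl u) hnr
    obtain ⟨hf, hlt⟩ := lowGraph_adj.1 d.adj
    have hnr' : ¬ (SimpleGraph.fromEdgeSet (Subtype.val '' (B \ {e}))).Reachable d.fst d.snd :=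
      fun h => hd2 (SimpleGraph.Reachable.trans hd1 h)
    have hfe : (⟨s(d.fst, d.snd), hf⟩ : G.edgeSet) ≠ e := fun he => by
      rw [he] at hlt
      exact lt_irrefl _ hlt
    have hfB : (⟨s(d.fst, d.snd), hf⟩ : G.edgeSet) ∉ B := fun hfB =>
      hnr' <| SimpleGraph.Adj.reachable <|
        (SimpleGraph.fromEdgeSet_adj _).2 ⟨⟨_, ⟨hfB, hfe⟩, rfl⟩, d.adj.ne⟩
    have hB' := hB.exchange_isBase_of_indep hfB (cycleMatroid_indep_iff.2
      (isForest_insert hf (hF.subset Set.sdiff_subset) hnr'))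
    have h1 := hmin _ hB'
    rw [← Set.insert_sdiff_of_notMem _ (by simpa using hfe)] at h1
    have h2 := finsum_mem_exchange x heB hfB
    linarith
  · intro hx ⟨e, he⟩ _
    induction e using Sym2.ind with
    | _ u v =>
    set e : G.edgeSet := ⟨s(u, v), he⟩
    obtain ⟨B, hB, hmin⟩ := (Set.toFinite {B | (cycleMatroid G).IsBase B}).exists_minimalFor
      (fun B => ∑ᶠ i ∈ B, x i) _ (cycleMatroid G).exists_isBase
    have hmin' : ∀ B', (cycleMatroid G).IsBase B' → ∑ᶠ i ∈ B, x i ≤ ∑ᶠ i ∈ B', x i :=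
      fun B' hB' => (le_total _ _).elim id fun h => hmin hB' h
    by_cases heB : e ∈ B
    · exact ⟨B, hB, heB, hmin'⟩
    -- the edge `e` and the smaller edges of `B` extend to a basis by larger edges of `B`
    have hI : (cycleMatroid G).Indep (insert e (B ∩ {f | x f < x e})) := by
      refine cycleMatroid_indep_iff.2 (isForest_insert he
        ((cycleMatroid_indep_iff.1 hB.indep).subset Set.inter_subset_left) fun hr => ?_)
      exact hx u v he (hr.mono (SimpleGraph.fromEdgeSet_mono
        (Set.image_mono Set.inter_subset_right)))
    obtain ⟨B', hB', hIB, hBB⟩ := hI.exists_isBase_subset_union_isBase hB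
    have heB' : e ∈ B' := hIB (Set.mem_insert _ _)
    have hd : B' \ B = {e} := by
      refine Set.Subset.antisymm (fun f hf => ?_) (by simpa using ⟨heB', heB⟩)
      rcases hBB hf.1 with (h | h) | h
      · exact h
      · exact absurd h.1 hf.2
      · exact absurd h hf.2
    obtain ⟨f, hf, hBf⟩ := hB'.eq_exchange_of_sdiff_eq_singleton hB hd
    have hle : x e ≤ x f := by
      by_contra! hlt
      exact hf.2 (hIB (Set.mem_insert_of_mem _ ⟨hf.1, hlt⟩))
    have h1 := finsum_mem_exchange x heB' hf.2
    rw [← hBf] at h1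
    exact ⟨B', hB', heB', fun B'' hB'' => le_trans (by linarith) (hmin' B'' hB'')⟩

end CycleMatroid

/-! ### The image of the moduli space is the Bergman fan -/

variable {n : ℕ} {w : Fin n → ℚ} {a : Fin n}

/-- The image of a nonnegative vector with laminar support satisfies the ultrametric inequality: if
the sum of the coordinates at the sets containing `u` and `m` and the one for `m` and `v` are
greater than `t`, then so is the one for `u` and `v`. -/
lemma splitMap_mem_bergmanFan (G : SimpleGraph (Others a)) {c : Finset (Fin n) → ℝ}
    (h0 : ∀ I, 0 ≤ c I) (hc : ∀ I ∈ supp c, ∀ J ∈ supp c, Compat I J) :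
    splitMap G c ∈ bergmanFan (cycleMatroid G) := by
  classical
  rw [mem_bergmanFan_iff]
  intro k l hkl hr
  rw [splitMap_apply] at hr
  set D : Fin n → Fin n → ℝ := fun u v => ∑ I ∈ Finset.univ.filter (fun I => u ∈ I ∧ v ∈ I), c I
    with hD
  have hmono : ∀ {u m u' v'}, (∀ J ∈ supp c, u ∈ J → m ∈ J → u' ∈ J ∧ v' ∈ J) →
      D u m ≤ D u' v' := by
    intro u m u' v' hJ
    simp only [hD, Finset.sum_filter]
    refine Finset.sum_le_sum fun J _ => ?_
    by_cases hs : J ∈ supp c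
    · by_cases hJ' : u ∈ J ∧ m ∈ J
      · rw [if_pos hJ', if_pos (hJ J hs hJ'.1 hJ'.2)]
      · rw [if_neg hJ']
        split_ifs
        exacts [h0 J, le_rfl]
    · simp [notMem_supp.1 hs]
  have key : ∀ u m v, D u m ≤ D u v ∨ D m v ≤ D u v := by
    intro u m v
    by_cases hex : ∃ I ∈ supp c, u ∈ I ∧ m ∈ I ∧ v ∉ I
    · obtain ⟨I, hI, hu, hm, hv⟩ := hex
      refine .inr (hmono fun J hJ hmJ hvJ => ?_)
      rcases hc I hI J hJ with h1 | h1 | h1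
      · exact ⟨h1 hu, hvJ⟩
      · exact absurd (h1 hvJ) hv
      · exact absurd hmJ (Finset.disjoint_left.1 h1 hm)
    · push Not at hex
      exact .inl (hmono fun J hJ huJ hmJ => ⟨huJ, hex J hJ huJ hmJ⟩)
  have hR : ∀ m, Relation.ReflTransGen (lowGraph (splitMap G c) (-D k l)).Adj k m →
      k = m ∨ D k l < D k m := by
    intro m hm
    induction hm with
    | refl => exact .inl rfl
    | tail _ hadj ih =>
      rename_i m v _
      obtain ⟨he, hlt⟩ := lowGraph_adj.1 hadj
      rw [splitMap_apply, neg_lt_neg_iff] at hlt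
      rcases ih with rfl | ih
      · exact .inr hlt
      · rcases key k m v with h1 | h1
        · exact .inr (ih.trans_le h1)
        · exact .inr (hlt.trans_le h1)
  rcases hR l ((SimpleGraph.reachable_iff_reflTransGen _ _).1 hr) with h1 | h1
  · exact ((SimpleGraph.mem_edgeSet _).1 hkl).ne h1
  · exact lt_irrefl _ h1

/-- A finite set of reals with maximum `M` can be described by nonnegative weights: `M - s` is the
sum of the weights at the elements that are at least `s`. -/
lemma exists_sum_eq_sub (S : Finset ℝ) : ∀ M ∈ S, (∀ s ∈ S, s ≤ M) →
    ∃ T ⊆ S, (∀ t ∈ T, t < M) ∧ ∃ g : ℝ → ℝ, (∀ t ∈ T, 0 ≤ g t) ∧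
      ∀ s ∈ S, ∑ t ∈ T.filter (fun t => s ≤ t), g t = M - s := by
  classical
  induction S using Finset.induction_on_min with
  | empty => simp
  | insert b S hb ih =>
    intro M hM hmax
    rcases S.eq_empty_or_nonempty with rfl | hS
    · refine ⟨∅, by simp, by simp, 0, by simp, ?_⟩
      simpa [eq_comm, sub_eq_zero] using hM
    · have hMS : M ∈ S := by
        obtain ⟨s, hs⟩ := hS
        refine (Finset.mem_insert.1 hM).resolve_left ?_
        rintro rfl
        exact absurd (hmax s (Finset.mem_insert_of_mem hs)) (not_le.2 (hb s hs))
      obtain ⟨T, hTS, hlt, g, hg, hsum⟩ := ih M hMS fun s hs =>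
        hmax s (Finset.mem_insert_of_mem hs)
      have hbT : b ∉ T := fun h => lt_irrefl _ (hb b (hTS h))
      refine ⟨insert b T, Finset.insert_subset_insert _ hTS, ?_,
        Function.update g b (M - b - ∑ t ∈ T, g t), ?_, ?_⟩
      · intro t ht
        rcases Finset.mem_insert.1 ht with rfl | ht
        · exact hb M hMS
        · exact hlt t ht
      · intro t ht
        rcases Finset.mem_insert.1 ht with rfl | htT
        · have hm := hsum _ (S.min'_mem hS)
          rw [Finset.filter_true_of_mem fun t ht => S.min'_le t (hTS ht)] at hm
          rw [Function.update_self, hm]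
          linarith [hb _ (S.min'_mem hS)]
        · rw [Function.update_of_ne (by rintro rfl; exact hbT htT)]
          exact hg t htT
      · intro s hs
        have hcongr : ∀ T' ⊆ T, ∑ t ∈ T', Function.update g b (M - b - ∑ t ∈ T, g t) t =
            ∑ t ∈ T', g t := fun T' hT' => Finset.sum_congr rfl fun t ht =>
          Function.update_of_ne (by rintro rfl; exact hbT (hT' ht)) _ _
        rcases Finset.mem_insert.1 hs with rfl | hs
        · rw [Finset.filter_true_of_mem, Finset.sum_insert hbT, Function.update_self,
            hcongr T subset_rfl]
          · ring
          · intro t ht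
            rcases Finset.mem_insert.1 ht with rfl | ht
            · exact le_rfl
            · exact (hb t (hTS ht)).le
        · rw [Finset.filter_insert, if_neg (not_le.2 (hb s hs)),
            hcongr _ (Finset.filter_subset _ _), hsum s hs]

/-- The marking set of the connected component of `k` in a graph. -/
def componentSet (H : SimpleGraph (Others a)) (k : Others a) : Finset (Fin n) := by
  classical exact Finset.univ.filter fun i => ∃ h, H.Reachable k ⟨i, h⟩

lemma mem_componentSet {H : SimpleGraph (Others a)} {k l : Others a} :
    l.1 ∈ componentSet H k ↔ H.Reachable k l := by
  classical
  simp only [componentSet, Finset.mem_filter, Finset.mem_univ, true_and]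
  exact ⟨fun ⟨_, h⟩ => h, fun h => ⟨l.2, h⟩⟩

lemma notMem_componentSet {H : SimpleGraph (Others a)} {k : Others a} :
    a ∉ componentSet H k := by
  classical
  simp only [componentSet, Finset.mem_filter, Finset.mem_univ, true_and]
  exact fun ⟨h, _⟩ => h rfl

lemma componentSet_eq_of_mem {H : SimpleGraph (Others a)} {k l : Others a}
    (h : l.1 ∈ componentSet H k) : componentSet H k = componentSet H l := by
  classical
  have h1 := mem_componentSet.1 h
  ext i
  simp only [componentSet, Finset.mem_filter, Finset.mem_univ, true_and]
  exact exists_congr fun hi => ⟨fun h2 => h1.symm.trans h2, fun h2 => h1.trans h2⟩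

lemma compat_componentSet {H H' : SimpleGraph (Others a)} (hle : H ≤ H') (k l : Others a) :
    componentSet H k ⊆ componentSet H' l ∨
      Disjoint (componentSet H k) (componentSet H' l) := by
  rw [or_iff_not_imp_right, Finset.not_disjoint_iff]
  rintro ⟨i, hi1, hi2⟩
  have hia : i ∈ ({a}ᶜ : Set (Fin n)) := fun h => notMem_componentSet (h ▸ hi1 : a ∈ _)
  rw [componentSet_eq_of_mem (l := ⟨i, hia⟩) hi1, componentSet_eq_of_mem (l := ⟨i, hia⟩) hi2]
  intro j hj
  have hja : j ∈ ({a}ᶜ : Set (Fin n)) := fun h => notMem_componentSet (h ▸ hj : a ∈ _)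
  exact mem_componentSet (l := ⟨j, hja⟩).2 ((mem_componentSet (l := ⟨j, hja⟩).1 hj).mono hle)

/-- The components of the edges of weight at most `t`, for all `t` smaller than the maximal
weight, form the laminar family that a point of the Bergman fan comes from. -/
lemma exists_isCoord_of_mem_bergmanFan (h : IsHeavyLight w) (hpos : ∀ i, 0 < w i)
    (hle : ∀ i, w i ≤ 1) (ha : IsHeavy w a) {x : (reducedWeightGraph w a).edgeSet → ℝ}
    [Nonempty (reducedWeightGraph w a).edgeSet]
    (hx : x ∈ bergmanFan (cycleMatroid (reducedWeightGraph w a))) :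
    ∃ c, IsCoord w a c ∧ ∃ t : ℝ, ∀ e, splitMap (reducedWeightGraph w a) c e = x e + t := by
  classical
  have := Fintype.ofFinite (reducedWeightGraph w a).edgeSet
  rw [mem_bergmanFan_iff] at hx
  obtain ⟨e₀, he₀⟩ := Finite.exists_max x
  obtain ⟨T, -, hT, g, hg, hsum⟩ := exists_sum_eq_sub (Finset.univ.image x) (x e₀)
    (Finset.mem_image_of_mem _ (Finset.mem_univ _))
    (fun s hs => by
      obtain ⟨e, -, rfl⟩ := Finset.mem_image.1 hs
      exact he₀ e)
  -- the graph of the edges of weight at most `t`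
  set H : ℝ → SimpleGraph (Others a) := fun t =>
    SimpleGraph.fromEdgeSet (Subtype.val '' {f : (reducedWeightGraph w a).edgeSet | x f ≤ t})
    with hH
  have hadj : ∀ t u v, (H t).Adj u v ↔
      ∃ h : s(u, v) ∈ (reducedWeightGraph w a).edgeSet, x ⟨s(u, v), h⟩ ≤ t := by
    intro t u v
    rw [hH, SimpleGraph.fromEdgeSet_adj]
    constructor
    · rintro ⟨⟨⟨e, he⟩, hlt, rfl⟩, -⟩
      exact ⟨he, hlt⟩
    · rintro ⟨h, hlt⟩
      exact ⟨⟨_, hlt, rfl⟩, ((SimpleGraph.mem_edgeSet _).1 h).ne⟩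
  have hmono : ∀ {t t'}, t ≤ t' → H t ≤ H t' := by
    intro t t' htt u v huv
    obtain ⟨he, hlt⟩ := (hadj _ _ _).1 huv
    exact (hadj _ _ _).2 ⟨he, hlt.trans htt⟩
  have hreach : ∀ t u v, ∀ h : s(u, v) ∈ (reducedWeightGraph w a).edgeSet,
      (H t).Reachable u v ↔ x ⟨s(u, v), h⟩ ≤ t := by
    refine fun t u v h => ⟨fun hr => ?_, fun ht => ((hadj _ _ _).2 ⟨h, ht⟩).reachable⟩
    by_contra! hlt
    refine hx u v h (hr.mono fun p q hpq => ?_)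
    obtain ⟨he, hle⟩ := (hadj _ _ _).1 hpq
    exact lowGraph_adj.2 ⟨he, hle.trans_lt hlt⟩
  set fam : ℝ → Finset (Finset (Fin n)) := fun t =>
    (Finset.univ.image (componentSet (H t))).filter fun I => 1 < I.card with hfam
  set c : Finset (Fin n) → ℝ := ∑ t ∈ T, g t • ∑ I ∈ fam t, Pi.single I 1 with hc
  have hsupp : ∀ I ∈ supp c, ∃ t ∈ T, I ∈ fam t := by
    intro I hI
    by_contra! hI'
    refine mem_supp.1 hI ?_
    rw [hc, Finset.sum_apply]
    refine Finset.sum_eq_zero fun t ht => ?_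
    rw [Pi.smul_apply, Finset.sum_apply, Finset.sum_eq_zero, smul_zero]
    intro J hJ
    refine Pi.single_eq_of_ne (fun he => hI' t ht ?_) _
    rwa [he]
  refine ⟨c, ⟨fun I => ?_, fun I hI => ?_, fun I hI J hJ => ?_⟩, - x e₀, fun ⟨e, he⟩ => ?_⟩
  · rw [hc, Finset.sum_apply]
    refine Finset.sum_nonneg fun t ht => ?_
    rw [Pi.smul_apply, Finset.sum_apply]
    refine mul_nonneg (hg t ht) (Finset.sum_nonneg fun J _ => ?_)
    rw [Pi.single_apply]
    split_ifs <;> simp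
  · obtain ⟨t, ht, hIt⟩ := hsupp I hI
    obtain ⟨hk, hcard⟩ := Finset.mem_filter.1 hIt
    obtain ⟨k, -, rfl⟩ := Finset.mem_image.1 hk
    have haI : a ∉ componentSet (H t) k := notMem_componentSet
    refine h.adm_of_big hpos hle ha ⟨haI, hcard, ?_⟩ fun heq => ?_
    · obtain ⟨l, hl, hlk⟩ := Finset.exists_mem_ne hcard k.1
      have hla : l ∈ ({a}ᶜ : Set (Fin n)) := fun h => haI (h ▸ hl : a ∈ _)
      have hr : (H t).Reachable k ⟨l, hla⟩ := mem_componentSet.1 hl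
      -- a component with more than one vertex contains an edge, and edges have a heavy end
      rw [SimpleGraph.reachable_iff_reflTransGen] at hr
      obtain ⟨m, hm, -⟩ := hr.cases_head.resolve_left fun h => hlk (congrArg Subtype.val h).symm
      have hmem : m.1 ∈ componentSet (H t) k := mem_componentSet.2 hm.reachable
      obtain ⟨he, -⟩ := (hadj _ _ _).1 hm
      rcases ((h.adj_iff hpos).1 he).2 with h1 | h1
      · exact ⟨k, mem_componentSet.2 (SimpleGraph.Reachable.refl k), h1⟩
      · exact ⟨m, hmem, h1⟩
    · obtain ⟨e, he⟩ := e₀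
      induction e using Sym2.ind with
      | _ u v =>
      have hmem : ∀ u : Others a, (H t).Reachable k u := fun u =>
        mem_componentSet.1 (heq ▸ Finset.mem_erase.2 ⟨u.2, Finset.mem_univ _⟩)
      exact absurd ((hreach t u v he).1 ((hmem u).symm.trans (hmem v))) (not_le.2 (hT t ht))
  · obtain ⟨t, -, hIt⟩ := hsupp I hI
    obtain ⟨t', -, hJt⟩ := hsupp J hJ
    obtain ⟨k, -, rfl⟩ := Finset.mem_image.1 (Finset.mem_filter.1 hIt).1
    obtain ⟨l, -, rfl⟩ := Finset.mem_image.1 (Finset.mem_filter.1 hJt).1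
    rcases le_total t t' with htt | htt
    · exact (compat_componentSet (hmono htt) k l).elim .inl fun h => .inr (.inr h)
    · exact (compat_componentSet (hmono htt) l k).elim (fun h => .inr (.inl h))
        fun h => .inr (.inr h.symm)
  · induction e using Sym2.ind with
    | _ k l =>
    have h1 := hsum (x ⟨s(k, l), he⟩) (Finset.mem_image_of_mem _ (Finset.mem_univ _))
    rw [splitMap_apply, ← sub_eq_add_neg, ← neg_sub, ← h1, neg_inj]
    simp only [hc, Finset.sum_apply, Pi.smul_apply, smul_eq_mul]
    rw [Finset.sum_comm, Finset.sum_filter]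
    refine Finset.sum_congr rfl fun t _ => ?_
    rw [← Finset.mul_sum, Finset.sum_comm]
    simp only [Pi.single_apply]
    have h2 : ∀ J ∈ fam t, ∑ I ∈ Finset.univ.filter (fun I : Finset (Fin n) => k.1 ∈ I ∧ l.1 ∈ I),
        (if I = J then (1 : ℝ) else 0) = if k.1 ∈ J ∧ l.1 ∈ J then 1 else 0 := by
      intro J _
      simp
    rw [Finset.sum_congr rfl h2]
    have hkl : k.1 ≠ l.1 := fun h => ((SimpleGraph.mem_edgeSet _).1 he).ne (Subtype.ext h)
    by_cases hr : (H t).Reachable k l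
    · rw [if_pos ((hreach t k l he).1 hr), Finset.sum_eq_single (componentSet (H t) k)]
      · rw [if_pos ⟨mem_componentSet.2 (SimpleGraph.Reachable.refl k), mem_componentSet.2 hr⟩,
          mul_one]
      · intro J hJ hne
        obtain ⟨m, -, rfl⟩ := Finset.mem_image.1 (Finset.mem_filter.1 hJ).1
        exact if_neg fun h => hne (componentSet_eq_of_mem h.1)
      · intro hn
        have hc1 : 1 < (componentSet (H t) k).card := Finset.one_lt_card.2 ⟨k.1,
          mem_componentSet.2 (SimpleGraph.Reachable.refl k), l.1, mem_componentSet.2 hr, hkl⟩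
        refine absurd ?_ hn
        rw [hfam]
        exact Finset.mem_filter.2 ⟨Finset.mem_image_of_mem _ (Finset.mem_univ _), hc1⟩
    · rw [if_neg fun h => hr ((hreach t k l he).2 h), Finset.sum_eq_zero, mul_zero]
      intro J hJ
      obtain ⟨m, -, rfl⟩ := Finset.mem_image.1 (Finset.mem_filter.1 hJ).1
      exact if_neg fun h => hr ((mem_componentSet.1 h.1).symm.trans (mem_componentSet.1 h.2))

end

section

/-! ### Fans spanned by laminar families -/

section LamCone

variable {n : ℕ} {w : Fin n → ℚ} {r : Fin n} {V : Type*} [AddCommGroup V] [Module ℝ V]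
  {ψ : (Finset (Fin n) → ℝ) →ₗ[ℝ] V} {𝓛 𝓜 : Finset (Finset (Fin n))}

/-- The image of the cone of a laminar family under a linear map of the split coordinates. -/
def lamCone (ψ : (Finset (Fin n) → ℝ) →ₗ[ℝ] V) (𝓛 : Finset (Finset (Fin n))) :
    PointedCone ℝ V :=
  PointedCone.hull ℝ ((fun I => ψ (Pi.single I 1)) '' (𝓛 : Set (Finset (Fin n))))

lemma single_mem_lamCone {I : Finset (Fin n)} (hI : I ∈ 𝓛) : ψ (Pi.single I 1) ∈ lamCone ψ 𝓛 :=
  Submodule.subset_span ⟨I, hI, rfl⟩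

lemma eq_sum_single (c : Finset (Fin n) → ℝ) (h : supp c ⊆ 𝓛) :
    c = ∑ I ∈ 𝓛, c I • Pi.single I (1 : ℝ) := by
  funext J
  rw [Finset.sum_apply]
  by_cases hJ : J ∈ 𝓛
  · rw [Finset.sum_eq_single J]
    · simp
    · intro I _ hne
      simp [Pi.single_eq_of_ne hne.symm]
    · exact fun hn => absurd hJ hn
  · rw [Finset.sum_eq_zero]
    · exact notMem_supp.1 fun h' => hJ (h h')
    · intro I hI
      simp [Pi.single_eq_of_ne (show J ≠ I by rintro rfl; exact hJ hI)]

lemma supp_add_subset {c d : Finset (Fin n) → ℝ} (hc : supp c ⊆ 𝓛) (hd : supp d ⊆ 𝓛) :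
    supp (c + d) ⊆ 𝓛 := by
  intro I hI
  by_contra h
  refine mem_supp.1 hI ?_
  rw [Pi.add_apply, notMem_supp.1 fun h' => h (hc h'), notMem_supp.1 fun h' => h (hd h'), add_zero]

lemma supp_smul_subset {c : Finset (Fin n) → ℝ} (t : ℝ) (hc : supp c ⊆ 𝓛) :
    supp (t • c) ⊆ 𝓛 := by
  intro I hI
  by_contra h
  refine mem_supp.1 hI ?_
  rw [Pi.smul_apply, notMem_supp.1 fun h' => h (hc h'), smul_zero]

lemma mem_lamCone {x : V} :
    x ∈ lamCone ψ 𝓛 ↔ ∃ c : Finset (Fin n) → ℝ, (∀ I, 0 ≤ c I) ∧ supp c ⊆ 𝓛 ∧ ψ c = x := by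
  constructor
  · intro hx
    induction hx using Submodule.span_induction with
    | mem x hx =>
      obtain ⟨I, hI, rfl⟩ := hx
      refine ⟨Pi.single I 1, fun J => ?_, ?_, rfl⟩
      · rw [Pi.single_apply]
        split_ifs <;> norm_num
      · rw [supp_single]
        exact Finset.singleton_subset_iff.2 hI
    | zero => exact ⟨0, fun _ => le_rfl, by simp [supp], map_zero _⟩
    | add x y _ _ hx hy =>
      obtain ⟨c, hc, hc', rfl⟩ := hx
      obtain ⟨d, hd, hd', rfl⟩ := hy
      exact ⟨c + d, fun I => add_nonneg (hc I) (hd I), supp_add_subset hc' hd', map_add _ _ _⟩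
    | smul t x _ hx =>
      obtain ⟨c, hc, hc', rfl⟩ := hx
      exact ⟨(t : ℝ) • c, fun I => mul_nonneg t.2 (hc I), supp_smul_subset _ hc', map_smul _ _ _⟩
  · rintro ⟨c, hc, hs, rfl⟩
    rw [eq_sum_single c hs, map_sum]
    refine (lamCone ψ 𝓛).sum_mem fun I hI => ?_
    rw [map_smul]
    exact (lamCone ψ 𝓛).smul_mem (hc I) (single_mem_lamCone hI)

lemma mem_lamCone_of_isLam (h𝓛 : IsLam w r 𝓛) {x : V} :
    x ∈ lamCone ψ 𝓛 ↔ ∃ c, IsCoord w r c ∧ supp c ⊆ 𝓛 ∧ ψ c = x := by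
  rw [mem_lamCone]
  exact ⟨fun ⟨c, h1, h2, h3⟩ => ⟨c, ⟨h1, h𝓛.mono h2⟩, h2, h3⟩,
    fun ⟨c, h1, h2, h3⟩ => ⟨c, h1.1, h2, h3⟩⟩

lemma lamCone_mono (h : 𝓛 ⊆ 𝓜) : lamCone ψ 𝓛 ≤ lamCone ψ 𝓜 :=
  Submodule.span_mono (Set.image_mono (by exact_mod_cast h))

lemma linSpan_lamCone : linSpan (lamCone ψ 𝓛) = lamSpan ψ 𝓛 := by
  rw [lamCone, linSpan_hull]
  refine le_antisymm (Submodule.span_le.2 ?_) ?_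
  · rintro _ ⟨I, hI, rfl⟩
    exact mem_lamSpan (by rw [supp_single]; exact Finset.singleton_subset_iff.2 hI)
  · rintro _ ⟨x, rfl⟩
    rw [LinearMap.comp_apply, eq_sum_single _ (supp_ext0_subset x), map_sum]
    refine Submodule.sum_mem _ fun I hI => ?_
    rw [map_smul]
    exact Submodule.smul_mem _ _ (Submodule.subset_span ⟨I, hI, rfl⟩)

lemma coneDim_lamCone (hψ : InjOn ψ {c | IsCoord w r c}) (h𝓛 : IsLam w r 𝓛) :
    coneDim (lamCone ψ 𝓛) = 𝓛.card := by
  rw [coneDim, linSpan_lamCone, finrank_lamSpan hψ h𝓛]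

lemma isCoord_single {I : Finset (Fin n)} (hI : Adm w r I) : IsCoord w r (Pi.single I 1) := by
  refine ⟨fun J => ?_, ?_, ?_⟩
  · rw [Pi.single_apply]
    split_ifs <;> norm_num
  · simp only [supp_single, Finset.mem_singleton, forall_eq]
    exact hI
  · simp only [supp_single, Finset.mem_singleton, forall_eq]
    exact .inl subset_rfl

lemma lamCone_le_iff (hψ : InjOn ψ {c | IsCoord w r c}) (h𝓛 : IsLam w r 𝓛) (h𝓜 : IsLam w r 𝓜) :
    lamCone ψ 𝓛 ≤ lamCone ψ 𝓜 ↔ 𝓛 ⊆ 𝓜 := by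
  refine ⟨fun h I hI => ?_, lamCone_mono⟩
  obtain ⟨c, hc, hs, he⟩ := (mem_lamCone_of_isLam h𝓜).1 (h (single_mem_lamCone hI))
  have h1 := hψ hc (isCoord_single (h𝓛.1 I hI)) he
  exact hs (by rw [h1, supp_single]; exact Finset.mem_singleton_self I)

lemma lamCone_inj (hψ : InjOn ψ {c | IsCoord w r c}) (h𝓛 : IsLam w r 𝓛) (h𝓜 : IsLam w r 𝓜)
    (h : lamCone ψ 𝓛 = lamCone ψ 𝓜) : 𝓛 = 𝓜 :=
  Finset.Subset.antisymm ((lamCone_le_iff hψ h𝓛 h𝓜).1 h.le) ((lamCone_le_iff hψ h𝓜 h𝓛).1 h.ge)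

lemma exists_lamCone_of_isFaceOf {F : PointedCone ℝ V} (hF : F.IsFaceOf (lamCone ψ 𝓛)) :
    ∃ 𝓜 ⊆ 𝓛, F = lamCone ψ 𝓜 := by
  classical
  refine ⟨𝓛.filter fun I => ψ (Pi.single I 1) ∈ F, Finset.filter_subset _ _, le_antisymm ?_ ?_⟩
  · intro x hx
    obtain ⟨c, hc, hs, rfl⟩ := mem_lamCone.1 (hF.le hx)
    refine mem_lamCone.2 ⟨c, hc, fun I hI => Finset.mem_filter.2 ⟨hs hI, ?_⟩, rfl⟩
    have hpos : 0 < c I := (hc I).lt_of_ne' (mem_supp.1 hI)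
    refine hF.mem_of_smul_add_mem (single_mem_lamCone (hs hI))
      (y := ψ (Function.update c I 0)) (mem_lamCone.2 ⟨_, fun J => ?_, fun J hJ => hs ?_, rfl⟩)
      hpos ?_
    · by_cases h : J = I
      · simp [h]
      · simpa [Function.update_of_ne h] using hc J
    · refine mem_supp.2 fun h0 => mem_supp.1 hJ ?_
      by_cases h : J = I
      · simp [h]
      · simpa [Function.update_of_ne h] using h0
    · rw [← map_smul, ← map_add]
      convert hx using 2
      funext J
      by_cases h : J = I
      · simp [h]
      · simp [h]
  · refine Submodule.span_le.2 ?_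
    rintro _ ⟨I, hI, rfl⟩
    exact (Finset.mem_filter.1 hI).2

lemma lamCone_isFaceOf (hψ : InjOn ψ {c | IsCoord w r c}) (h𝓛 : IsLam w r 𝓛) (h : 𝓜 ⊆ 𝓛) :
    (lamCone ψ 𝓜).IsFaceOf (lamCone ψ 𝓛) := by
  refine ⟨lamCone_mono h, ?_⟩
  intro x y t hx hy ht hxy
  obtain ⟨c, hc, hcs, rfl⟩ := mem_lamCone.1 hx
  obtain ⟨d, hd, hds, rfl⟩ := mem_lamCone.1 hy
  obtain ⟨e, he, hes, heq⟩ := mem_lamCone.1 hxy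
  have h1 : e = t • c + d := by
    refine hψ ⟨he, h𝓛.mono (hes.trans h)⟩ ⟨fun I => ?_, h𝓛.mono
      (supp_add_subset (supp_smul_subset t hcs) hds)⟩ ?_
    · exact add_nonneg (mul_nonneg ht.le (hc I)) (hd I)
    · rw [heq, map_add, map_smul]
  refine mem_lamCone.2 ⟨c, hc, fun I hI => hes (mem_supp.2 ?_), rfl⟩
  have h2 : 0 < c I := (hc I).lt_of_ne' (mem_supp.1 hI)
  rw [h1]
  exact (add_pos_of_pos_of_nonneg (mul_pos ht h2) (hd I)).ne'

lemma lamCone_inf (hψ : InjOn ψ {c | IsCoord w r c}) (h𝓛 : IsLam w r 𝓛) (h𝓜 : IsLam w r 𝓜) :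
    lamCone ψ 𝓛 ⊓ lamCone ψ 𝓜 = lamCone ψ (𝓛 ∩ 𝓜) := by
  refine le_antisymm (fun x hx => ?_)
    (le_inf (lamCone_mono Finset.inter_subset_left) (lamCone_mono Finset.inter_subset_right))
  obtain ⟨c, hc, hcs, rfl⟩ := (mem_lamCone_of_isLam h𝓛).1 hx.1
  obtain ⟨d, hd, hds, heq⟩ := (mem_lamCone_of_isLam h𝓜).1 hx.2
  rw [hψ hd hc heq] at hds
  exact mem_lamCone.2 ⟨c, hc.1, Finset.subset_inter hcs hds, rfl⟩

/-- The cones of the laminar families form a tropical fan if the families can be extended to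
families of the same size, the lattice points are those with integral split coordinates, and
for each family that lacks one member the rays of all possible new members add up to a
vector in its span. -/
lemma isTropicalFan_lamCone {N : Submodule ℤ V} {d : ℕ} (hψ : InjOn ψ {c | IsCoord w r c})
    (hN : IsLattice N)
    (hint : ∀ 𝓛, IsLam w r 𝓛 → ∀ c, supp c ⊆ 𝓛 → (ψ c ∈ N ↔ ∀ I, ∃ k : ℤ, c I = k))
    (hpure : ∀ 𝓛, IsLam w r 𝓛 → ∃ 𝓜, IsLam w r 𝓜 ∧ 𝓛 ⊆ 𝓜 ∧ 𝓜.card = d)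
    (hbal : ∀ 𝓛, IsLam w r 𝓛 → 𝓛.card + 1 = d →
      ∑ᶠ J ∈ {J | J ∉ 𝓛 ∧ IsLam w r (insert J 𝓛)}, ψ (Pi.single J 1) ∈ lamSpan ψ 𝓛) :
    IsTropicalFan N {σ | ∃ 𝓛, IsLam w r 𝓛 ∧ σ = lamCone ψ 𝓛} d (fun _ => 1) := by
  classical
  have hray : ∀ I, Adm w r I → ψ (Pi.single I 1) ∈ N := by
    intro I hI
    refine (hint {I} ?_ _ supp_single.subset).2 fun J => ?_
    · rw [← supp_single]
      exact (isCoord_single hI).2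
    · rw [Pi.single_apply]
      split_ifs
      exacts [⟨1, by simp⟩, ⟨0, by simp⟩]
  refine ⟨hN, ?_, ⟨_, ∅, ⟨by simp, by simp⟩, rfl⟩, ?_, ?_, ?_, ?_, fun _ _ _ => one_pos, ?_⟩
  · exact (Set.finite_range (lamCone ψ)).subset fun σ ⟨𝓛, _, h⟩ => ⟨𝓛, h.symm⟩
  · rintro _ ⟨𝓛, h𝓛, rfl⟩
    refine ⟨_, (Set.toFinite _).image _, ?_, rfl⟩
    rintro _ ⟨I, hI, rfl⟩
    exact hray I (h𝓛.1 I hI)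
  · rintro _ ⟨𝓛, h𝓛, rfl⟩ F hF
    obtain ⟨𝓜, h𝓜, rfl⟩ := exists_lamCone_of_isFaceOf hF
    exact ⟨𝓜, h𝓛.mono h𝓜, rfl⟩
  · rintro _ ⟨𝓛, h𝓛, rfl⟩ _ ⟨𝓜, h𝓜, rfl⟩
    rw [lamCone_inf hψ h𝓛 h𝓜]
    exact lamCone_isFaceOf hψ h𝓛 Finset.inter_subset_left
  · rintro _ ⟨𝓛, h𝓛, rfl⟩
    obtain ⟨𝓜, h𝓜, hsub, hcard⟩ := hpure 𝓛 h𝓛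
    exact ⟨_, ⟨𝓜, h𝓜, rfl⟩, lamCone_mono hsub, (coneDim_lamCone hψ h𝓜).trans hcard⟩
  · rintro _ ⟨𝓛, h𝓛, rfl⟩ hdim
    rw [coneDim_lamCone hψ h𝓛] at hdim
    set A : Set (Finset (Fin n)) := {J | J ∉ 𝓛 ∧ IsLam w r (insert J 𝓛)} with hA
    have hinj : ∀ {J K}, J ∈ A → K ∈ A → lamCone ψ (insert J 𝓛) = lamCone ψ (insert K 𝓛) →
        J = K := by
      intro J K hJ hK h
      have h1 := lamCone_inj hψ hJ.2 hK.2 h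
      exact (Finset.mem_insert.1 (h1 ▸ Finset.mem_insert_self J 𝓛)).resolve_right hJ.1
    have hset : {σ | (∃ 𝓛, IsLam w r 𝓛 ∧ σ = lamCone ψ 𝓛) ∧ coneDim σ = d ∧ lamCone ψ 𝓛 ≤ σ} =
        (fun J => lamCone ψ (insert J 𝓛)) '' A := by
      ext σ
      constructor
      · rintro ⟨⟨𝓜, h𝓜, rfl⟩, hd, hle⟩
        rw [coneDim_lamCone hψ h𝓜] at hd
        have hsub := (lamCone_le_iff hψ h𝓛 h𝓜).1 hle
        obtain ⟨J, hJ, rfl⟩ := (Finset.covBy_iff_exists_insert).1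
          (Finset.covBy_iff_card_sdiff_eq_one.2 ⟨hsub, by
            rw [Finset.card_sdiff_of_subset hsub]
            omega⟩)
        exact ⟨J, ⟨hJ, h𝓜⟩, rfl⟩
      · rintro ⟨J, hJ, rfl⟩
        refine ⟨⟨_, hJ.2, rfl⟩, ?_, lamCone_mono (Finset.subset_insert _ _)⟩
        rw [coneDim_lamCone hψ hJ.2, Finset.card_insert_of_notMem hJ.1, hdim]
    -- the primitive normal vector is the ray of the new member
    obtain ⟨u, hu⟩ : ∃ u : PointedCone ℝ V → V, ∀ J ∈ A,
        u (lamCone ψ (insert J 𝓛)) = ψ (Pi.single J 1) := by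
      refine ⟨fun σ => if h : ∃ J ∈ A, lamCone ψ (insert J 𝓛) = σ then
        ψ (Pi.single h.choose 1) else 0, fun J hJ => ?_⟩
      have h : ∃ K ∈ A, lamCone ψ (insert K 𝓛) = lamCone ψ (insert J 𝓛) := ⟨J, hJ, rfl⟩
      simp only
      rw [dif_pos h, hinj h.choose_spec.1 hJ h.choose_spec.2]
    refine ⟨u, fun σ hσ hd hle => ?_, ?_⟩
    · obtain ⟨J, hJ, rfl⟩ : σ ∈ (fun J => lamCone ψ (insert J 𝓛)) '' A := hset ▸ ⟨hσ, hd, hle⟩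
      simp only
      rw [hu J hJ]
      refine ⟨hray J (hJ.2.1 J (Finset.mem_insert_self _ _)),
        single_mem_lamCone (Finset.mem_insert_self _ _), fun x hxN hx => ?_⟩
      rw [linSpan_lamCone] at hx
      obtain ⟨y, rfl⟩ := hx
      rw [LinearMap.comp_apply] at hxN ⊢
      set c := ext0 (insert J 𝓛) y
      have hcs : supp c ⊆ insert J 𝓛 := supp_ext0_subset y
      obtain ⟨k, hk⟩ := (hint _ hJ.2 c hcs).1 hxN J
      refine ⟨k, ?_⟩
      rw [linSpan_lamCone, ← Int.cast_smul_eq_zsmul ℝ, ← map_smul, ← map_sub]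
      refine mem_lamSpan fun I hI => ?_
      by_contra hI𝓛
      refine mem_supp.1 hI ?_
      by_cases hIJ : I = J
      · simp [hIJ, hk]
      · have : I ∉ supp c := fun h => (Finset.mem_insert.1 (hcs h)).elim hIJ hI𝓛
        simp [hIJ, notMem_supp.1 this]
    · have h2 := hbal 𝓛 h𝓛 hdim
      rw [linSpan_lamCone]
      simp only [Set.mem_ofPred_eq, one_smul]
      convert h2 using 1
      have h3 := finsum_mem_image (f := u) (g := fun J => lamCone ψ (insert J 𝓛)) (s := A)
        fun J hJ K hK h => hinj hJ hK h
      rw [← hset] at h3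
      exact h3.trans (finsum_mem_congr rfl hu)

lemma support_lamCone :
    support {σ | ∃ 𝓛, IsLam w r 𝓛 ∧ σ = lamCone ψ 𝓛} = ψ '' {c | IsCoord w r c} := by
  ext x
  constructor
  · rintro ⟨_, ⟨𝓛, h𝓛, rfl⟩, hx⟩
    obtain ⟨c, hc, -, rfl⟩ := (mem_lamCone_of_isLam h𝓛).1 hx
    exact ⟨c, hc, rfl⟩
  · rintro ⟨c, hc, rfl⟩
    exact ⟨_, ⟨supp c, hc.2, rfl⟩, mem_lamCone.2 ⟨c, hc.1, subset_rfl, rfl⟩⟩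

/-- The image of the cone of a stable tree is the cone of its family of sides. -/
lemma image_cone (hpos : ∀ i, 0 < w i) (hle : ∀ i, w i ≤ 1) (hsum : 2 < ∑ i, w i)
    {φ : CurveClass n → V} (h : ∀ C : TropCurve n, C.IsStable w → φ ⟦C⟧ = ψ (C.coord r))
    {T : MarkedTree n} (hT : T.IsStable w) : φ '' T.cone = lamCone ψ (T.sides r) := by
  have hw : ∀ i, 0 ≤ w i := fun i => (hpos i).le
  ext x
  rw [SetLike.mem_coe, mem_lamCone_of_isLam (hT.isLam_sides hw)]
  constructor
  · rintro ⟨y, hy, rfl⟩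
    obtain ⟨C, hC, hs, rfl⟩ := (mem_cone_iff (r := r) hpos hle hsum hT).1 hy
    exact ⟨_, TropCurve.isCoord_coord hC hw, hs, (h C hC).symm⟩
  · rintro ⟨c, hc, hs, rfl⟩
    obtain ⟨C, hC, rfl⟩ := exists_curve hpos hle hsum hc
    exact ⟨_, (mem_cone_iff hpos hle hsum hT).2 ⟨C, hC, hs, rfl⟩, h C hC⟩

/-- A linear map of the split coordinates that is injective on those of the stable curves embeds
the moduli space, and the underlying cone complex of the fan of all cones of laminar families is
the moduli space. -/
lemma isUnderlyingComplex_lamCone (hpos : ∀ i, 0 < w i) (hle : ∀ i, w i ≤ 1)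
    (hsum : 2 < ∑ i, w i) {φ : CurveClass n → V} {N : Submodule ℤ V}
    (h : ∀ C : TropCurve n, C.IsStable w → φ ⟦C⟧ = ψ (C.coord r))
    (hψ : InjOn ψ {c | IsCoord w r c})
    (hint : ∀ 𝓛, IsLam w r 𝓛 → ∀ c, supp c ⊆ 𝓛 → (ψ c ∈ N ↔ ∀ I, ∃ k : ℤ, c I = k)) :
    IsUnderlyingComplex w φ N {σ | ∃ 𝓛, IsLam w r 𝓛 ∧ σ = lamCone ψ 𝓛} := by
  have hw : ∀ i, 0 ≤ w i := fun i => (hpos i).le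
  refine ⟨⟨?_, fun T hT => ⟨ψ ∘ₗ T.push r, fun ℓ D hℓ hD => ?_⟩⟩, fun T hT => ?_, ?_,
    fun C hC => ?_⟩
  · rintro _ ⟨C, hC, rfl⟩ _ ⟨D, hD, rfl⟩ hCD
    rw [h C hC, h D hD] at hCD
    exact class_eq_of_coord_eq (hC.one hle) (hD.one hle)
      (hψ (TropCurve.isCoord_coord hC hw) (TropCurve.isCoord_coord hD hw) hCD)
  · obtain ⟨C, hC, hC', hC''⟩ := exists_contraction (r := r) hpos hle hsum hT hℓ
    rw [show (⟦D⟧ : CurveClass n) = ⟦C⟧ from Quotient.sound (hD.iso hC''), h C hC, hC']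
    rfl
  · exact ⟨_, ⟨_, hT.isLam_sides hw, rfl⟩, (image_cone hpos hle hsum h hT).symm⟩
  · rintro _ ⟨𝓛, h𝓛, rfl⟩
    obtain ⟨T, hT, rfl⟩ := exists_tree hpos hle hsum h𝓛
    exact ⟨T, hT, (image_cone hpos hle hsum h hT).symm⟩
  · rw [h C hC, hint _ (TropCurve.isCoord_coord hC hw).2 _ subset_rfl]
    constructor
    · intro hk e
      obtain ⟨k, hk⟩ := hk (C.sideSet r e)
      exact ⟨k, (hC.push_sideSet hw C.len e).symm.trans hk⟩
    · intro hk I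
      by_cases hI : I ∈ C.sides r
      · obtain ⟨e, rfl⟩ := MarkedTree.mem_sides.1 hI
        obtain ⟨k, hk⟩ := hk e
        exact ⟨k, (hC.push_sideSet hw C.len e).trans hk⟩
      · exact ⟨0, by rw [Int.cast_zero]; exact MarkedTree.push_of_notMem C.len hI⟩

end LamCone

end

section

/-! ### The lattice of the ambient space -/

section EdgeLattice

variable {W : Type*} {G : SimpleGraph W}

lemma mem_edgeLattice {x : EdgeSpace G} : x ∈ edgeLattice G ↔
    ∃ z : G.edgeSet → ℝ, (∀ e, ∃ k : ℤ, z e = k) ∧ (allOnes _).mkQ z = x := by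
  constructor
  · rintro ⟨z, hz, rfl⟩
    refine ⟨z, ?_, rfl⟩
    induction hz using Submodule.span_induction with
    | mem z hz => exact hz
    | zero => exact fun e => ⟨0, by simp⟩
    | add y z _ _ hy hz =>
      intro e
      obtain ⟨k, hk⟩ := hy e
      obtain ⟨l, hl⟩ := hz e
      exact ⟨k + l, by simp [hk, hl]⟩
    | smul t z _ hz =>
      intro e
      obtain ⟨k, hk⟩ := hz e
      exact ⟨t * k, by simp [hk]⟩
  · rintro ⟨z, hz, rfl⟩
    exact ⟨z, Submodule.subset_span hz, rfl⟩

lemma mem_allOnes {E : Type*} {x : E → ℝ} : x ∈ allOnes E ↔ ∃ t : ℝ, ∀ e, x e = t := by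
  rw [allOnes, Submodule.mem_span_singleton]
  refine exists_congr fun t => ?_
  rw [funext_iff]
  refine forall_congr' fun e => ?_
  rw [Pi.smul_apply, smul_eq_mul, mul_one, eq_comm]

/-- The unit vectors of all edges but one form a basis of the lattice. -/
lemma isLattice_edgeLattice [Finite G.edgeSet] [Nonempty G.edgeSet] :
    IsLattice (edgeLattice G) := by
  classical
  have := Fintype.ofFinite G.edgeSet
  obtain ⟨e₀⟩ := ‹Nonempty G.edgeSet›
  let f : (G.edgeSet → ℝ) →ₗ[ℝ] ({e : G.edgeSet // e ≠ e₀} → ℝ) :=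
    LinearMap.funLeft ℝ ℝ Subtype.val - LinearMap.funLeft ℝ ℝ fun _ => e₀
  have hf : ∀ x e, f x e = x e.1 - x e₀ := fun _ _ => rfl
  have hker : allOnes G.edgeSet = LinearMap.ker f := by
    ext x
    rw [mem_allOnes, LinearMap.mem_ker]
    constructor
    · rintro ⟨t, ht⟩
      funext e
      rw [hf, ht, ht, sub_self, Pi.zero_apply]
    · refine fun h => ⟨x e₀, fun e => ?_⟩
      by_cases he : e = e₀
      · rw [he]
      · exact sub_eq_zero.1 (congrFun h ⟨e, he⟩)
  have hsurj : Function.Surjective f := by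
    intro y
    refine ⟨fun e => if h : e = e₀ then 0 else y ⟨e, h⟩, funext fun e => ?_⟩
    rw [hf, dif_neg e.2, dif_pos rfl, sub_zero]
  let g : EdgeSpace G ≃ₗ[ℝ] ({e : G.edgeSet // e ≠ e₀} → ℝ) :=
    (Submodule.quotEquivOfEq _ _ hker).trans (f.quotKerEquivOfSurjective hsurj)
  have hg : ∀ x, g ((allOnes _).mkQ x) = f x := fun _ => rfl
  let b := Module.Basis.ofEquivFun g
  refine ⟨_, b.reindex (Fintype.equivFin _), ?_⟩
  rw [Module.Basis.range_reindex]
  ext x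
  rw [Module.Basis.mem_span_iff_repr_mem ℤ b x, mem_edgeLattice]
  obtain ⟨y, rfl⟩ := (allOnes G.edgeSet).mkQ_surjective x
  have hr : ∀ e, b.repr ((allOnes _).mkQ y) e = y e.1 - y e₀ := fun _ => rfl
  simp only [hr]
  constructor
  · rintro ⟨z, hz, hzy⟩ e
    obtain ⟨k, hk⟩ := hz e.1
    obtain ⟨l, hl⟩ := hz e₀
    refine ⟨k - l, ?_⟩
    have h1 : f z = f y := by rw [← hg, hzy, hg]
    have h2 := congrFun h1 e
    rw [hf, hf, hk, hl] at h2
    simpa using h2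
  · intro h
    refine ⟨fun e => y e - y e₀, fun e => ?_, ?_⟩
    · by_cases he : e = e₀
      · exact ⟨0, by simp [he]⟩
      · obtain ⟨k, hk⟩ := h ⟨e, he⟩
        exact ⟨k, hk.symm⟩
    · rw [← sub_eq_zero, ← map_sub, Submodule.mkQ_apply, Submodule.Quotient.mk_eq_zero]
      exact mem_allOnes.2 ⟨- y e₀, fun e => by simp⟩

end EdgeLattice

/-! ### The embedding by distances in split coordinates -/

variable {n : ℕ} {w : Fin n → ℚ} {a : Fin n}

open Classical in
/-- The linear map that takes the split coordinates of a curve to its distances: the distance of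
two ends is the sum of the coordinates at the sets that contain exactly one of them. -/
def splitDist (n : ℕ) : (Finset (Fin n) → ℝ) →ₗ[ℝ] DistSpace n :=
  (LinearMap.range (pairSum n)).mkQ ∘ₗ Fintype.linearCombination ℝ
    fun I e => if (∃ i ∈ e.1, i ∈ I) ∧ ∃ i ∈ e.1, i ∉ I then (1 : ℝ) else 0

lemma distMap_eq_splitDist (r : Fin n) (C : TropCurve n) :
    distMap n ⟦C⟧ = splitDist n (C.coord r) := by
  classical
  change (LinearMap.range (pairSum n)).mkQ C.distVec = _
  rw [splitDist, LinearMap.comp_apply]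
  congr 1
  funext ⟨e, he⟩
  induction e using Sym2.ind with
  | _ i j =>
  have h1 : ∀ I : Finset (Fin n), ((∃ k ∈ s(i, j), k ∈ I) ∧ ∃ k ∈ s(i, j), k ∉ I) ↔
      ¬ (i ∈ I ↔ j ∈ I) := by
    intro I
    simp only [Sym2.mem_iff, exists_eq_or_imp, exists_eq_left]
    tauto
  change C.dist i j = _
  rw [Fintype.linearCombination_apply, Finset.sum_apply, C.dist_eq_sum, Finset.sum_filter]
  simp only [Pi.smul_apply, smul_eq_mul, h1, TropCurve.coord, MarkedTree.push_apply,
    Finset.sum_mul, Finset.sum_filter, ite_mul, zero_mul]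
  rw [Finset.sum_comm]
  refine Finset.sum_congr rfl fun e _ => ?_
  rw [Finset.sum_ite_eq, if_pos (Finset.mem_univ _)]
  simp only [MarkedTree.mem_sideSet, mul_ite, mul_one, mul_zero]
  refine if_congr ?_ rfl rfl
  have h3 := sep_xor C.isTree e.1 (C.mark r) (C.mark i) (C.mark j)
  tauto

/-- The linear map of the split coordinates that corresponds to the projection `pr_w`. -/
def splitProj (w : Fin n → ℚ) (a : Fin n) :
    (Finset (Fin n) → ℝ) →ₗ[ℝ] EdgeSpace (reducedWeightGraph w a) :=
  (allOnes _).mkQ ∘ₗ splitMap (reducedWeightGraph w a)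

lemma splitProj_apply (c : Finset (Fin n) → ℝ) :
    splitProj w a c = (allOnes _).mkQ (splitMap (reducedWeightGraph w a) c) := rfl

lemma splitProj_eq_iff {c d : Finset (Fin n) → ℝ} : splitProj w a c = splitProj w a d ↔
    ∃ t : ℝ, ∀ e, splitMap (reducedWeightGraph w a) c e =
      splitMap (reducedWeightGraph w a) d e + t := by
  rw [splitProj_apply, splitProj_apply, ← sub_eq_zero, ← map_sub, Submodule.mkQ_apply,
    Submodule.Quotient.mk_eq_zero, mem_allOnes]
  refine exists_congr fun t => forall_congr' fun e => ?_
  rw [Pi.sub_apply, sub_eq_iff_eq_add']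

lemma map_lamCone {V V' : Type*} [AddCommGroup V] [Module ℝ V] [AddCommGroup V'] [Module ℝ V']
    (f : V →ₗ[ℝ] V') (ψ : (Finset (Fin n) → ℝ) →ₗ[ℝ] V) (𝓛 : Finset (Finset (Fin n))) :
    PointedCone.map f (lamCone ψ 𝓛) = lamCone (f ∘ₗ ψ) 𝓛 := by
  ext x
  simp only [PointedCone.mem_map, mem_lamCone]
  constructor
  · rintro ⟨_, ⟨c, hc, hs, rfl⟩, rfl⟩
    exact ⟨c, hc, hs, rfl⟩
  · rintro ⟨c, hc, hs, rfl⟩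
    exact ⟨_, ⟨c, hc, hs, rfl⟩, rfl⟩

lemma two_lt_sum_one (hle : ∀ i, w i ≤ 1) (hsum : 2 < ∑ i, w i) :
    2 < ∑ i, (1 : Fin n → ℚ) i :=
  hsum.trans_le (Finset.sum_le_sum fun i _ => hle i)

lemma projectedFan_eq (hle : ∀ i, w i ≤ 1) (hsum : 2 < ∑ i, w i) (a : Fin n) :
    projectedFan w a = {σ | ∃ 𝓛, IsLam 1 a 𝓛 ∧ σ = lamCone (splitProj w a) 𝓛} := by
  have hsum1 := two_lt_sum_one hle hsum
  have hcone : ∀ T : MarkedTree n, T.IsStable 1 →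
      distMap n '' T.cone = lamCone (splitDist n) (T.sides a) := fun T hT =>
    image_cone (fun _ => one_pos) (fun _ => le_rfl) hsum1
      (fun C _ => distMap_eq_splitDist a C) hT
  have hmap : ∀ 𝓛, IsLam 1 a 𝓛 →
      PointedCone.map (prW w a) (lamCone (splitDist n) 𝓛) = lamCone (splitProj w a) 𝓛 := by
    intro 𝓛 h𝓛
    rw [map_lamCone]
    ext x
    rw [mem_lamCone_of_isLam h𝓛, mem_lamCone_of_isLam h𝓛]
    refine exists_congr fun c => and_congr_right fun hc => and_congr_right fun _ => ?_
    obtain ⟨C, -, rfl⟩ := exists_curve (fun _ => one_pos) (fun _ => le_rfl) hsum1 hc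
    rw [LinearMap.comp_apply, ← distMap_eq_splitDist, prW_distMap, splitProj_apply]
  ext σ
  constructor
  · rintro ⟨τ, ⟨T, hT, hτ⟩, rfl⟩
    have h𝓛 : IsLam 1 a (T.sides a) := hT.isLam_sides fun _ => zero_le_one
    refine ⟨_, h𝓛, ?_⟩
    rw [← hmap _ h𝓛]
    exact congrArg _ (SetLike.coe_injective (hτ.trans (hcone T hT)))
  · rintro ⟨𝓛, h𝓛, rfl⟩
    obtain ⟨T, hT, rfl⟩ := exists_tree (fun _ => one_pos) (fun _ => le_rfl) hsum1 h𝓛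
    exact ⟨_, ⟨T, hT, (hcone T hT).symm⟩, hmap _ h𝓛⟩

/-! ### The fan of a heavy/light weight vector -/

lemma IsHeavyLight.splitProj_eq_zero (h : IsHeavyLight w) (hpos : ∀ i, 0 < w i)
    {I : Finset (Fin n)} (hI : ∀ i ∈ I, ¬ IsHeavy w i) : splitProj w a (Pi.single I 1) = 0 := by
  rw [splitProj_apply, splitMap_single, h.negClique_eq_zero hpos hI, smul_zero, map_zero]

/-- Splits without heavy markings on one side are contracted by the projection. -/
lemma IsHeavyLight.projectedFan_eq (h : IsHeavyLight w) (hpos : ∀ i, 0 < w i)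
    (hle : ∀ i, w i ≤ 1) (hsum : 2 < ∑ i, w i) (ha : IsHeavy w a) :
    projectedFan w a = {σ | ∃ 𝓛, IsLam w a 𝓛 ∧ σ = lamCone (splitProj w a) 𝓛} := by
  classical
  rw [WeightedTrop.projectedFan_eq hle hsum]
  ext σ
  constructor
  · rintro ⟨𝓛, h𝓛, rfl⟩
    refine ⟨𝓛.filter fun I => ∃ i ∈ I, IsHeavy w i, ⟨fun I hI => ?_, fun I hI J hJ => ?_⟩, ?_⟩
    · obtain ⟨hI, hh⟩ := Finset.mem_filter.1 hI
      exact (h.adm_iff hpos hle ha).2 ⟨h𝓛.1 I hI, hh⟩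
    · exact h𝓛.2 I (Finset.mem_filter.1 hI).1 J (Finset.mem_filter.1 hJ).1
    · refine le_antisymm (Submodule.span_le.2 ?_) (lamCone_mono (Finset.filter_subset _ _))
      rintro _ ⟨I, hI, rfl⟩
      by_cases hh : ∃ i ∈ I, IsHeavy w i
      · exact single_mem_lamCone (Finset.mem_filter.2 ⟨hI, hh⟩)
      · push Not at hh
        simp only
        rw [h.splitProj_eq_zero hpos hh]
        exact Submodule.zero_mem _
  · rintro ⟨𝓛, h𝓛, rfl⟩
    exact ⟨𝓛, h𝓛.one hle, rfl⟩

lemma exists_third (hle : ∀ i, w i ≤ 1) (hsum : 2 < ∑ i, w i) (a b : Fin n) :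
    ∃ c, c ≠ a ∧ c ≠ b := by
  by_contra! hc
  have h1 : (Finset.univ : Finset (Fin n)) ⊆ {a, b} := fun c _ => by
    rw [Finset.mem_insert, Finset.mem_singleton, or_iff_not_imp_left]
    exact hc c
  have h2 := two_lt_sum_one hle hsum
  have h3 := Finset.card_le_card h1
  simp only [Pi.one_apply, Finset.sum_const, nsmul_eq_mul, mul_one] at h2
  have h4 : 2 < (Finset.univ : Finset (Fin n)).card := by exact_mod_cast h2
  have h5 := Finset.card_le_two (a := a) (b := b)
  omega

lemma big_erase (hle : ∀ i, w i ≤ 1) (hsum : 2 < ∑ i, w i) {b : Fin n} (hab : b ≠ a)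
    (hb : IsHeavy w b) : Big w a (Finset.univ.erase a) := by
  obtain ⟨c, hca, hcb⟩ := exists_third hle hsum a b
  exact ⟨by simp, Finset.one_lt_card.2 ⟨b, by simpa using hab, c, by simpa using hca, hcb.symm⟩,
    b, by simpa using hab, hb⟩

lemma splitMap_add_single_erase (G : SimpleGraph (Others a)) (c : Finset (Fin n) → ℝ) (t : ℝ)
    (e : G.edgeSet) :
    splitMap G (c + Pi.single (Finset.univ.erase a) t) e = splitMap G c e - t := by
  rw [map_add, splitMap_single, negClique_erase]
  simp [sub_eq_add_neg]

lemma IsCoord.apply_erase (hle : ∀ i, w i ≤ 1) {c : Finset (Fin n) → ℝ} (hc : IsCoord w a c) :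
    c (Finset.univ.erase a) = 0 :=
  notMem_supp.1 fun h => ((hc.one hle).2.1 _ h).ne_erase rfl

/-- The projection is injective on the moduli space of a heavy/light weight vector. -/
lemma IsHeavyLight.injOn_splitProj (h : IsHeavyLight w) (hpos : ∀ i, 0 < w i)
    (hle : ∀ i, w i ≤ 1) (ha : IsHeavy w a) (hO : Big w a (Finset.univ.erase a)) :
    InjOn (splitProj w a) {c | IsCoord w a c} := by
  intro c hc d hd hcd
  obtain ⟨t, ht⟩ := splitProj_eq_iff.1 hcd
  have h1 := (IsCoord.isExt h hpos hle ha hO hc t).eq_of_splitMap_eq h hpos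
    (IsCoord.isExt h hpos hle ha hO hd 0) (by
      funext e
      rw [splitMap_add_single_erase, splitMap_add_single_erase, ht]
      ring)
  have h2 : t = 0 := by
    have := congrFun h1 (Finset.univ.erase a)
    simpa [hc.apply_erase hle, hd.apply_erase hle] using this
  rw [h2] at h1
  exact add_right_cancel h1

lemma IsHeavyLight.splitProj_mem_edgeLattice_iff (h : IsHeavyLight w) (hpos : ∀ i, 0 < w i)
    (hle : ∀ i, w i ≤ 1) (ha : IsHeavy w a) (hO : Big w a (Finset.univ.erase a))
    {𝓛 : Finset (Finset (Fin n))} (h𝓛 : IsLam w a 𝓛) (c : Finset (Fin n) → ℝ)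
    (hs : supp c ⊆ 𝓛) :
    splitProj w a c ∈ edgeLattice (reducedWeightGraph w a) ↔ ∀ I, ∃ k : ℤ, c I = k := by
  classical
  have hint : ∀ c : Finset (Fin n) → ℝ, (∀ I, ∃ k : ℤ, c I = k) →
      splitProj w a c ∈ edgeLattice (reducedWeightGraph w a) := by
    intro c hc
    choose k hk using hc
    refine mem_edgeLattice.2 ⟨_, fun ⟨e, he⟩ => ?_, rfl⟩
    induction e using Sym2.ind with
    | _ u v =>
    rw [splitMap_apply]
    exact ⟨- ∑ I ∈ Finset.univ.filter (fun I : Finset (Fin n) => u.1 ∈ I ∧ v.1 ∈ I), k I,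
      by push_cast; simp only [hk]⟩
  refine ⟨fun hc => ?_, hint c⟩
  -- adding a large integral vector makes all coordinates nonnegative
  obtain ⟨M, hM⟩ : ∃ M : ℕ, ∀ I, - c I ≤ M := by
    obtain ⟨M, hM⟩ := exists_nat_ge (∑ I, |c I|)
    exact ⟨M, fun I => (neg_le_abs _).trans ((Finset.single_le_sum
      (f := fun I => |c I|) (fun I _ => abs_nonneg _) (Finset.mem_univ I)).trans hM)⟩
  set m : Finset (Fin n) → ℝ := fun I => if I ∈ 𝓛 then M else 0 with hm
  have hmi : ∀ I, ∃ k : ℤ, m I = k := by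
    intro I
    simp only [hm]
    split_ifs
    exacts [⟨M, by simp⟩, ⟨0, by simp⟩]
  have hms : supp m ⊆ 𝓛 := by
    intro I hI
    by_contra hn
    exact mem_supp.1 hI (if_neg hn)
  have hd : IsCoord w a (c + m) := by
    refine ⟨fun I => ?_, h𝓛.mono (supp_add_subset hs hms)⟩
    by_cases hI : I ∈ 𝓛
    · rw [Pi.add_apply, hm]
      simp only [hI, if_true]
      linarith [hM I]
    · rw [Pi.add_apply, notMem_supp.1 fun h' => hI (hs h'), notMem_supp.1 fun h' => hI (hms h'),
        add_zero]
  have hdN : splitProj w a (c + m) ∈ edgeLattice (reducedWeightGraph w a) := by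
    rw [map_add]
    exact Submodule.add_mem _ hc (hint m hmi)
  obtain ⟨z, hz, hzd⟩ := mem_edgeLattice.1 hdN
  rw [splitProj_apply, ← sub_eq_zero, ← map_sub, Submodule.mkQ_apply,
    Submodule.Quotient.mk_eq_zero, mem_allOnes] at hzd
  obtain ⟨t, ht⟩ := hzd
  have h1 := (IsCoord.isExt h hpos hle ha hO hd (-t)).integral h hpos fun e => by
    obtain ⟨k, hk⟩ := hz e
    refine ⟨k, ?_⟩
    rw [splitMap_add_single_erase, ← hk, ← ht e, Pi.sub_apply]
    ring
  intro I
  have h2 : ∃ k : ℤ, (c + m) I = k := by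
    by_cases hI : I = Finset.univ.erase a
    · exact ⟨0, by rw [hI, hd.apply_erase hle, Int.cast_zero]⟩
    · obtain ⟨k, hk⟩ := h1 I
      rw [Pi.add_apply, Pi.single_eq_of_ne hI, add_zero] at hk
      exact ⟨k, hk⟩
  obtain ⟨k, hk⟩ := h2
  obtain ⟨l, hl⟩ := hmi I
  refine ⟨k - l, ?_⟩
  rw [Pi.add_apply, hl] at hk
  push_cast
  linarith

/-- The image of the moduli space is the Bergman fan. -/
lemma IsHeavyLight.image_splitProj (h : IsHeavyLight w) (hpos : ∀ i, 0 < w i)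
    (hle : ∀ i, w i ≤ 1) (ha : IsHeavy w a)
    [Nonempty (reducedWeightGraph w a).edgeSet] :
    splitProj w a '' {c | IsCoord w a c} = reducedBergmanFan (reducedWeightGraph w a) := by
  refine Set.Subset.antisymm ?_ ?_
  · rintro _ ⟨c, hc, rfl⟩
    exact ⟨_, splitMap_mem_bergmanFan _ hc.1 hc.2.2, rfl⟩
  · rintro _ ⟨x, hx, rfl⟩
    obtain ⟨c, hc, t, ht⟩ := exists_isCoord_of_mem_bergmanFan h hpos hle ha hx
    refine ⟨c, hc, ?_⟩
    rw [splitProj_apply, ← sub_eq_zero, ← map_sub, Submodule.mkQ_apply,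
      Submodule.Quotient.mk_eq_zero, mem_allOnes]
    exact ⟨t, fun e => by rw [Pi.sub_apply, ht]; ring⟩

lemma IsLam.isProperLaminar (hle : ∀ i, w i ≤ 1) {𝓛 : Finset (Finset (Fin n))}
    (h𝓛 : IsLam w a 𝓛) (hO : Big w a (Finset.univ.erase a)) :
    IsProperLaminar (Finset.univ.erase a) 𝓛 := by
  refine ⟨fun J hJ => ?_, fun J hJ => ?_, h𝓛.2, hO.2.1⟩
  · have h1 := (h𝓛.1 J hJ).one hle
    refine Finset.ssubset_iff_subset_ne.2 ⟨fun x hx => Finset.mem_erase.2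
      ⟨fun he => h1.1 (he ▸ hx), Finset.mem_univ _⟩, h1.ne_erase⟩
  · exact (adm_one_iff.1 ((h𝓛.1 J hJ).one hle)).2.1

/-- A new member of a laminar family: a set with at least three blocks, without one of them. -/
lemma IsHeavyLight.isLam_insert_sdiff (h : IsHeavyLight w) (hpos : ∀ i, 0 < w i)
    (hle : ∀ i, w i ≤ 1) (ha : IsHeavy w a) (hO : Big w a (Finset.univ.erase a))
    {𝓛 : Finset (Finset (Fin n))} (h𝓛 : IsLam w a 𝓛) {I β : Finset (Fin n)}
    (hI : I ∈ insert (Finset.univ.erase a) 𝓛) (h3 : 3 ≤ (blocks (Finset.univ.erase a) 𝓛 I).card)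
    (hβ : β ∈ blocks (Finset.univ.erase a) 𝓛 I) (hh : ∃ i ∈ I \ β, IsHeavy w i) :
    I \ β ∉ 𝓛 ∧ IsLam w a (insert (I \ β) 𝓛) := by
  have hP := h𝓛.isProperLaminar hle hO
  obtain ⟨h1, h2⟩ := hP.sdiff_notMem hI hβ h3
  have hsub : I \ β ⊆ Finset.univ.erase a :=
    Finset.sdiff_subset.trans (hP.mem_insert_subset hI).1
  have hadm : Adm w a (I \ β) := h.adm_of_big hpos hle ha
    ⟨fun h' => by simpa using hsub h', h1, hh⟩
    fun he => h2 (he ▸ Finset.mem_insert_self _ _)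
  refine ⟨fun h' => h2 (Finset.mem_insert_of_mem h'), fun J hJ => ?_, fun J hJ K hK => ?_⟩
  · rcases Finset.mem_insert.1 hJ with rfl | hJ
    exacts [hadm, h𝓛.1 J hJ]
  · rcases Finset.mem_insert.1 hJ with rfl | hJ
    · rcases Finset.mem_insert.1 hK with rfl | hK
      exacts [.inl subset_rfl, hP.compat_sdiff hI hβ hK]
    · rcases Finset.mem_insert.1 hK with rfl | hK
      exacts [(hP.compat_sdiff hI hβ hJ).symm, h𝓛.2 J hJ K hK]

lemma exists_heavy_of_mem (h : IsHeavyLight w) (hpos : ∀ i, 0 < w i) (hle : ∀ i, w i ≤ 1)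
    (ha : IsHeavy w a) (hO : Big w a (Finset.univ.erase a)) {𝓛 : Finset (Finset (Fin n))}
    (h𝓛 : IsLam w a 𝓛) {I : Finset (Fin n)} (hI : I ∈ insert (Finset.univ.erase a) 𝓛) :
    ∃ i ∈ I, IsHeavy w i := by
  rcases Finset.mem_insert.1 hI with rfl | hI
  · exact hO.2.2
  · exact (h.big hpos hle ha (h𝓛.1 I hI)).2.2

/-- Every laminar family of admissible sets can be extended to one with `n - 3` members. -/
lemma IsHeavyLight.exists_isLam_card_eq (h : IsHeavyLight w) (hpos : ∀ i, 0 < w i)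
    (hle : ∀ i, w i ≤ 1) (ha : IsHeavy w a) (hO : Big w a (Finset.univ.erase a))
    {𝓛 : Finset (Finset (Fin n))} (h𝓛 : IsLam w a 𝓛) :
    ∃ 𝓜, IsLam w a 𝓜 ∧ 𝓛 ⊆ 𝓜 ∧ 𝓜.card = n - 3 := by
  obtain ⟨𝓜, hsub, hmax⟩ := (Set.toFinite {𝓜 | IsLam w a 𝓜}).exists_le_maximal h𝓛
  have h𝓜 : IsLam w a 𝓜 := hmax.prop
  refine ⟨𝓜, h𝓜, hsub, ?_⟩
  have hP := h𝓜.isProperLaminar hle hO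
  have hU : (Finset.univ.erase a).card = n - 1 := by
    rw [Finset.card_erase_of_mem (Finset.mem_univ a), Finset.card_univ, Fintype.card_fin]
  have h1 := hP.card_le
  by_contra hne
  obtain ⟨I, hI, h3⟩ := hP.exists_three_le (by omega)
  obtain ⟨k, hk, hheavy⟩ := exists_heavy_of_mem h hpos hle ha hO h𝓜 hI
  obtain ⟨β, hβ, hkβ⟩ := hP.exists_block hI hk
  -- without a block that does not contain the heavy marking `k`, the set stays admissible
  obtain ⟨γ, hγ, hne⟩ := Finset.exists_mem_ne
    (by omega : 1 < (blocks (Finset.univ.erase a) 𝓜 I).card) β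
  have hkγ : k ∉ γ := fun h' => Finset.disjoint_left.1 (hP.block_disjoint hγ hβ hne) h' hkβ
  obtain ⟨h4, h5⟩ := h.isLam_insert_sdiff hpos hle ha hO h𝓜 hI h3 hγ
    ⟨k, Finset.mem_sdiff.2 ⟨hk, hkγ⟩, hheavy⟩
  exact h4 (hmax.le_of_ge h5 (Finset.subset_insert _ _) (Finset.mem_insert_self _ _))

/-- If `I` is the union of three blocks, then an edge in `I` either lies in one block, hence in two
of the three unions of two blocks, or it joins two blocks, and lies in exactly one of these. -/
lemma sum_negClique_sdiff (G : SimpleGraph (Others a)) {𝓛 : Finset (Finset (Fin n))}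
    (hP : IsProperLaminar (Finset.univ.erase a) 𝓛) {I : Finset (Fin n)}
    (hI : I ∈ insert (Finset.univ.erase a) 𝓛)
    (h3 : (blocks (Finset.univ.erase a) 𝓛 I).card = 3) :
    ∑ β ∈ blocks (Finset.univ.erase a) 𝓛 I, negClique G (I \ β) =
      negClique G I + ∑ β ∈ blocks (Finset.univ.erase a) 𝓛 I, negClique G β := by
  classical
  obtain ⟨β₁, β₂, β₃, h12, h13, h23, hB⟩ := Finset.card_eq_three.1 h3
  have hm : ∀ {β}, β = β₁ ∨ β = β₂ ∨ β = β₃ → β ∈ blocks (Finset.univ.erase a) 𝓛 I := by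
    intro β hβ
    rw [hB]
    simpa using hβ
  have hd12 := Finset.disjoint_left.1 (hP.block_disjoint (hm (.inl rfl)) (hm (.inr (.inl rfl))) h12)
  have hd13 := Finset.disjoint_left.1 (hP.block_disjoint (hm (.inl rfl)) (hm (.inr (.inr rfl))) h13)
  have hd23 := Finset.disjoint_left.1
    (hP.block_disjoint (hm (.inr (.inl rfl))) (hm (.inr (.inr rfl))) h23)
  have hIB : ∀ x, x ∈ I ↔ x ∈ β₁ ∨ x ∈ β₂ ∨ x ∈ β₃ := by
    intro x
    constructor
    · intro hx
      obtain ⟨β, hβ, hxβ⟩ := hP.exists_block hI hx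
      rw [hB] at hβ
      simp only [Finset.mem_insert, Finset.mem_singleton] at hβ
      rcases hβ with rfl | rfl | rfl <;> simp [hxβ]
    · rintro (hx | hx | hx)
      · exact (hP.block_ssubset (hm (.inl rfl))).subset hx
      · exact (hP.block_ssubset (hm (.inr (.inl rfl)))).subset hx
      · exact (hP.block_ssubset (hm (.inr (.inr rfl)))).subset hx
  have hsum : ∀ f : Finset (Fin n) → G.edgeSet → ℝ,
      ∑ β ∈ blocks (Finset.univ.erase a) 𝓛 I, f β = f β₁ + f β₂ + f β₃ := by
    intro f
    rw [hB, Finset.sum_insert (by simp [h12, h13]), Finset.sum_insert (by simp [h23]),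
      Finset.sum_singleton, add_assoc]
  rw [hsum, hsum]
  funext ⟨e, he⟩
  induction e using Sym2.ind with
  | _ k l =>
  have hnc : ∀ J : Finset (Fin n), negClique G J ⟨s(k, l), he⟩ =
      if k.1 ∈ J ∧ l.1 ∈ J then -1 else 0 := by
    intro J
    simp only [negClique, Sym2.mem_iff, forall_eq_or_imp, forall_eq]
  simp only [Pi.add_apply, hnc, Finset.mem_sdiff, hIB]
  have k12 := @hd12 k.1
  have k13 := @hd13 k.1
  have k23 := @hd23 k.1
  have l12 := @hd12 l.1
  have l13 := @hd13 l.1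
  have l23 := @hd23 l.1
  by_cases k1 : k.1 ∈ β₁
  · have k2 := k12 k1
    have k3 := k13 k1
    by_cases l1 : l.1 ∈ β₁
    · simp [k1, k2, k3, l1, l12 l1, l13 l1]
    · by_cases l2 : l.1 ∈ β₂
      · simp [k1, k2, k3, l1, l2, l23 l2]
      · by_cases l3 : l.1 ∈ β₃ <;> simp [k1, k2, k3, l1, l2, l3]
  · by_cases k2 : k.1 ∈ β₂
    · have k3 := k23 k2
      by_cases l1 : l.1 ∈ β₁
      · simp [k1, k2, k3, l1, l12 l1, l13 l1]
      · by_cases l2 : l.1 ∈ β₂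
        · simp [k1, k2, k3, l1, l2, l23 l2]
        · by_cases l3 : l.1 ∈ β₃ <;> simp [k1, k2, k3, l1, l2, l3]
    · by_cases k3 : k.1 ∈ β₃
      · by_cases l1 : l.1 ∈ β₁
        · simp [k1, k2, k3, l1, l12 l1, l13 l1]
        · by_cases l2 : l.1 ∈ β₂
          · simp [k1, k2, k3, l1, l2, l23 l2]
          · by_cases l3 : l.1 ∈ β₃
            · simp [k1, k2, k3, l1, l2, l3]
            · simp [k1, k2, k3, l1, l2, l3]
      · simp [k1, k2, k3]

/-- The balancing condition: the new members of a family that lacks one member are the sets `I \ β`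
for the blocks `β` of the unique set `I` with three blocks. -/
lemma IsHeavyLight.sum_splitProj_mem (h : IsHeavyLight w) (hpos : ∀ i, 0 < w i)
    (hle : ∀ i, w i ≤ 1) (ha : IsHeavy w a) (hO : Big w a (Finset.univ.erase a))
    {𝓛 : Finset (Finset (Fin n))} (h𝓛 : IsLam w a 𝓛) (hcard : 𝓛.card + 1 = n - 3) :
    ∑ᶠ J ∈ {J | J ∉ 𝓛 ∧ IsLam w a (insert J 𝓛)}, splitProj w a (Pi.single J 1) ∈
      lamSpan (splitProj w a) 𝓛 := by
  classical
  have hP := h𝓛.isProperLaminar hle hO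
  set U : Finset (Fin n) := Finset.univ.erase a with hUdef
  have hU : U.card = n - 1 := by
    rw [Finset.card_erase_of_mem (Finset.mem_univ a), Finset.card_univ, Fintype.card_fin]
  obtain ⟨I, hI, h3, h2⟩ := hP.exists_unique_three (by omega)
  set B := blocks U 𝓛 I with hB
  have hinj : Set.InjOn (fun β => I \ β) (B : Set (Finset (Fin n))) := by
    intro β hβ γ hγ he
    rw [← Finset.sdiff_sdiff_eq_self (hP.block_ssubset hβ).subset,
      ← Finset.sdiff_sdiff_eq_self (hP.block_ssubset hγ).subset]
    exact congrArg (I \ ·) he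
  have hset : {J | J ∉ 𝓛 ∧ IsLam w a (insert J 𝓛)} =
      (((B.filter fun β => ∃ i ∈ I \ β, IsHeavy w i).image fun β => I \ β :
        Finset (Finset (Fin n))) : Set (Finset (Fin n))) := by
    ext J
    simp only [Set.mem_ofPred_eq, Finset.coe_image, Set.mem_image, Finset.mem_coe,
      Finset.mem_filter]
    constructor
    · rintro ⟨hJ, hJL⟩
      have hadm := hJL.1 J (Finset.mem_insert_self _ _)
      have hJ1 : 1 < J.card := (adm_one_iff.1 (hadm.one hle)).2.1
      have hPJ := (hJL.isProperLaminar hle hO).ssubset J (Finset.mem_insert_self _ _)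
      have hpar : par U 𝓛 J ∈ insert U 𝓛 :=
        par_mem_insert (Finset.card_pos.1 (by omega)) (fun J => hP.subset_top) hP.compat
      have hle3 : (blocks U 𝓛 (par U 𝓛 J)).card ≤ 3 := by
        by_cases he : par U 𝓛 J = I
        · rw [he, ← hB, h3]
        · rw [h2 _ hpar he]
          norm_num
      obtain ⟨h4, β, hβ, hJβ⟩ := hP.eq_sdiff_of_compat hJ1 hPJ hJ
        (fun K hK => hJL.2 J (Finset.mem_insert_self _ _) K (Finset.mem_insert_of_mem hK)) hle3
      have he : par U 𝓛 J = I := by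
        by_contra he
        rw [h2 _ hpar he] at h4
        omega
      rw [he] at hβ hJβ
      refine ⟨β, ⟨hβ, ?_⟩, hJβ.symm⟩
      rw [← hJβ]
      exact (h.big hpos hle ha hadm).2.2
    · rintro ⟨β, ⟨hβ, hh⟩, rfl⟩
      exact h.isLam_insert_sdiff hpos hle ha hO h𝓛 hI h3.ge hβ hh
  have hsingle : ∀ J : Finset (Fin n), splitProj w a (Pi.single J 1) =
      (allOnes _).mkQ (negClique (reducedWeightGraph w a) J) := by
    intro J
    rw [splitProj_apply, splitMap_single, one_smul]
  have hmem : ∀ J ∈ 𝓛, splitProj w a (Pi.single J 1) ∈ lamSpan (splitProj w a) 𝓛 := fun J hJ =>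
    mem_lamSpan (by rw [supp_single]; exact Finset.singleton_subset_iff.2 hJ)
  -- the sets `I \ β` without heavy markings contribute nothing, so all blocks may be included
  rw [hset, finsum_mem_coe_finset, Finset.sum_image fun β hβ γ hγ he =>
    hinj (Finset.mem_filter.1 hβ).1 (Finset.mem_filter.1 hγ).1 he,
    Finset.sum_filter_of_ne fun β _ hne => by
      by_contra! hh
      exact hne (h.splitProj_eq_zero hpos hh)]
  simp only [hsingle]
  rw [← map_sum, sum_negClique_sdiff _ hP hI h3, map_add, map_sum]
  refine Submodule.add_mem _ ?_ (Submodule.sum_mem _ fun β hβ => ?_)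
  · rcases Finset.mem_insert.1 hI with rfl | hI
    · rw [negClique_erase, Submodule.mkQ_apply,
        (Submodule.Quotient.mk_eq_zero _).2 (mem_allOnes.2 ⟨-1, fun _ => rfl⟩)]
      exact Submodule.zero_mem _
    · rw [← hsingle]
      exact hmem I hI
  · rcases IsProperLaminar.mem_cases (Finset.mem_filter.1 hβ).1 with h1 | ⟨k, -, rfl⟩
    · rw [← hsingle]
      exact hmem β h1
    · rw [negClique_singleton, map_zero]
      exact Submodule.zero_mem _

end

end WeightedTrop

end

open WeightedTrop
theorem mainTheorem1 {n : ℕ} (w : Fin n → ℚ)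
    (hpos : ∀ i, 0 < w i) (hle : ∀ i, w i ≤ 1) (hsum : 2 < ∑ i, w i)
    (hheavy : ∃ a b : Fin n, a ≠ b ∧ IsHeavy w a ∧ IsHeavy w b) :
    (IsHeavyLight w → ∀ a : Fin n, IsHeavy w a →
      prW w a '' (distMap n '' MTrop 1) = reducedBergmanFan (reducedWeightGraph w a) ∧
      support (projectedFan w a) = reducedBergmanFan (reducedWeightGraph w a) ∧
      IsUnderlyingComplex w (fun c => prW w a (distMap n c))
        (edgeLattice (reducedWeightGraph w a)) (projectedFan w a) ∧
      IsTropicalFan (edgeLattice (reducedWeightGraph w a)) (projectedFan w a) (n - 3)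
        (fun _ => 1)) ∧
    (¬ IsHeavyLight w → ∀ (V : Type*) [AddCommGroup V] [Module ℝ V],
      ¬ HasBalancedEmbedding w V) := by
  obtain ⟨a₀, b₀, hab₀, ha₀, hb₀⟩ := hheavy
  refine ⟨fun h a ha => ?_, fun hw V _ _ =>
    not_hasBalancedEmbedding hpos hle hsum hab₀ ha₀ hb₀ hw⟩
  obtain ⟨b, hba, hb⟩ : ∃ b, b ≠ a ∧ IsHeavy w b := by
    by_cases h0 : a₀ = a
    · exact ⟨b₀, fun he => hab₀ (h0.trans he.symm), hb₀⟩
    · exact ⟨a₀, h0, ha₀⟩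
  have hO := big_erase hle hsum hba hb
  obtain ⟨c, hca, hcb⟩ := exists_third hle hsum a b
  have : Nonempty (reducedWeightGraph w a).edgeSet :=
    ⟨⟨s(⟨b, hba⟩, ⟨c, hca⟩), (SimpleGraph.mem_edgeSet _).2 ((h.adj_iff hpos).2
      ⟨fun he => hcb (congrArg Subtype.val he).symm, .inl hb⟩)⟩⟩
  have hψ := h.injOn_splitProj hpos hle ha hO
  have hint := fun 𝓛 (h𝓛 : IsLam w a 𝓛) =>
    h.splitProj_mem_edgeLattice_iff hpos hle ha hO h𝓛
  have himage := h.image_splitProj hpos hle ha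
  have hfan := h.projectedFan_eq hpos hle hsum ha
  refine ⟨?_, ?_, ?_, ?_⟩
  · rw [Set.image_image]
    refine Set.Subset.antisymm ?_ ?_
    · rintro _ ⟨_, ⟨C, hC, rfl⟩, rfl⟩
      have hc := TropCurve.isCoord_coord (r := a) hC fun _ => zero_le_one
      simp only
      rw [prW_distMap]
      exact ⟨_, splitMap_mem_bergmanFan _ hc.1 hc.2.2, rfl⟩
    · rw [← himage, ← image_mTrop (φ := fun c => prW w a (distMap n c)) hpos hle hsum
        fun C _ => prW_distMap w a C]
      refine Set.image_mono ?_
      rintro _ ⟨C, hC, rfl⟩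
      exact ⟨C, hC.one hle, rfl⟩
  · rw [hfan, support_lamCone, himage]
  · rw [hfan]
    exact isUnderlyingComplex_lamCone hpos hle hsum (fun C _ => prW_distMap w a C) hψ hint
  · rw [hfan]
    exact isTropicalFan_lamCone hψ isLattice_edgeLattice hint
      (fun 𝓛 h𝓛 => h.exists_isLam_card_eq hpos hle ha hO h𝓛)
      fun 𝓛 h𝓛 => h.sum_splitProj_mem hpos hle ha hO h𝓛
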